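/- Let $L$ be a homogeneous Lévy basis on $\mathbb R^2$ with characteristic triplet $(\gamma,b,\nu)$: a family $(L(A))$ of real random variables indexed by the Borel sets $A\subseteq\mathbb R^2$ of finite Lebesgue measure which is a.s. $\sigma$-additive, independently scattered (values on disjoint sets are independent), and satisfies $\log E\,e^{izL(A)}=\mathrm{Leb}(A)\psi(z)$ with $\psi(z)=i\gamma z-\tfrac12b^2z^2+\int_{\mathbb R\setminus\{0\}}(e^{izx}-1-izx\mathbf 1_{|x|\le1})\,\nu(dx)$, where $\gamma\in\mathbb R$, $b\ge0$ and $\nu$ is a Lévy measure. Let its Lévy seed $L'$ be a random variable with characteristic function $e^{\psi}$. Assume $\mathrm{Var}(L')=1$ and $E|L'|^{p_0}<\infty$ for some $p_0\ge16/3$, and put $c_4(L')=\int x^4\,\nu(dx)$. Let $a:[0,\infty)\to[0,\infty)$ be a trawl function (continuous, non-increasing, integrable) such that $a(s)=\int_s^\infty\phi(y)\,dy$ for $s\ge0$, where $\phi$ is strictly positive and continuous on $[0,\infty)$ and $\phi(s)=O(s^{-\alpha-1})$ as $s\to\infty$ for some $\alpha>1$. Let $X_t=L(A_t)$ be the trawl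 process, with $A_t=A+(t,0)$ and $A=\{(r,y):r\le0,\ 0\le y\le a(-r)\}$. Let $\Delta_n\downarrow0$ ($\Delta_n>0$), $n\Delta_n\to\infty$ and $n\Delta_n^3\to\mu\in[0,\infty)$. Let $N_n\in\mathbb N$ satisfy $N_n\to\infty$, $N_n\Delta_n\to\infty$ and $N_n/n\to0$. From the observations $(X_{k\Delta_n})_{k=0}^{n-1}$ form $\delta_kX=X_{(k+1)\Delta_n}-X_{k\Delta_n}$, $\bar X_n=\frac1n\sum_{k=0}^{n-1}X_{k\Delta_n}$ and $$\hat\Gamma_l=\frac1n\sum_{k=0}^{n-1-l}(X_{(l+k)\Delta_n}-\bar X_n)(X_{k\Delta_n}-\bar X_n),\qquad Q_n=\frac1{2n\Delta_n}\sum_{k=0}^{n-2}(\delta_kX)^4,$$ $$\hat a(0)=\frac1{2n\Delta_n}\sum_{k=0}^{n-2}(\delta_kX)^2,\qquad \hat a(t)=-\Delta_n^{-1}\bigl[\hat\Gamma_{l+1}-\hat\Gamma_l\bigr]\quad\text{for }t>0,\ l\Delta_n\le t<(l+1)\Delta_n .$$ For $t>0$ and $i=\lfloor t/\Delta_n\rfloor$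 put $$\hat v_1(t)=\frac{Q_n}{\hat a(0)}\,\hat a(t),\qquad \hat v_2(t)=2\sum_{l=0}^{N_n}\hat a(l\Delta_n)^2\Delta_n,$$ $$\hat v_3(t)=2\sum_{l=0}^{\min\{i,n-1-i\}}\hat a((i-l)\Delta_n)\,\hat a((i+l)\Delta_n)\Delta_n,\qquad \hat v_4(t)=-2\sum_{l=i}^{N_n-i}\hat a((l-i)\Delta_n)\,\hat a((i+l)\Delta_n)\Delta_n,$$ the last sum being $0$ if $N_n-i<i$, and $\widehat{\sigma_a^2}(t)=\hat v_1(t)+\hat v_2(t)+\hat v_3(t)+\hat v_4(t)$. Then for every $t>0$, as $n\to\infty$, $\widehat{\sigma_a^2}(t)\to\sigma_a^2(t)$ in probability, where $$\sigma_a^2(t)=c_4(L')a(t)+2\left\{\int_0^\infty a(s)^2ds+\int_0^t a(t-s)a(t+s)\,ds-\int_t^\infty a(s-t)a(t+s)\,ds\right\}.$$ -/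

import Mathlib

open MeasureTheory ProbabilityTheory Filter Topology

noncomputable section

namespace Trawl

/-- A characteristic triplet `(γ, b, ν)`: a drift, a Gaussian coefficient `b ≥ 0` and a
Lévy measure `ν` on `ℝ`. -/
structure LevyTriplet where
  γ : ℝ
  b : ℝ
  ν : Measure ℝ
  b_nonneg : 0 ≤ b
  ν_zero : ν {0} = 0
  ν_levy : ∫⁻ x, ENNReal.ofReal (min 1 (x ^ 2)) ∂ν < ⊤

/-- The characteristic exponent
`ψ(z) = iγz - b²z²/2 + ∫_{ℝ∖{0}} (e^{izx} - 1 - izx 1_{|x| ≤ 1}) ν(dx)`. -/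
def LevyTriplet.exponent (T : LevyTriplet) (z : ℝ) : ℂ :=
  Complex.I * T.γ * z - (1 / 2 : ℂ) * (T.b : ℂ) ^ 2 * (z : ℂ) ^ 2
    + ∫ x in ({0}ᶜ : Set ℝ),
        (Complex.exp (Complex.I * z * x) - 1
          - Complex.I * z * x * Set.indicator {y : ℝ | |y| ≤ 1} (fun _ => (1 : ℂ)) x) ∂T.ν

/-- `c₄(L') = ∫ x⁴ ν(dx)`. -/
def LevyTriplet.c4 (T : LevyTriplet) : ℝ := ∫ x, x ^ 4 ∂T.ν

/-- `Z` is a Lévy seed with triplet `T`: a random variable whose law is the infinitely divisible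
law with characteristic function `exp ψ`. -/
structure IsLevySeed {Ω : Type*} [MeasurableSpace Ω] (P : Measure Ω) (T : LevyTriplet)
    (Z : Ω → ℝ) : Prop where
  measurable : Measurable Z
  charFun_eq : ∀ z : ℝ, charFun (P.map Z) z = Complex.exp (T.exponent z)

/-- The index sets of a homogeneous Lévy basis on `ℝ²`: Borel sets of finite Lebesgue measure. -/
def IsBoundedBorel (A : Set (ℝ × ℝ)) : Prop := MeasurableSet A ∧ volume A < ⊤

/-- `L` is a homogeneous Lévy basis on `ℝ²` with characteristic triplet `T`: an independently
scattered, almost surely `σ`-additive family of random variables indexed by the Borel sets of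
finite Lebesgue measure (its values on other sets play no role), with cumulants
`log E exp(i z L(A)) = Leb(A) ψ(z)`, so that each `L(A)` is infinitely divisible. The series in
the `σ`-additivity is the limit of its partial sums; it need not converge absolutely. -/
structure IsHomogeneousLevyBasis {Ω : Type*} [MeasurableSpace Ω] (P : Measure Ω)
    (T : LevyTriplet) (L : Set (ℝ × ℝ) → Ω → ℝ) : Prop where
  measurable : ∀ A, IsBoundedBorel A → Measurable (L A)
  sigma_additive : ∀ A : ℕ → Set (ℝ × ℝ), (∀ k, IsBoundedBorel (A k)) →
    Pairwise (Function.onFun Disjoint A) → IsBoundedBorel (⋃ k, A k) →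
    ∀ᵐ ω ∂P, Tendsto (fun m : ℕ => ∑ k ∈ Finset.range m, L (A k) ω) atTop
      (𝓝 (L (⋃ k, A k) ω))
  indep : ∀ A : ℕ → Set (ℝ × ℝ), (∀ k, IsBoundedBorel (A k)) →
    Pairwise (Function.onFun Disjoint A) → iIndepFun (fun k => L (A k)) P
  charFun_eq : ∀ A, IsBoundedBorel A → ∀ z : ℝ,
    charFun (P.map (L A)) z = Complex.exp (((volume A).toReal : ℂ) * T.exponent z)

/-- A trawl function: a continuous, non-increasing, integrable function `[0,∞) → [0,∞)`. It is
represented by a function on `ℝ` of which only the values on `[0,∞)` matter. -/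
structure IsTrawlFunction (a : ℝ → ℝ) : Prop where
  continuousOn : ContinuousOn a (Set.Ici 0)
  antitoneOn : AntitoneOn a (Set.Ici 0)
  nonneg : ∀ s, 0 ≤ s → 0 ≤ a s
  integrableOn : IntegrableOn a (Set.Ici 0)

/-- The trawl set `A = {(r, y) : r ≤ 0, 0 ≤ y ≤ a(-r)}`. -/
def trawlSet (a : ℝ → ℝ) : Set (ℝ × ℝ) := {p | p.1 ≤ 0 ∧ 0 ≤ p.2 ∧ p.2 ≤ a (-p.1)}

/-- The shifted trawl set `A_t = A + (t, 0)`. -/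
def trawlSetAt (a : ℝ → ℝ) (t : ℝ) : Set (ℝ × ℝ) := {p | (p.1 - t, p.2) ∈ trawlSet a}

/-- The trawl process `X_t = L(A_t)`. -/
def trawlProcess {Ω : Type*} (L : Set (ℝ × ℝ) → Ω → ℝ) (a : ℝ → ℝ) (t : ℝ) (ω : Ω) : ℝ :=
  L (trawlSetAt a t) ω

/-- The trawl function is `a(s) = ∫_s^∞ φ(y) dy` on `[0,∞)` with `φ` strictly positive, continuous
on `[0,∞)`, and `φ(s) = O(s^{-α-1})` as `s → ∞` for some `α > 1`. -/
def TrawlCondition (a : ℝ → ℝ) : Prop :=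
  ∃ φ : ℝ → ℝ, ContinuousOn φ (Set.Ici 0) ∧ (∀ s, 0 ≤ s → 0 < φ s) ∧
    (∃ α : ℝ, 1 < α ∧ φ =O[atTop] (fun s : ℝ => s ^ (-α - 1))) ∧
    ∀ s, 0 ≤ s → a s = ∫ y in Set.Ioi s, φ y

/-- The sampling scheme: `Δ_n → 0` through positive values, `nΔ_n → ∞` and `nΔ_n³ → μ < ∞`. -/
structure SamplingScheme (Δ : ℕ → ℝ) (μ : ℝ) : Prop where
  tendsto_zero : Tendsto Δ atTop (𝓝[>] 0)
  tendsto_span : Tendsto (fun n : ℕ => (n : ℝ) * Δ n) atTop atTop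
  tendsto_cube : Tendsto (fun n : ℕ => (n : ℝ) * Δ n ^ 3) atTop (𝓝 μ)

/-- The tuning parameter: `N_n → ∞`, `N_n Δ_n → ∞` and `N_n / n → 0`. -/
structure TuningCondition (Δ : ℕ → ℝ) (N : ℕ → ℕ) : Prop where
  tendsto_top : Tendsto N atTop atTop
  tendsto_span : Tendsto (fun n : ℕ => (N n : ℝ) * Δ n) atTop atTop
  tendsto_ratio : Tendsto (fun n : ℕ => (N n : ℝ) / (n : ℝ)) atTop (𝓝 0)

/-! Statistics of the observations `x k = X_{kΔ}`, `k = 0, …, n - 1`. -/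

/-- The sample mean. -/
def sampleMean (x : ℕ → ℝ) (n : ℕ) : ℝ := (1 / (n : ℝ)) * ∑ k ∈ Finset.range n, x k

/-- The sample autocovariance at lag `l`; the sum runs over `k = 0, …, n - 1 - l`. -/
def sampleAutocov (x : ℕ → ℝ) (n l : ℕ) : ℝ :=
  (1 / (n : ℝ)) * ∑ k ∈ Finset.range (n - l),
    (x (l + k) - sampleMean x n) * (x k - sampleMean x n)

/-- The index `i` with `iΔ ≤ t < (i+1)Δ` (for `Δ > 0`, `t ≥ 0`). -/
def gridIndex (Δ t : ℝ) : ℕ := ⌊t / Δ⌋₊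

/-- The estimator `â(t)` of the trawl function: the averaged realised variance at `t = 0`, and a
difference quotient of the sample autocovariance, with `lΔ ≤ t < (l+1)Δ`, for `t > 0`. -/
def trawlEst (x : ℕ → ℝ) (n : ℕ) (Δ t : ℝ) : ℝ :=
  if t = 0 then
    (1 / (2 * Δ * n)) * ∑ k ∈ Finset.range (n - 1), (x (k + 1) - x k) ^ 2
  else
    -(1 / Δ) * (sampleAutocov x n (gridIndex Δ t + 1) - sampleAutocov x n (gridIndex Δ t))

/-- The quarticity `Q_n`. -/
def quarticity (x : ℕ → ℝ) (n : ℕ) (Δ : ℝ) : ℝ :=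
  (1 / (2 * Δ * n)) * ∑ k ∈ Finset.range (n - 1), (x (k + 1) - x k) ^ 4

/-- The estimator `Q_n / â(0)` of `c₄(L')`. -/
def c4Est (x : ℕ → ℝ) (n : ℕ) (Δ : ℝ) : ℝ := quarticity x n Δ / trawlEst x n Δ 0

/-- The estimator of `c₄(L') a(t)`. -/
def v1 (x : ℕ → ℝ) (n : ℕ) (Δ t : ℝ) : ℝ := c4Est x n Δ * trawlEst x n Δ t

/-- The estimator of `2 ∫_0^∞ a(s)² ds`. -/
def v2 (x : ℕ → ℝ) (n : ℕ) (Δ : ℝ) (N : ℕ) : ℝ :=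
  2 * ∑ l ∈ Finset.Icc 0 N, trawlEst x n Δ (l * Δ) ^ 2 * Δ

/-- The estimator of `2 ∫_0^t a(t-s) a(t+s) ds`, where `iΔ ≤ t < (i+1)Δ`. -/
def v3 (x : ℕ → ℝ) (n : ℕ) (Δ t : ℝ) : ℝ :=
  2 * ∑ l ∈ Finset.Icc 0 (min (gridIndex Δ t) (n - 1 - gridIndex Δ t)),
    trawlEst x n Δ (((gridIndex Δ t : ℝ) - l) * Δ) *
      trawlEst x n Δ (((gridIndex Δ t : ℝ) + l) * Δ) * Δ

/-- The estimator of `-2 ∫_t^∞ a(s-t) a(t+s) ds`, where `iΔ ≤ t < (i+1)Δ`; the sum is `0` when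
`N - i < i`. -/
def v4 (x : ℕ → ℝ) (n : ℕ) (Δ : ℝ) (N : ℕ) (t : ℝ) : ℝ :=
  -(2 * ∑ l ∈ Finset.Icc (gridIndex Δ t) (N - gridIndex Δ t),
    trawlEst x n Δ (((l : ℝ) - gridIndex Δ t) * Δ) *
      trawlEst x n Δ (((gridIndex Δ t : ℝ) + l) * Δ) * Δ)

/-- The plug-in estimator of the asymptotic variance. -/
def avarEst (x : ℕ → ℝ) (n : ℕ) (Δ : ℝ) (N : ℕ) (t : ℝ) : ℝ :=
  v1 x n Δ t + v2 x n Δ N + v3 x n Δ t + v4 x n Δ N t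

/-- The asymptotic variance `σ_a²(t)`, `t > 0`. -/
def avar (T : LevyTriplet) (a : ℝ → ℝ) (t : ℝ) : ℝ :=
  T.c4 * a t + 2 * ((∫ s in Set.Ioi (0 : ℝ), a s ^ 2) + (∫ s in (0 : ℝ)..t, a (t - s) * a (t + s))
    - ∫ s in Set.Ioi t, a (s - t) * a (t + s))

end Trawl

end

/-! The estimator does not change when a constant is subtracted from the data (`avarEst_sub_const`),
so `L` may be replaced by its centred version. An increment of the trawl process is X(gain) -
X(loss): the gains at different times are disjoint, so are the losses, and all of them have the same
area v, with v / Δ → a(0). Hence everything reduces to an independently scattered centred random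
measure X, whose required properties are collected in `IsCenteredBasis`.

Three facts about moments carry the proof: E X(A)² = |A|; E|X(A)|⁵ ≤ K|A| for |A| ≤ 1; and E X(A)⁴ =
c₄|A| + o(|A|) as |A| → 0. The fifth moment bound holds because the fifth absolute central moment is
superadditive under convolution, up to a constant factor. For the fourth moment, X is symmetrised
and x⁴ is replaced by a bounded fourth difference of exponentials of step h, whose mean is explicit
in the exponent ψ. The error is at most a constant times h|A|, by the fifth moment bound, so the
limits |A| → 0 and h → 0 may be exchanged (`tendsto_fourth_moment`).

For the trawl function, n(Γ̂_l - Γ̂_{l+1}) is Σ X_k (X_{k+l} - X_{k+l+1}) plus a remainder with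
bounded second moment. Each summand has mean |A_k ∩ loss_{k+l}| = ∫ a over [lΔ, (l+1)Δ]. Since the
losses are disjoint, the covariances are given by Wick's formula without a cumulant term, and they
sum geometrically. This gives a mean square error of order 1/(nΔ), uniformly in the lag, plus a bias
(`integral_trawlEst_sub_sq_le`). Summed over the lags up to N_n it tends to zero, because N_n/n → 0
and the discretisation bias telescopes by monotonicity of a. By Cauchy–Schwarz this empirical L²
consistency passes to the quadratic functionals `v2`, `v3`, `v4`, whose deterministic counterparts
are Riemann sums.

For `v1`, the quarticity is a sum of fourth powers of gains and losses up to negligible cross terms.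
A truncated weak law, which needs only fifth moments, gives Q_n → c₄ a(0). Division by â(0) → a(0) >
0 and multiplication by â(t) finish the proof. -/

namespace Trawl

/-! ### Moments along a convolution semigroup: variance and fifth absolute moment -/

section ConvolutionSemigroup

/-- Uniform convexity of |·|⁵: the tangent line inequality at r with a remainder. In mean, for
independent centred u, the linear term disappears and a share of E|u|⁵ is gained. The value 1/8 is
not essential; only its positivity is. -/
theorem le_abs_add_pow_five (r u : ℝ) :
    |r| ^ 5 + 5 * (r * |r| ^ 3) * u + |u| ^ 5 / 8 ≤ |r + u| ^ 5 := by
  wlog hr : 0 ≤ r generalizing r u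
  · have := this (-r) (-u) (by linarith)
    rw [abs_neg, abs_neg, ← neg_add, abs_neg] at this
    linarith
  rw [abs_of_nonneg hr]
  rcases le_total 0 u with hu | hu
  · rw [abs_of_nonneg hu, abs_of_nonneg (by positivity)]
    have : 0 ≤ 10*r^3*u^2+10*r^2*u^3+5*r*u^4 + 7/8*u^5 := by positivity
    nlinarith
  obtain ⟨s, rfl⟩ : ∃ s, u = -s := ⟨-u, by ring⟩
  have hs : 0 ≤ s := by linarith
  rw [abs_neg, abs_of_nonneg hs]
  rcases le_total s r with h | h
  · rw [abs_of_nonneg (by linarith)]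
    obtain ⟨d, rfl⟩ : ∃ d, r = s + d := ⟨r - s, by ring⟩
    have hd : 0 ≤ d := by linarith
    have : 0 ≤ s^2 * (10*d^3+20*d^2*s+15*d*s^2+ 31/8*s^3) := by positivity
    nlinarith
  · rw [abs_of_nonpos (by linarith)]
    obtain ⟨d, rfl⟩ : ∃ d, s = r + d := ⟨s - r, by ring⟩
    have hd : 0 ≤ d := by linarith
    -- The claim is now that a quintic form in r, d ≥ 0 is nonnegative; these products serve as
    -- certificates.
    have h1 : 0 ≤ r^2*d*(r-d)^2 := by positivity
    have h2 : 0 ≤ d^3*(3*r-5*d)^2 := by positivity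
    have h3 : 0 ≤ d*(11*r^2-3*d^2)^2 := by positivity
    have h4 : 0 ≤ r^5 := by positivity
    have h5 : 0 ≤ r^4*d := by positivity
    have h6 : 0 ≤ d^5 := by positivity
    nlinarith

theorem abs_add_pow_five_le (x y : ℝ) : |x + y| ^ 5 ≤ 16 * (|x| ^ 5 + |y| ^ 5) :=
  (pow_le_pow_left₀ (abs_nonneg _) (abs_add_le x y) 5).trans
    ((add_pow_le (abs_nonneg x) (abs_nonneg y) 5).trans (by norm_num))

theorem integral_fst_prod {μ ν : Measure ℝ} [IsProbabilityMeasure μ] [IsProbabilityMeasure ν]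
    (f : ℝ → ℝ) : ∫ p, f p.1 ∂μ.prod ν = ∫ x, f x ∂μ := by
  simp [integral_fun_fst]

theorem integral_snd_prod {μ ν : Measure ℝ} [IsProbabilityMeasure μ] [IsProbabilityMeasure ν]
    (f : ℝ → ℝ) : ∫ p, f p.2 ∂μ.prod ν = ∫ x, f x ∂ν := by
  simp [integral_fun_snd]

theorem integral_conv_eq {μ ν : Measure ℝ} {f : ℝ → ℝ} (hf : Measurable f) :
    ∫ x, f x ∂(μ ∗ ν) = ∫ p, f (p.1 + p.2) ∂μ.prod ν :=
  integral_map (by fun_prop) hf.aestronglyMeasurable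

theorem memLp_conv {μ ν : Measure ℝ} [IsProbabilityMeasure μ] [IsProbabilityMeasure ν]
    {p : ENNReal} (hμ : MemLp id p μ) (hν : MemLp id p ν) : MemLp id p (μ ∗ ν) := by
  refine (memLp_map_measure_iff (by fun_prop) (by fun_prop)).2 ?_
  exact (hμ.comp_fst ν).add (hν.comp_snd μ)

/-- By Fubini, x + y is in L^p(μ) for almost every fixed y, and a constant can be subtracted. -/
theorem memLp_of_conv {μ ν : Measure ℝ} [IsProbabilityMeasure μ] [IsProbabilityMeasure ν]
    {p : ENNReal} (h : MemLp id p (μ ∗ ν)) (hp0 : p ≠ 0) (hp : p ≠ ⊤) : MemLp id p μ := by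
  have h1 := (memLp_map_measure_iff (by fun_prop) (by fun_prop)).1 h
  have h2 := (h1.integrable_norm_rpow hp0 hp).prod_left_ae
  obtain ⟨y, hy⟩ := h2.exists
  have h3 : MemLp (fun x : ℝ => x + y) p μ :=
    (integrable_norm_rpow_iff (by fun_prop) hp0 hp).1 hy
  have h4 := h3.sub (memLp_const y)
  refine h4.ae_eq (ae_of_all _ fun x => ?_)
  simp

/-- The mean of a law on the real line. -/
noncomputable def mean (μ : Measure ℝ) : ℝ := ∫ x, x ∂μ

/-- The fifth absolute central moment of a law on the real line. -/
noncomputable def absCentralMomentFive (μ : Measure ℝ) : ℝ := ∫ x, |x - mean μ| ^ 5 ∂μ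

theorem mean_conv {μ ν : Measure ℝ} [IsProbabilityMeasure μ] [IsProbabilityMeasure ν]
    (hμ : Integrable id μ) (hν : Integrable id ν) : mean (μ ∗ ν) = mean μ + mean ν := by
  have hμ' : Integrable (fun x : ℝ => x) μ := hμ
  have hν' : Integrable (fun x : ℝ => x) ν := hν
  unfold mean
  rw [integral_conv_eq measurable_id', integral_add (hμ'.comp_fst ν) (hν'.comp_snd μ),
    integral_fst_prod (fun x => x), integral_snd_prod (fun x => x)]

theorem variance_id_conv {μ ν : Measure ℝ} [IsProbabilityMeasure μ] [IsProbabilityMeasure ν]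
    (hμ : MemLp id 2 μ) (hν : MemLp id 2 ν) : Var[id; μ ∗ ν] = Var[id; μ] + Var[id; ν] := by
  have h1 : IndepFun (fun p : ℝ × ℝ => p.1) (fun p => p.2) (μ.prod ν) :=
    indepFun_prod measurable_id measurable_id
  have h2 := h1.variance_add (hμ.comp_fst ν) (hν.comp_snd μ)
  have h3 := variance_map (X := id) (Y := fun p : ℝ × ℝ => p.1) (μ := μ.prod ν)
    measurable_id.aemeasurable measurable_fst.aemeasurable
  have h4 := variance_map (X := id) (Y := fun p : ℝ × ℝ => p.2) (μ := μ.prod ν)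
    measurable_id.aemeasurable measurable_snd.aemeasurable
  have h5 := variance_map (X := id) (Y := fun p : ℝ × ℝ => p.1 + p.2) (μ := μ.prod ν)
    measurable_id.aemeasurable (measurable_fst.add measurable_snd).aemeasurable
  rw [show (μ.prod ν).map (fun p : ℝ × ℝ => p.1) = μ from Measure.fst_prod] at h3
  rw [show (μ.prod ν).map (fun p : ℝ × ℝ => p.2) = ν from Measure.snd_prod] at h4
  rw [h3, h4]
  exact h5.trans h2

theorem integrable_abs_sub_pow {μ : Measure ℝ} [IsProbabilityMeasure μ]
    (hμ : MemLp id 5 μ) (c : ℝ) {k : ℕ} (hk : k ≤ 5) : Integrable (fun x => |x - c| ^ k) μ := by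
  rcases Nat.eq_zero_or_pos k with rfl | h0
  · simp
  have h1 : MemLp (fun x : ℝ => x - c) k μ :=
    (hμ.sub (memLp_const c)).mono_exponent (by exact_mod_cast hk)
  simpa using h1.integrable_norm_pow h0.ne'

theorem integrable_sub_pow {μ : Measure ℝ} [IsProbabilityMeasure μ]
    (hμ : MemLp id 5 μ) (c : ℝ) {k : ℕ} (hk : k ≤ 5) : Integrable (fun x => (x - c) ^ k) μ :=
  (integrable_abs_sub_pow hμ c hk).mono' (by fun_prop) (by simp)

theorem integral_sub_mean {μ : Measure ℝ} [IsProbabilityMeasure μ] (hμ : Integrable id μ) :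
    ∫ x, (x - mean μ) ∂μ = 0 := by
  have hμ' : Integrable (fun x : ℝ => x) μ := hμ
  rw [integral_sub hμ' (integrable_const _)]
  simp [mean]

/-- Integrate `le_abs_add_pow_five` with r the centred variable of ν and u that of μ; the mixed term
has mean zero. Only μ pays the factor 1/8, which matters when the bound is iterated. -/
theorem le_absCentralMomentFive_conv {μ ν : Measure ℝ} [IsProbabilityMeasure μ]
    [IsProbabilityMeasure ν] (hμ : MemLp id 5 μ) (hν : MemLp id 5 ν) :
    absCentralMomentFive ν + absCentralMomentFive μ / 8 ≤ absCentralMomentFive (μ ∗ ν) := by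
  have iμ : Integrable id μ := hμ.integrable (by norm_num)
  have iν : Integrable id ν := hν.integrable (by norm_num)
  unfold absCentralMomentFive
  rw [integral_conv_eq (by fun_prop), mean_conv iμ iν]
  have i1 : Integrable (fun p : ℝ × ℝ => |p.2 - mean ν| ^ 5) (μ.prod ν) :=
    (integrable_abs_sub_pow hν _ le_rfl).comp_snd μ
  have i2 : Integrable (fun p : ℝ × ℝ => |p.1 - mean μ| ^ 5) (μ.prod ν) :=
    (integrable_abs_sub_pow hμ _ le_rfl).comp_fst ν
  have i4 : Integrable (fun y => (y - mean ν) * |y - mean ν| ^ 3) ν :=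
    (integrable_abs_sub_pow hν (mean ν) (k := 4) (by norm_num)).mono' (by fun_prop)
      (ae_of_all _ fun x => by simp; ring_nf; rfl)
  have i3 : Integrable (fun p : ℝ × ℝ =>
      (p.1 - mean μ) * ((p.2 - mean ν) * |p.2 - mean ν| ^ 3)) (μ.prod ν) :=
    (iμ.sub (integrable_const _)).mul_prod i4
  have e3 : ∫ p : ℝ × ℝ, (p.1 - mean μ) * ((p.2 - mean ν) * |p.2 - mean ν| ^ 3) ∂μ.prod ν = 0 := by
    rw [integral_prod_mul (fun x => x - mean μ) (fun y => (y - mean ν) * |y - mean ν| ^ 3),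
      integral_sub_mean iμ, zero_mul]
  have i5 : Integrable (fun p : ℝ × ℝ => |p.1 + p.2 - (mean μ + mean ν)| ^ 5) (μ.prod ν) := by
    refine ((i1.add i2).const_mul 16).mono' (by fun_prop) (ae_of_all _ fun p => ?_)
    have := abs_add_pow_five_le (p.2 - mean ν) (p.1 - mean μ)
    rw [show p.2 - mean ν + (p.1 - mean μ) = p.1 + p.2 - (mean μ + mean ν) by ring] at this
    simpa using this
  calc _ = ∫ p : ℝ × ℝ, (|p.2 - mean ν| ^ 5
        + 5 * ((p.1 - mean μ) * ((p.2 - mean ν) * |p.2 - mean ν| ^ 3))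
        + |p.1 - mean μ| ^ 5 / 8) ∂μ.prod ν := by
        rw [integral_add (by fun_prop) (i2.div_const 8),
          integral_add i1 (i3.const_mul 5), integral_const_mul, e3, integral_div,
          integral_fst_prod (fun x => |x - mean μ| ^ 5),
          integral_snd_prod (fun x => |x - mean ν| ^ 5)]
        ring
    _ ≤ _ := by
        refine integral_mono ((i1.add (i3.const_mul 5)).add (i2.div_const 8)) i5 fun p => ?_
        have := le_abs_add_pow_five (p.2 - mean ν) (p.1 - mean μ)
        rw [show p.2 - mean ν + (p.1 - mean μ) = p.1 + p.2 - (mean μ + mean ν) by ring] at this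
        linarith

variable {ψ : ℝ → ℂ} {m : ℝ → Measure ℝ}

/-- The laws `m v`, `v ≥ 0`, form the convolution semigroup with characteristic exponent `ψ`. -/
structure IsConvolutionSemigroup (ψ : ℝ → ℂ) (m : ℝ → Measure ℝ) : Prop where
  isProbabilityMeasure : ∀ v, IsProbabilityMeasure (m v)
  charFun_eq : ∀ v, 0 ≤ v → ∀ z, charFun (m v) z = Complex.exp (v * ψ z)

namespace IsConvolutionSemigroup

theorem conv_eq (hm : IsConvolutionSemigroup ψ m) {v w : ℝ} (hv : 0 ≤ v) (hw : 0 ≤ w) :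
    m (v + w) = m v ∗ m w := by
  have := hm.isProbabilityMeasure
  refine Measure.ext_of_charFun (funext fun z => ?_)
  rw [charFun_conv, hm.charFun_eq _ (add_nonneg hv hw), hm.charFun_eq _ hv, hm.charFun_eq _ hw,
    ← Complex.exp_add]
  push_cast
  ring_nf

/-- For w ≤ 1 the law `m w` is a convolution factor of `m 1` and inherits its moments; longer times
are reached by adding units. -/
theorem memLp (hm : IsConvolutionSemigroup ψ m) {p : ENNReal} (hp0 : p ≠ 0) (hp : p ≠ ⊤)
    (h1 : MemLp id p (m 1)) {v : ℝ} (hv : 0 ≤ v) : MemLp id p (m v) := by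
  have := hm.isProbabilityMeasure
  have small : ∀ w, 0 ≤ w → w ≤ 1 → MemLp id p (m w) := fun w h0 hw => by
    have h := hm.conv_eq h0 (sub_nonneg.2 hw)
    rw [add_sub_cancel] at h
    exact memLp_of_conv (h ▸ h1) hp0 hp
  have nat : ∀ k : ℕ, ∀ w : ℝ, 0 ≤ w → w ≤ k + 1 → MemLp id p (m w) := fun k => by
    induction k with
    | zero => simpa using small
    | succ k ih =>
      intro w h0 hw
      rcases le_total w 1 with h | h
      · exact small w h0 h
      have e := hm.conv_eq (sub_nonneg.2 h) zero_le_one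
      rw [sub_add_cancel] at e
      rw [e]
      exact memLp_conv (ih _ (by linarith) (by push_cast at hw; linarith)) h1
  obtain ⟨k, hk⟩ := exists_nat_ge v
  exact nat k v hv (by linarith)

/-- Cauchy's functional equation: the variance is additive and monotone in time, hence linear. -/
theorem variance_eq (hm : IsConvolutionSemigroup ψ m) (h1 : MemLp id 2 (m 1))
    (hvar : Var[id; m 1] = 1) {v : ℝ} (hv : 0 ≤ v) : Var[id; m v] = v := by
  have := hm.isProbabilityMeasure
  have hL : ∀ w, 0 ≤ w → MemLp id 2 (m w) := fun w => hm.memLp (by simp) (by simp) h1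
  have add : ∀ v w, 0 ≤ v → 0 ≤ w → Var[id; m (v + w)] = Var[id; m v] + Var[id; m w] :=
    fun v w hv hw => by rw [hm.conv_eq hv hw, variance_id_conv (hL v hv) (hL w hw)]
  have mono : ∀ v w, 0 ≤ v → v ≤ w → Var[id; m v] ≤ Var[id; m w] := fun v w hv hw => by
    have := add v (w - v) hv (sub_nonneg.2 hw)
    rw [add_sub_cancel] at this
    linarith [variance_nonneg id (m (w - v))]
  have mul : ∀ (k : ℕ) v, 0 ≤ v → Var[id; m (k * v)] = k * Var[id; m v] := fun k v hv => by
    induction k with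
    | zero =>
      have := add 0 0 le_rfl le_rfl
      simp at this ⊢
      exact this
    | succ k ih =>
      have := add (k * v) v (by positivity) hv
      push_cast
      rw [add_mul, one_mul, this, ih]
      ring
  have rat : ∀ (j k : ℕ), 0 < k → Var[id; m (j / k)] = j / k := fun j k hk => by
    have hk' : (k : ℝ) ≠ 0 := by positivity
    have a1 := mul k (1 / k) (by positivity)
    rw [mul_one_div_cancel hk', hvar] at a1
    have a2 := mul j (1 / k) (by positivity)
    rw [mul_one_div] at a2
    rw [a2, eq_div_iff hk', mul_assoc, mul_comm _ (k : ℝ), ← a1, mul_one]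
  -- Monotonicity squeezes v between neighbouring multiples of 1/k, where the value is already
  -- known.
  refine eq_of_forall_dist_le fun ε hε => ?_
  obtain ⟨k, hk⟩ := exists_nat_gt (1 / ε)
  have hk0 : (0 : ℝ) < k := lt_trans (by positivity) hk
  have hk0' : 0 < k := by exact_mod_cast hk0
  have e1 := Nat.floor_le (mul_nonneg hv hk0.le)
  have e2 := (Nat.lt_floor_add_one (v * k)).le
  have m1 := mono (⌊v * k⌋₊ / k) v (by positivity) (by rwa [div_le_iff₀ hk0])
  have m2 := mono v ((⌊v * k⌋₊ + 1 : ℕ) / k) hv (by push_cast; rwa [le_div_iff₀ hk0])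
  rw [rat _ _ hk0'] at m1 m2
  have b1 : v - 1 / k ≤ ⌊v * k⌋₊ / k := by
    rw [le_div_iff₀ hk0, sub_mul, one_div_mul_cancel hk0.ne']; linarith
  have b2 : ((⌊v * k⌋₊ + 1 : ℕ) : ℝ) / k ≤ v + 1 / k := by
    push_cast
    rw [div_le_iff₀ hk0, add_mul, one_div_mul_cancel hk0.ne']; linarith
  have hε' : 1 / (k : ℝ) ≤ ε := by
    rw [div_le_iff₀ hk0]
    rw [div_lt_iff₀ hε] at hk
    linarith
  rw [Real.dist_eq, abs_le]
  constructor <;> linarith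

/-- About 1/v independent copies of `m v` fit into `m 1`, so by superadditivity each has a share of
order v of the moment of `m 1`. The constant is 16 = 2 · 8: 8 from the convexity bound, 2 from
rounding 1/v down. -/
theorem absCentralMomentFive_le (hm : IsConvolutionSemigroup ψ m) (h1 : MemLp id 5 (m 1)) {v : ℝ}
    (hv : 0 ≤ v) (hv1 : v ≤ 1) :
    absCentralMomentFive (m v) ≤ 16 * absCentralMomentFive (m 1) * v := by
  have := hm.isProbabilityMeasure
  have hL : ∀ w, 0 ≤ w → MemLp id 5 (m w) := fun w => hm.memLp (by simp) (by simp) h1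
  have add : ∀ v w, 0 ≤ v → 0 ≤ w → absCentralMomentFive (m w) + absCentralMomentFive (m v) / 8
      ≤ absCentralMomentFive (m (v + w)) := fun v w hv hw => by
    rw [hm.conv_eq hv hw]
    exact le_absCentralMomentFive_conv (hL v hv) (hL w hw)
  have nonneg : ∀ w, 0 ≤ absCentralMomentFive (m w) := fun w =>
    integral_nonneg fun x => by positivity
  -- Each new copy takes the slot that carries 1/8, and the accumulated part keeps its full weight,
  -- so the loss does not compound.
  have mul : ∀ (k : ℕ), k * absCentralMomentFive (m v) / 8 ≤ absCentralMomentFive (m (k * v)) :=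
    fun k => by
    induction k with
    | zero => simpa using nonneg 0
    | succ k ih =>
      have := add v (k * v) hv (by positivity)
      push_cast
      rw [show ((k : ℝ) + 1) * v = v + k * v by ring]
      linarith
  rcases hv.eq_or_lt with rfl | hv0
  · have := add 0 0 le_rfl le_rfl
    simp only [add_zero] at this
    linarith [nonneg 0]
  have f1 := Nat.floor_le (show 0 ≤ 1 / v by positivity)
  have f2 := Nat.lt_floor_add_one (1 / v)
  have f3 : (1 : ℝ) ≤ ⌊1 / v⌋₊ := by
    exact_mod_cast Nat.le_floor (by rw [Nat.cast_one, le_div_iff₀ hv0]; linarith)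
  rw [le_div_iff₀ hv0] at f1
  have k1 := mul ⌊1 / v⌋₊
  have k2 := add (1 - ⌊1 / v⌋₊ * v) (⌊1 / v⌋₊ * v) (by linarith) (by positivity)
  rw [sub_add_cancel] at k2
  have k3 := nonneg (1 - ⌊1 / v⌋₊ * v)
  -- With k the floor of 1/v, 1 < (k + 1)v ≤ 2kv, since k ≥ 1.
  have k4 : 1 ≤ 2 * ⌊1 / v⌋₊ * v := by
    rw [div_lt_iff₀ hv0] at f2
    nlinarith
  have k5 := nonneg v
  have k6 : ⌊1 / v⌋₊ * absCentralMomentFive (m v) ≤ 8 * absCentralMomentFive (m 1) := by linarith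
  calc absCentralMomentFive (m v) = 1 * absCentralMomentFive (m v) := (one_mul _).symm
    _ ≤ (2 * ⌊1 / v⌋₊ * v) * absCentralMomentFive (m v) := by gcongr
    _ = 2 * v * (⌊1 / v⌋₊ * absCentralMomentFive (m v)) := by ring
    _ ≤ 2 * v * (8 * absCentralMomentFive (m 1)) := by gcongr
    _ = _ := by ring

end IsConvolutionSemigroup

end ConvolutionSemigroup

/-! ### Small-time asymptotics of the fourth central moment -/

section FourthCumulant

/-- A bounded approximation of `x ^ 4`, the fourth difference quotient of `z ↦ exp (i z x)`. -/
noncomputable def sinQuartic (h x : ℝ) : ℝ := (2 * Real.sin (h * x / 2) / h) ^ 4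

theorem sinQuartic_nonneg (h x : ℝ) : 0 ≤ sinQuartic h x := by
  unfold sinQuartic; positivity

theorem measurable_sinQuartic (h : ℝ) : Measurable (sinQuartic h) := by
  unfold sinQuartic; fun_prop

theorem abs_sub_abs_sin_le (u : ℝ) : |u| - |Real.sin u| ≤ u ^ 2 := by
  wlog hu : 0 ≤ u generalizing u
  · simpa using this (-u) (by linarith)
  rw [abs_of_nonneg hu]
  rcases hu.eq_or_lt with rfl | h0
  · simp
  rcases le_total u 1 with h | h
  · have := Real.sin_gt_sub_cube h0
    nlinarith [le_abs_self (Real.sin u), sq_nonneg u]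
  · nlinarith [abs_nonneg (Real.sin u)]

theorem sinQuartic_le {h : ℝ} (hh : 0 < h) (x : ℝ) : sinQuartic h x ≤ x ^ 4 := by
  unfold sinQuartic
  have h1 : |2 * Real.sin (h * x / 2) / h| ≤ |x| := by
    rw [abs_div, div_le_iff₀ (abs_pos.2 hh.ne'), abs_mul, abs_two]
    have := Real.abs_sin_le_abs (x := h * x / 2)
    rw [abs_div, abs_mul, abs_two] at this
    linarith
  have h2 := pow_le_pow_left₀ (abs_nonneg _) h1 4
  rwa [Even.pow_abs (by decide), Even.pow_abs (by decide)] at h2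

/-- With u = hx/2, factor u⁴ - sin⁴ u through |u| - |sin u| ≤ u². The error is linear in h at the
price of a fifth moment, which is of the order of the time v; this makes the approximation uniform
after division by v. -/
theorem pow_four_sub_sinQuartic_le {h : ℝ} (hh : 0 < h) (x : ℝ) :
    x ^ 4 - sinQuartic h x ≤ 2 * h * |x| ^ 5 := by
  obtain ⟨u, rfl⟩ : ∃ u, x = 2 * u / h := ⟨h * x / 2, by field_simp⟩
  have e1 : h * (2 * u / h) / 2 = u := by field_simp
  have key : u ^ 4 - Real.sin u ^ 4 ≤ 4 * |u| ^ 5 := by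
    have a1 := abs_sub_abs_sin_le u
    have a2 := Real.abs_sin_le_abs (x := u)
    have a3 := abs_nonneg (Real.sin u)
    rw [← sq_abs u] at a1
    have e2 : u ^ 4 = |u| ^ 4 := (Even.pow_abs (by decide) u).symm
    have e3 : Real.sin u ^ 4 = |Real.sin u| ^ 4 := (Even.pow_abs (by decide) _).symm
    rw [e2, e3]
    generalize |u| = a at *
    generalize |Real.sin u| = s at *
    have ha : 0 ≤ a := a3.trans a2
    have s2 : s ^ 2 ≤ a ^ 2 := by gcongr
    have s3 : s ^ 3 ≤ a ^ 3 := by gcongr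
    have f1 : a ^ 3 + a ^ 2 * s + a * s ^ 2 + s ^ 3 ≤ 4 * a ^ 3 := by
      nlinarith [mul_le_mul_of_nonneg_left a2 (sq_nonneg a), mul_le_mul_of_nonneg_left s2 ha]
    calc a ^ 4 - s ^ 4 = (a ^ 3 + a ^ 2 * s + a * s ^ 2 + s ^ 3) * (a - s) := by ring
      _ ≤ (4 * a ^ 3) * (a - s) := by gcongr
      _ ≤ (4 * a ^ 3) * a ^ 2 := by gcongr
      _ = _ := by ring
  unfold sinQuartic
  rw [e1, abs_div, abs_mul, abs_two, abs_of_pos hh, div_pow, div_pow, mul_pow, mul_pow, div_pow,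
    mul_pow, ← sub_div, ← mul_sub]
  calc 2 ^ 4 * (u ^ 4 - Real.sin u ^ 4) / h ^ 4 ≤ 2 ^ 4 * (4 * |u| ^ 5) / h ^ 4 := by gcongr
    _ = 2 * h * (2 ^ 5 * |u| ^ 5 / h ^ 5) := by field_simp; norm_num

theorem tendsto_sinQuartic (x : ℝ) :
    Tendsto (fun h => sinQuartic h x) (𝓝[>] 0) (𝓝 (x ^ 4)) := by
  have h1 : Tendsto (fun h : ℝ => x ^ 4 - 2 * h * |x| ^ 5) (𝓝[>] 0) (𝓝 (x ^ 4)) := by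
    have : Tendsto (fun h : ℝ => x ^ 4 - 2 * h * |x| ^ 5) (𝓝 0) (𝓝 (x ^ 4 - 2 * 0 * |x| ^ 5)) :=
      Continuous.tendsto (by fun_prop) 0
    simpa using this.mono_left nhdsWithin_le_nhds
  refine tendsto_of_tendsto_of_tendsto_of_le_of_le' h1 tendsto_const_nhds ?_ ?_
  · filter_upwards [self_mem_nhdsWithin] with h hh
    linarith [pow_four_sub_sinQuartic_le hh x]
  · filter_upwards [self_mem_nhdsWithin] with h hh using sinQuartic_le hh x

/-- Cosines integrate to the real part of the exponent against ν, and to squared moduli of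
characteristic functions against a symmetrised law; this identity links the two. -/
theorem sinQuartic_eq_cos (h x : ℝ) :
    sinQuartic h x = (6 - 8 * Real.cos (h * x) + 2 * Real.cos (2 * h * x)) / h ^ 4 := by
  unfold sinQuartic
  rw [show 2 * h * x = 2 * (h * x) by ring, Real.cos_two_mul,
    show h * x = 2 * (h * x / 2) by ring, Real.cos_two_mul, div_pow]
  congr 1
  rw [show 2 * (h * x / 2) / 2 = h * x / 2 by ring]
  have := Real.sin_sq_add_cos_sq (h * x / 2)
  rw [mul_pow, show Real.sin (h * x / 2) ^ 4 = (Real.sin (h * x / 2) ^ 2) ^ 2 by ring,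
    show Real.sin (h * x / 2) ^ 2 = 1 - Real.cos (h * x / 2) ^ 2 by linarith]
  ring

theorem LevyTriplet.integrable_min (T : LevyTriplet) :
    Integrable (fun x : ℝ => min 1 (x ^ 2)) T.ν := by
  refine ⟨by fun_prop, ?_⟩
  rw [hasFiniteIntegral_iff_ofReal (ae_of_all _ fun x => by positivity)]
  exact T.ν_levy

theorem norm_levyIntegrand_le (z x : ℝ) :
    ‖Complex.exp (Complex.I * z * x) - 1
      - Complex.I * z * x * Set.indicator {y : ℝ | |y| ≤ 1} (fun _ => (1 : ℂ)) x‖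
      ≤ (3 * z ^ 2 + 2) * min 1 (x ^ 2) := by
  have n1 : ‖Complex.exp (Complex.I * z * x)‖ = 1 := by
    rw [show Complex.I * z * x = ((z * x : ℝ) : ℂ) * Complex.I by push_cast; ring,
      Complex.norm_exp_ofReal_mul_I]
  have n2 : ‖Complex.I * z * x‖ = |z * x| := by simp [abs_mul]
  by_cases hx : |x| ≤ 1
  · rw [Set.indicator_of_mem (by exact hx), mul_one,
      min_eq_right ((sq_le_one_iff_abs_le_one x).2 hx)]
    have : ‖Complex.exp (Complex.I * z * x) - 1 - Complex.I * z * x‖ ≤ 3 * |z * x| ^ 2 := by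
      rcases le_total |z * x| 1 with h | h
      · have := Complex.norm_exp_sub_one_sub_id_le (x := Complex.I * z * x) (by rwa [n2])
        rw [n2] at this
        nlinarith [sq_nonneg |z * x|]
      · calc _ ≤ ‖Complex.exp (Complex.I * z * x)‖ + ‖(1 : ℂ)‖ + ‖Complex.I * z * x‖ :=
              (norm_sub_le _ _).trans (add_le_add_left (norm_sub_le _ _) _)
          _ ≤ 3 * |z * x| ^ 2 := by rw [n1, n2, norm_one]; nlinarith
    rw [sq_abs, mul_pow] at this
    nlinarith [sq_nonneg x]
  · rw [Set.indicator_of_notMem (by exact hx), mul_zero, sub_zero,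
      min_eq_left (by
        rw [← sq_abs]
        nlinarith [not_le.1 hx])]
    calc _ ≤ ‖Complex.exp (Complex.I * z * x)‖ + ‖(1 : ℂ)‖ := norm_sub_le _ _
      _ ≤ _ := by rw [n1, norm_one]; nlinarith [sq_nonneg z]

theorem LevyTriplet.integrable_levyIntegrand (T : LevyTriplet) (z : ℝ) :
    Integrable (fun x : ℝ => Complex.exp (Complex.I * z * x) - 1
      - Complex.I * z * x * Set.indicator {y : ℝ | |y| ≤ 1} (fun _ => (1 : ℂ)) x) T.ν := by
  refine (T.integrable_min.const_mul (3 * z ^ 2 + 2)).mono' ?_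
    (ae_of_all _ (norm_levyIntegrand_le z))
  have : MeasurableSet {y : ℝ | |y| ≤ 1} := measurableSet_le (by fun_prop) (by fun_prop)
  have : Measurable (Set.indicator {y : ℝ | |y| ≤ 1} (fun _ => (1 : ℂ))) :=
    measurable_const.indicator this
  fun_prop

theorem levyIntegrand_re (z x : ℝ) :
    (Complex.exp (Complex.I * z * x) - 1
      - Complex.I * z * x * Set.indicator {y : ℝ | |y| ≤ 1} (fun _ => (1 : ℂ)) x).re
      = Real.cos (z * x) - 1 := by
  rw [show Complex.I * z * x = ((z * x : ℝ) : ℂ) * Complex.I by push_cast; ring, Complex.sub_re,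
    Complex.sub_re, Complex.exp_ofReal_mul_I_re]
  by_cases hx : |x| ≤ 1 <;> simp [Set.indicator, hx]

theorem LevyTriplet.restrict_ν (T : LevyTriplet) : T.ν.restrict ({0}ᶜ : Set ℝ) = T.ν :=
  Measure.restrict_eq_self_of_ae_mem (by
    rw [ae_iff]
    simpa using T.ν_zero)

theorem LevyTriplet.integrable_cos (T : LevyTriplet) (z : ℝ) :
    Integrable (fun x : ℝ => Real.cos (z * x) - 1) T.ν :=
  (T.integrable_levyIntegrand z).re.congr (ae_of_all _ fun x => levyIntegrand_re z x)

theorem LevyTriplet.exponent_re (T : LevyTriplet) (z : ℝ) :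
    (T.exponent z).re = -(1 / 2) * T.b ^ 2 * z ^ 2 + ∫ x, (Real.cos (z * x) - 1) ∂T.ν := by
  unfold LevyTriplet.exponent
  rw [T.restrict_ν, Complex.add_re]
  congr 1
  · rw [show Complex.I * T.γ * z - (1 / 2 : ℂ) * (T.b : ℂ) ^ 2 * (z : ℂ) ^ 2
      = ((-(1 / 2) * T.b ^ 2 * z ^ 2 : ℝ) : ℂ) + ((T.γ * z : ℝ) : ℂ) * Complex.I by
        push_cast; ring, Complex.add_re, Complex.ofReal_re, Complex.re_ofReal_mul, Complex.I_re,
      mul_zero, add_zero]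
  · refine (integral_re (T.integrable_levyIntegrand z)).symm.trans ?_
    exact integral_congr_ae (ae_of_all _ fun x => levyIntegrand_re z x)

theorem LevyTriplet.integrable_sinQuartic (T : LevyTriplet) (h : ℝ) :
    Integrable (sinQuartic h) T.ν := by
  have := (((T.integrable_cos (2 * h)).const_mul 2).sub
    ((T.integrable_cos h).const_mul 8)).div_const (h ^ 4)
  refine this.congr (ae_of_all _ fun x => ?_)
  simp only [Pi.sub_apply, sinQuartic_eq_cos]
  ring

/-- The combination 2f(2h) - 8f(h) annihilates z², so the Gaussian part of the exponent drops out.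
-/
theorem LevyTriplet.integral_sinQuartic (T : LevyTriplet) (h : ℝ) :
    ∫ x, sinQuartic h x ∂T.ν
      = (2 * (T.exponent (2 * h)).re - 8 * (T.exponent h).re) / h ^ 4 := by
  rw [T.exponent_re, T.exponent_re, show 2 * (-(1 / 2) * T.b ^ 2 * (2 * h) ^ 2
    + ∫ x, (Real.cos (2 * h * x) - 1) ∂T.ν) - 8 * (-(1 / 2) * T.b ^ 2 * h ^ 2
    + ∫ x, (Real.cos (h * x) - 1) ∂T.ν) = 2 * (∫ x, (Real.cos (2 * h * x) - 1) ∂T.ν)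
    - 8 * ∫ x, (Real.cos (h * x) - 1) ∂T.ν by ring, ← integral_const_mul, ← integral_const_mul,
    ← integral_sub ((T.integrable_cos _).const_mul 2) ((T.integrable_cos _).const_mul 8),
    ← integral_div]
  refine integral_congr_ae (ae_of_all _ fun x => ?_)
  simp only [sinQuartic_eq_cos]
  ring

/-- Under the product measure p.1 - p.2 is the difference of two independent copies. Symmetrising
leaves only the real part of the exponent, so drift and compensation are invisible. -/
theorem integral_cos_sub_prod {μ : Measure ℝ} [IsProbabilityMeasure μ] (h : ℝ) :
    ∫ p : ℝ × ℝ, Real.cos (h * (p.1 - p.2)) ∂μ.prod μ = ‖charFun μ h‖ ^ 2 := by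
  have ic : Integrable (fun x => Real.cos (h * x)) μ :=
    Integrable.of_bound (by fun_prop) 1 (ae_of_all _ fun x => by simpa using Real.abs_cos_le_one _)
  have is : Integrable (fun x => Real.sin (h * x)) μ :=
    Integrable.of_bound (by fun_prop) 1 (ae_of_all _ fun x => by simpa using Real.abs_sin_le_one _)
  have ie : Integrable (fun x : ℝ => Complex.exp (h * x * Complex.I)) μ :=
    Integrable.of_bound (by fun_prop) 1 (ae_of_all _ fun x => by
      rw [← Complex.ofReal_mul, Complex.norm_exp_ofReal_mul_I])
  have e1 : (charFun μ h).re = ∫ x, Real.cos (h * x) ∂μ := by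
    rw [charFun_apply_real]
    refine (integral_re ie).symm.trans (integral_congr_ae (ae_of_all _ fun x => ?_))
    change (Complex.exp _).re = _
    rw [← Complex.ofReal_mul, Complex.exp_ofReal_mul_I_re]
  have e2 : (charFun μ h).im = ∫ x, Real.sin (h * x) ∂μ := by
    rw [charFun_apply_real]
    refine (integral_im ie).symm.trans (integral_congr_ae (ae_of_all _ fun x => ?_))
    change (Complex.exp _).im = _
    rw [← Complex.ofReal_mul, Complex.exp_ofReal_mul_I_im]
  rw [Complex.sq_norm, Complex.normSq_apply, e1, e2,
    ← integral_prod_mul (fun x => Real.cos (h * x)) (fun x => Real.cos (h * x)),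
    ← integral_prod_mul (fun x => Real.sin (h * x)) (fun x => Real.sin (h * x)),
    ← integral_add (ic.mul_prod ic) (is.mul_prod is)]
  refine integral_congr_ae (ae_of_all _ fun p => ?_)
  simp only
  rw [mul_sub, Real.cos_sub]

variable {T : LevyTriplet} {m : ℝ → Measure ℝ}

theorem integrable_cos_sub_prod {μ : Measure ℝ} [IsProbabilityMeasure μ] (h : ℝ) :
    Integrable (fun p : ℝ × ℝ => Real.cos (h * (p.1 - p.2))) (μ.prod μ) :=
  Integrable.of_bound (by fun_prop) 1 (ae_of_all _ fun x => by simpa using Real.abs_cos_le_one _)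

namespace IsConvolutionSemigroup

theorem integral_sinQuartic_prod (hm : IsConvolutionSemigroup T.exponent m) (h : ℝ) {v : ℝ}
    (hv : 0 ≤ v) :
    ∫ p, sinQuartic h (p.1 - p.2) ∂(m v).prod (m v)
      = (6 - 8 * Real.exp (2 * (T.exponent h).re * v)
        + 2 * Real.exp (2 * (T.exponent (2 * h)).re * v)) / h ^ 4 := by
  have := hm.isProbabilityMeasure
  have key : ∀ z, ‖charFun (m v) z‖ ^ 2 = Real.exp (2 * (T.exponent z).re * v) := fun z => by
    rw [hm.charFun_eq v hv, Complex.norm_exp, ← Real.exp_nat_mul]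
    congr 1
    simp
    ring
  simp_rw [sinQuartic_eq_cos]
  rw [integral_div, integral_add (by
      exact (integrable_const _).sub ((integrable_cos_sub_prod h).const_mul 8))
      ((integrable_cos_sub_prod (2 * h)).const_mul 2),
    integral_sub (integrable_const _) ((integrable_cos_sub_prod h).const_mul 8),
    integral_const_mul, integral_const_mul, integral_cos_sub_prod, integral_cos_sub_prod, key, key]
  simp

/-- For fixed h the integral is an explicit combination of exponentials in v that vanishes at v = 0,
and the limit is its derivative there. -/
theorem tendsto_integral_sinQuartic_prod (hm : IsConvolutionSemigroup T.exponent m) (h : ℝ) :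
    Tendsto (fun v => (∫ p, sinQuartic h (p.1 - p.2) ∂(m v).prod (m v)) / v) (𝓝[>] 0)
      (𝓝 (2 * ∫ x, sinQuartic h x ∂T.ν)) := by
  set f : ℝ → ℝ := fun v => (6 - 8 * Real.exp (2 * (T.exponent h).re * v)
        + 2 * Real.exp (2 * (T.exponent (2 * h)).re * v)) / h ^ 4 with hf
  have hd : ∀ c : ℝ, HasDerivAt (fun v => Real.exp (c * v)) c 0 := fun c => by
    simpa using ((hasDerivAt_id (0 : ℝ)).const_mul c).exp
  have h1 : HasDerivAt f (2 * ∫ x, sinQuartic h x ∂T.ν) 0 := by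
    have := ((((hd (2 * (T.exponent h).re)).const_mul 8).const_sub 6).add
      ((hd (2 * (T.exponent (2 * h)).re)).const_mul 2)).div_const (h ^ 4)
    rw [T.integral_sinQuartic]
    refine this.congr_deriv ?_
    ring
  have h2 := h1.tendsto_slope_zero_right
  refine h2.congr' ?_
  filter_upwards [self_mem_nhdsWithin] with v hv
  rw [hm.integral_sinQuartic_prod h (le_of_lt hv)]
  simp only [hf, zero_add, smul_eq_mul, mul_zero, Real.exp_zero]
  rw [show (6 - 8 * 1 + 2 * 1 : ℝ) / h ^ 4 = 0 by norm_num, sub_zero]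
  ring

theorem integral_abs_sub_pow_five_le {μ : Measure ℝ} [IsProbabilityMeasure μ]
    (hμ : MemLp id 5 μ) :
    Integrable (fun p : ℝ × ℝ => |p.1 - p.2| ^ 5) (μ.prod μ) ∧
      ∫ p : ℝ × ℝ, |p.1 - p.2| ^ 5 ∂μ.prod μ ≤ 32 * absCentralMomentFive μ := by
  have i1 : Integrable (fun p : ℝ × ℝ => |p.1 - mean μ| ^ 5) (μ.prod μ) :=
    (integrable_abs_sub_pow hμ _ le_rfl).comp_fst μ
  have i2 : Integrable (fun p : ℝ × ℝ => |p.2 - mean μ| ^ 5) (μ.prod μ) :=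
    (integrable_abs_sub_pow hμ _ le_rfl).comp_snd μ
  have le : ∀ p : ℝ × ℝ,
      |p.1 - p.2| ^ 5 ≤ 16 * (|p.1 - mean μ| ^ 5 + |p.2 - mean μ| ^ 5) := fun p => by
    have := abs_add_pow_five_le (p.1 - mean μ) (-(p.2 - mean μ))
    rwa [abs_neg, show p.1 - mean μ + -(p.2 - mean μ) = p.1 - p.2 by ring] at this
  have i3 : Integrable (fun p : ℝ × ℝ => |p.1 - p.2| ^ 5) (μ.prod μ) :=
    ((i1.add i2).const_mul 16).mono' (by fun_prop) (ae_of_all _ fun p => by simpa using le p)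
  refine ⟨i3, (integral_mono i3 ((i1.add i2).const_mul 16) le).trans (le_of_eq ?_)⟩
  simp only [Pi.add_apply]
  rw [integral_const_mul, integral_add i1 i2, integral_fst_prod (fun x => |x - mean μ| ^ 5),
    integral_snd_prod (fun x => |x - mean μ| ^ 5), absCentralMomentFive]
  ring

/-- In the binomial expansion the odd terms contain a first central moment. Along the semigroup the
variance term is 6v², negligible against v, so symmetrised fourth moments determine the plain ones
to first order. -/
theorem integral_sub_pow_four_prod {μ : Measure ℝ} [IsProbabilityMeasure μ]
    (hμ : MemLp id 5 μ) :
    Integrable (fun p : ℝ × ℝ => (p.1 - p.2) ^ 4) (μ.prod μ) ∧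
    ∫ p : ℝ × ℝ, (p.1 - p.2) ^ 4 ∂μ.prod μ
      = 2 * (∫ x, (x - mean μ) ^ 4 ∂μ) + 6 * Var[id; μ] ^ 2 := by
  have ic : ∀ k ≤ 5, Integrable (fun x : ℝ => (x - mean μ) ^ k) μ := fun k hk =>
    integrable_sub_pow hμ _ hk
  have ip : ∀ j k, j ≤ 5 → k ≤ 5 → Integrable
      (fun p : ℝ × ℝ => (p.1 - mean μ) ^ j * (p.2 - mean μ) ^ k) (μ.prod μ) := fun j k hj hk =>
    (ic j hj).mul_prod (ic k hk)
  have ep : ∀ j k, ∫ p : ℝ × ℝ, (p.1 - mean μ) ^ j * (p.2 - mean μ) ^ k ∂μ.prod μ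
      = (∫ x, (x - mean μ) ^ j ∂μ) * ∫ x, (x - mean μ) ^ k ∂μ := fun j k =>
    integral_prod_mul (fun x => (x - mean μ) ^ j) (fun x => (x - mean μ) ^ k)
  have e1 : ∫ x, (x - mean μ) ^ 1 ∂μ = 0 := by
    simpa using integral_sub_mean (hμ.integrable (by norm_num))
  have e2 : ∫ x, (x - mean μ) ^ 2 ∂μ = Var[id; μ] :=
    (variance_eq_integral measurable_id.aemeasurable).symm
  have i40 := ip 4 0 (by norm_num) (by norm_num)
  have i04 := ip 0 4 (by norm_num) (by norm_num)
  have i31 := (ip 3 1 (by norm_num) (by norm_num)).const_mul 4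
  have i13 := (ip 1 3 (by norm_num) (by norm_num)).const_mul 4
  have i22 := (ip 2 2 (by norm_num) (by norm_num)).const_mul 6
  have eq : (fun p : ℝ × ℝ => (p.1 - p.2) ^ 4) = fun p =>
      (p.1 - mean μ) ^ 4 * (p.2 - mean μ) ^ 0 + (p.1 - mean μ) ^ 0 * (p.2 - mean μ) ^ 4
      + 6 * ((p.1 - mean μ) ^ 2 * (p.2 - mean μ) ^ 2)
      - 4 * ((p.1 - mean μ) ^ 3 * (p.2 - mean μ) ^ 1)
      - 4 * ((p.1 - mean μ) ^ 1 * (p.2 - mean μ) ^ 3) := funext fun p => by ring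
  rw [eq]
  refine ⟨(((i40.add i04).add i22).sub i31).sub i13, ?_⟩
  rw [integral_sub (by exact ((i40.add i04).add i22).sub i31) i13,
    integral_sub (by exact (i40.add i04).add i22) i31, integral_add (by exact i40.add i04) i22,
    integral_add i40 i04, integral_const_mul, integral_const_mul, integral_const_mul,
    ep, ep, ep, ep, ep, e1, e2]
  simp
  ring

theorem pow_four_le (x : ℝ) : x ^ 4 ≤ x ^ 2 + |x| ^ 5 := by
  rw [← Even.pow_abs (by decide : Even 4), ← Even.pow_abs (by decide : Even 2)]
  have := abs_nonneg x
  generalize |x| = a at *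
  have h : 0 ≤ a ^ 2 * ((a - 1) ^ 2 * (a + 1) + a) := by positivity
  nlinarith

theorem integral_sub_mean_pow_four_le {μ : Measure ℝ} [IsProbabilityMeasure μ]
    (hμ : MemLp id 5 μ) :
    ∫ x, (x - mean μ) ^ 4 ∂μ ≤ Var[id; μ] + absCentralMomentFive μ := by
  have e2 : ∫ x, (x - mean μ) ^ 2 ∂μ = Var[id; μ] :=
    (variance_eq_integral measurable_id.aemeasurable).symm
  have i2 := integrable_sub_pow hμ (mean μ) (k := 2) (by norm_num)
  have i5 := integrable_abs_sub_pow hμ (mean μ) le_rfl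
  rw [← e2, absCentralMomentFive, ← integral_add i2 i5]
  exact integral_mono (integrable_sub_pow hμ _ (by norm_num)) (i2.add i5)
    fun x => pow_four_le (x - mean μ)

/-- Let F and E h be the symmetrised means of x⁴ and of `sinQuartic h`. Then E h v / v → 2 ∫
`sinQuartic h` dν for each h, while 0 ≤ F - E h ≤ 64 C h v uniformly in v ≤ 1, so h → 0 may be taken
after v → 0. The factor 2 comes from symmetrisation. -/
theorem tendsto_fourth_moment (hm : IsConvolutionSemigroup T.exponent m) (h1 : MemLp id 5 (m 1))
    (hvar : Var[id; m 1] = 1) :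
    Tendsto (fun v => (∫ x, (x - mean (m v)) ^ 4 ∂m v) / v) (𝓝[>] 0) (𝓝 T.c4) := by
  have := hm.isProbabilityMeasure
  have h12 : MemLp id 2 (m 1) := h1.mono_exponent (by norm_num)
  have hL : ∀ w, 0 ≤ w → MemLp id 5 (m w) := fun w => hm.memLp (by simp) (by simp) h1
  have hV : ∀ w, 0 ≤ w → Var[id; m w] = w := fun w => hm.variance_eq h12 hvar
  set C := 16 * absCentralMomentFive (m 1) with hC
  have hC0 : 0 ≤ C := mul_nonneg (by norm_num) (integral_nonneg fun x => by positivity)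
  have h5 : ∀ w, 0 ≤ w → w ≤ 1 → absCentralMomentFive (m w) ≤ C * w := fun w =>
    hm.absCentralMomentFive_le h1
  set F : ℝ → ℝ := fun v => ∫ p : ℝ × ℝ, (p.1 - p.2) ^ 4 ∂(m v).prod (m v) with hF
  set E : ℝ → ℝ → ℝ := fun h v => ∫ p : ℝ × ℝ, sinQuartic h (p.1 - p.2) ∂(m v).prod (m v) with hE
  have iE : ∀ h, 0 < h → ∀ v, 0 ≤ v →
      Integrable (fun p : ℝ × ℝ => sinQuartic h (p.1 - p.2)) ((m v).prod (m v)) :=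
    fun h hh v hv => (integral_sub_pow_four_prod (hL v hv)).1.mono'
      ((measurable_sinQuartic h).comp (by fun_prop)).aestronglyMeasurable
      (ae_of_all _ fun p => by
        rw [Real.norm_of_nonneg (sinQuartic_nonneg _ _)]; exact sinQuartic_le hh _)
  have hEF : ∀ h, 0 < h → ∀ v, 0 ≤ v → E h v ≤ F v := fun h hh v hv =>
    integral_mono (iE h hh v hv) (integral_sub_pow_four_prod (hL v hv)).1
      fun p => sinQuartic_le hh _
  have hFE : ∀ h, 0 < h → ∀ v, 0 ≤ v → v ≤ 1 → F v - E h v ≤ h * (64 * C) * v :=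
    fun h hh v hv hv1 => by
    obtain ⟨i5, b5⟩ := integral_abs_sub_pow_five_le (hL v hv)
    calc F v - E h v = ∫ p : ℝ × ℝ, ((p.1 - p.2) ^ 4 - sinQuartic h (p.1 - p.2))
          ∂(m v).prod (m v) :=
          (integral_sub (integral_sub_pow_four_prod (hL v hv)).1 (iE h hh v hv)).symm
      _ ≤ ∫ p : ℝ × ℝ, 2 * h * |p.1 - p.2| ^ 5 ∂(m v).prod (m v) :=
          integral_mono ((integral_sub_pow_four_prod (hL v hv)).1.sub (iE h hh v hv))
            (i5.const_mul _) fun p => pow_four_sub_sinQuartic_le hh _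
      _ = 2 * h * ∫ p : ℝ × ℝ, |p.1 - p.2| ^ 5 ∂(m v).prod (m v) := integral_const_mul _ _
      _ ≤ 2 * h * (32 * (C * v)) := by
          gcongr
          exact b5.trans (by linarith [h5 v hv hv1])
      _ = _ := by ring
  have hFB : ∀ v, 0 < v → v ≤ 1 → F v / v ≤ 2 * (4 + C) := fun v hv hv1 => by
    rw [div_le_iff₀ hv, hF]
    simp only
    rw [(integral_sub_pow_four_prod (hL v hv.le)).2, hV v hv.le]
    have := integral_sub_mean_pow_four_le (hL v hv.le)
    rw [hV v hv.le] at this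
    nlinarith [h5 v hv.le hv1]
  have hI : ∀ h, 0 < h → ∫ x, sinQuartic h x ∂T.ν ≤ 4 + C := fun h hh => by
    have := le_of_tendsto (hm.tendsto_integral_sinQuartic_prod h) (b := 2 * (4 + C)) (by
      filter_upwards [Ioc_mem_nhdsGT zero_lt_one] with v hv
      exact (div_le_div_of_nonneg_right (hEF h hh v hv.1.le) hv.1.le).trans (hFB v hv.1 hv.2))
    linarith
  have hu : Tendsto (fun n : ℕ => 1 / ((n : ℝ) + 1)) atTop (𝓝[>] 0) :=
    tendsto_nhdsWithin_iff.2 ⟨tendsto_one_div_add_atTop_nhds_zero_nat,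
      Eventually.of_forall fun n => by simp only [Set.mem_Ioi]; positivity⟩
  -- The bound `hI` is uniform in h, so Fatou along h = 1/(n+1) gives the fourth moment of ν, which
  -- then dominates the limit h → 0.
  have i4 : Integrable (fun x : ℝ => x ^ 4) T.ν := by
    refine ⟨by fun_prop, ?_⟩
    rw [hasFiniteIntegral_iff_ofReal (ae_of_all _ fun x => by positivity)]
    have fatou := lintegral_liminf_le (u := atTop) (μ := T.ν)
      (f := fun (n : ℕ) x => ENNReal.ofReal (sinQuartic (1 / ((n : ℝ) + 1)) x))
      fun n => (measurable_sinQuartic _).ennreal_ofReal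
    have e : ∀ x, liminf (fun n : ℕ => ENNReal.ofReal (sinQuartic (1 / ((n : ℝ) + 1)) x)) atTop
        = ENNReal.ofReal (x ^ 4) := fun x =>
      (ENNReal.tendsto_ofReal ((tendsto_sinQuartic x).comp hu)).liminf_eq
    simp_rw [e] at fatou
    refine lt_of_le_of_lt fatou (lt_of_le_of_lt
      (liminf_le_of_le (a := ENNReal.ofReal (4 + C)) (by isBoundedDefault) ?_)
      ENNReal.ofReal_lt_top)
    intro b hb
    obtain ⟨n, hn⟩ := hb.exists
    refine hn.trans ?_
    rw [← ofReal_integral_eq_lintegral_ofReal (T.integrable_sinQuartic _)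
      (ae_of_all _ fun x => sinQuartic_nonneg _ x)]
    exact ENNReal.ofReal_le_ofReal (hI _ (by positivity))
  have hIc : Tendsto (fun h => ∫ x, sinQuartic h x ∂T.ν) (𝓝[>] 0) (𝓝 T.c4) := by
    refine tendsto_integral_filter_of_dominated_convergence (l := 𝓝[>] (0 : ℝ)) (fun x => x ^ 4)
      (Eventually.of_forall fun h => (measurable_sinQuartic h).aestronglyMeasurable) ?_ i4
      (ae_of_all _ tendsto_sinQuartic)
    filter_upwards [self_mem_nhdsWithin] with h hh
    refine ae_of_all _ fun x => ?_
    rw [Real.norm_of_nonneg (sinQuartic_nonneg _ _)]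
    exact sinQuartic_le hh x
  have hFc : Tendsto (fun v => F v / v) (𝓝[>] 0) (𝓝 (2 * T.c4)) := by
    rw [Metric.tendsto_nhds]
    intro ε hε
    have hsmall : ∀ᶠ h in 𝓝[>] (0 : ℝ), h * (64 * C) < ε / 3 := by
      have : Tendsto (fun h : ℝ => h * (64 * C)) (𝓝[>] 0) (𝓝 (0 * (64 * C))) :=
        (tendsto_nhdsWithin_of_tendsto_nhds tendsto_id).mul_const _
      rw [zero_mul] at this
      exact this.eventually_lt_const (by positivity)
    -- Fix one h that makes both the approximation error and the distance of the ν-integral from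
    -- `c4` small; only then let v tend to zero.
    obtain ⟨h, ⟨hh, hs⟩, hc⟩ := ((eventually_mem_nhdsWithin.and hsmall).and
      ((Metric.tendsto_nhds.1 hIc) (ε / 6) (by positivity))).exists
    filter_upwards [(Metric.tendsto_nhds.1 (hm.tendsto_integral_sinQuartic_prod h)) (ε / 3)
      (by positivity), Ioc_mem_nhdsGT zero_lt_one] with v hv hv1
    have a1 : E h v / v ≤ F v / v :=
      div_le_div_of_nonneg_right (hEF h hh v hv1.1.le) hv1.1.le
    have a2 : F v / v - E h v / v ≤ h * (64 * C) := by
      rw [← sub_div, div_le_iff₀ hv1.1]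
      exact hFE h hh v hv1.1.le hv1.2
    rw [Real.dist_eq, abs_lt] at hv hc ⊢
    constructor <;> linarith [hv.1, hv.2, hc.1, hc.2]
  have hlim : Tendsto (fun v => (F v / v - 6 * v) / 2) (𝓝[>] 0) (𝓝 ((2 * T.c4 - 6 * 0) / 2)) :=
    (hFc.sub ((tendsto_nhdsWithin_of_tendsto_nhds tendsto_id).const_mul 6)).div_const 2
  rw [show (2 * T.c4 - 6 * 0) / 2 = T.c4 by ring] at hlim
  refine hlim.congr' ?_
  filter_upwards [self_mem_nhdsWithin] with v hv
  have hv : 0 < v := hv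
  simp only [hF]
  rw [(integral_sub_pow_four_prod (hL v hv.le)).2, hV v hv.le]
  field_simp
  ring

end IsConvolutionSemigroup

end FourthCumulant

/-! ### From the Lévy basis to a centred independently scattered measure -/

section LevyBasis

variable {Ω : Type*} [MeasurableSpace Ω] {P : Measure Ω} {T : LevyTriplet}
  {L : Set (ℝ × ℝ) → Ω → ℝ}

theorem IsBoundedBorel.empty : IsBoundedBorel ∅ := ⟨MeasurableSet.empty, by simp⟩

theorem IsBoundedBorel.subset {A B : Set (ℝ × ℝ)} (hB : IsBoundedBorel B) (hA : MeasurableSet A)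
    (h : A ⊆ B) : IsBoundedBorel A := ⟨hA, (measure_mono h).trans_lt hB.2⟩

theorem IsBoundedBorel.inter {A B : Set (ℝ × ℝ)} (hA : IsBoundedBorel A) (hB : IsBoundedBorel B) :
    IsBoundedBorel (A ∩ B) := hA.subset (hA.1.inter hB.1) Set.inter_subset_left

theorem IsBoundedBorel.diff {A B : Set (ℝ × ℝ)} (hA : IsBoundedBorel A) (hB : IsBoundedBorel B) :
    IsBoundedBorel (A \ B) := hA.subset (hA.1.diff hB.1) Set.sdiff_subset

theorem IsBoundedBorel.union {A B : Set (ℝ × ℝ)} (hA : IsBoundedBorel A) (hB : IsBoundedBorel B) :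
    IsBoundedBorel (A ∪ B) := ⟨hA.1.union hB.1, measure_union_lt_top hA.2 hB.2⟩

theorem IsBoundedBorel.biUnion {ι : Type*} {A : ι → Set (ℝ × ℝ)} (s : Finset ι)
    (hA : ∀ i ∈ s, IsBoundedBorel (A i)) : IsBoundedBorel (⋃ i ∈ s, A i) :=
  ⟨s.measurableSet_biUnion fun i hi => (hA i hi).1,
    (measure_biUnion_lt_top s.finite_toSet fun i hi => (hA i hi).2)⟩

/-- A rectangle of area `v`. -/
def rectangle (v : ℝ) : Set (ℝ × ℝ) := Set.Ioc 0 v ×ˢ Set.Ioc 0 1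

theorem volume_rectangle (v : ℝ) : volume (rectangle v) = ENNReal.ofReal v := by
  simp [rectangle, Measure.volume_eq_prod]

theorem isBoundedBorel_rectangle (v : ℝ) : IsBoundedBorel (rectangle v) :=
  ⟨measurableSet_Ioc.prod measurableSet_Ioc, by rw [volume_rectangle]; exact ENNReal.ofReal_lt_top⟩

namespace IsHomogeneousLevyBasis

/-- For the constant sequence ∅ the partial sums are multiples of L(∅); they converge, so their
increment L(∅) is zero. -/
theorem ae_empty (hL : IsHomogeneousLevyBasis P T L) : L ∅ =ᵐ[P] 0 := by
  have h := hL.sigma_additive (fun _ => ∅) (fun _ => .empty) (fun i j _ => by simp [Function.onFun])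
    (by simpa using IsBoundedBorel.empty)
  filter_upwards [h] with ω hω
  simp only [Set.iUnion_empty, Finset.sum_const, Finset.card_range, nsmul_eq_mul] at hω
  have h2 := ((tendsto_add_atTop_iff_nat 1).2 hω).sub hω
  rw [sub_self] at h2
  refine tendsto_nhds_unique (tendsto_const_nhds.congr fun n => ?_) h2
  push_cast
  ring

theorem ae_union (hL : IsHomogeneousLevyBasis P T L) {A B : Set (ℝ × ℝ)} (hA : IsBoundedBorel A)
    (hB : IsBoundedBorel B) (hAB : Disjoint A B) : L (A ∪ B) =ᵐ[P] L A + L B := by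
  let S : ℕ → Set (ℝ × ℝ) := fun k => if k = 0 then A else if k = 1 then B else ∅
  have hU : ⋃ k, S k = A ∪ B := by
    ext p
    simp only [Set.mem_iUnion, Set.mem_union]
    constructor
    · rintro ⟨k, hk⟩
      simp only [S] at hk
      split_ifs at hk
      · exact Or.inl hk
      · exact Or.inr hk
      · exact hk.elim
    · rintro (h | h)
      · exact ⟨0, by simpa [S] using h⟩
      · exact ⟨1, by simpa [S] using h⟩
  have hS : ∀ k, IsBoundedBorel (S k) := fun k => by
    simp only [S]; split_ifs
    exacts [hA, hB, .empty]
  have hd : Pairwise (Function.onFun Disjoint S) := fun i j hij => by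
    simp only [Function.onFun, S]
    split_ifs <;> simp_all [disjoint_comm]
  filter_upwards [hL.sigma_additive S hS hd (hU ▸ hA.union hB), hL.ae_empty] with ω h1 h2
  rw [hU] at h1
  refine tendsto_nhds_unique h1 (tendsto_const_nhds.congr' ?_)
  filter_upwards [eventually_ge_atTop 2] with n hn
  obtain ⟨n, rfl⟩ := Nat.exists_eq_add_of_le' hn
  rw [Finset.sum_range_succ', Finset.sum_range_succ', Finset.sum_eq_zero]
  · simp [S, add_comm]
  · intro i _
    simpa [S] using h2

theorem ae_biUnion (hL : IsHomogeneousLevyBasis P T L) {ι : Type*} {A : ι → Set (ℝ × ℝ)}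
    (s : Finset ι) (hA : ∀ i ∈ s, IsBoundedBorel (A i))
    (hd : (s : Set ι).PairwiseDisjoint A) : L (⋃ i ∈ s, A i) =ᵐ[P] fun ω => ∑ i ∈ s, L (A i) ω := by
  classical
  induction s using Finset.induction_on with
  | empty =>
    filter_upwards [hL.ae_empty] with ω hω
    simpa using hω
  | insert i s hi ih =>
    have h1 := ih (fun j hj => hA j (Finset.mem_insert_of_mem hj))
      (hd.subset (by simp))
    have h2 := hL.ae_union (hA i (Finset.mem_insert_self i s))
      (IsBoundedBorel.biUnion s fun j hj => hA j (Finset.mem_insert_of_mem hj)) (by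
        rw [Set.disjoint_iUnion₂_right]
        intro j hj
        exact hd (by simp) (by simp [hj]) (fun h => hi (h ▸ hj)))
    rw [Finset.set_biUnion_insert]
    filter_upwards [h1, h2] with ω h1 h2
    rw [h2, Finset.sum_insert hi, Pi.add_apply, h1]

/-- The family is moved to ℕ along an injection and padded with empty sets. -/
theorem iIndepFun_of_countable (hL : IsHomogeneousLevyBasis P T L) {ι : Type*} [Countable ι]
    {A : ι → Set (ℝ × ℝ)} (hA : ∀ i, IsBoundedBorel (A i))
    (hd : Pairwise (Function.onFun Disjoint A)) : iIndepFun (fun i => L (A i)) P := by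
  obtain ⟨g, hg⟩ := Countable.exists_injective_nat ι
  have key : ∀ k, (∃ i, g i = k ∧ Function.extend g A (fun _ => ∅) k = A i) ∨
      Function.extend g A (fun _ => ∅) k = ∅ := fun k => by
    by_cases h : ∃ i, g i = k
    · obtain ⟨i, rfl⟩ := h
      exact Or.inl ⟨i, rfl, hg.extend_apply _ _ _⟩
    · exact Or.inr (Function.extend_apply' _ _ _ h)
  have h := hL.indep (Function.extend g A fun _ => ∅) (fun k => by
    rcases key k with ⟨i, -, h⟩ | h <;> rw [h]
    exacts [hA i, .empty]) (fun j k hjk => by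
    simp only [Function.onFun]
    rcases key j with ⟨i, hi, h⟩ | h <;> rw [h]
    · rcases key k with ⟨i', hi', h'⟩ | h' <;> rw [h']
      · exact hd fun e => hjk (by rw [← hi, ← hi', e])
      · simp
    · simp)
  have h2 := h.precomp hg
  simpa only [hg.extend_apply] using h2

/-- The part of the plane that lies exactly in the sets `S i` with `i ∈ I`. -/
def atom {ι : Type*} (S : ι → Set (ℝ × ℝ)) (I : Finset ι) : Set (ℝ × ℝ) :=
  {p | I.Nonempty ∧ ∀ i, p ∈ S i ↔ i ∈ I}

/-- The nonemptiness condition in `atom` is essential here: the complement of all S i would in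
general have infinite area. -/
theorem isBoundedBorel_atom {ι : Type*} [Countable ι] {S : ι → Set (ℝ × ℝ)}
    (hS : ∀ i, IsBoundedBorel (S i)) (I : Finset ι) : IsBoundedBorel (atom S I) := by
  rcases I.eq_empty_or_nonempty with rfl | ⟨i, hi⟩
  · simpa [atom] using IsBoundedBorel.empty
  refine (hS i).subset ?_ fun p hp => (hp.2 i).2 hi
  have : atom S I = ⋂ i, {p | p ∈ S i ↔ i ∈ I} := by
    ext p
    simp [atom, show I.Nonempty from ⟨i, hi⟩]
  rw [this]
  refine MeasurableSet.iInter fun j => ?_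
  by_cases hj : j ∈ I
  · simpa [hj] using (hS j).1
  · simp only [hj, iff_false]
    exact (hS j).1.compl

theorem disjoint_atom {ι : Type*} (S : ι → Set (ℝ × ℝ)) {I J : Finset ι} (h : I ≠ J) :
    Disjoint (atom S I) (atom S J) := by
  rw [Set.disjoint_left]
  exact fun p hp hq => h (Finset.ext fun i => (hp.2 i).symm.trans (hq.2 i))

theorem ae_eq_sum_atom (hL : IsHomogeneousLevyBasis P T L) {ι : Type*} [Fintype ι]
    [DecidableEq ι] {S : ι → Set (ℝ × ℝ)} (hS : ∀ i, IsBoundedBorel (S i)) (i : ι) :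
    L (S i) =ᵐ[P] fun ω => ∑ I : Finset ι with i ∈ I, L (atom S I) ω := by
  classical
  have e : S i = ⋃ I ∈ Finset.univ.filter (fun I : Finset ι => i ∈ I), atom S I := by
    ext p
    simp only [Finset.mem_filter_univ, Set.mem_iUnion, exists_prop]
    refine ⟨fun hp => ⟨Finset.univ.filter fun j => p ∈ S j, by simpa using hp,
      ⟨i, by simpa using hp⟩, by simp⟩, fun ⟨I, hI, hp⟩ => (hp.2 i).2 hI⟩
  conv_lhs => rw [e]
  exact hL.ae_biUnion _ (fun I _ => isBoundedBorel_atom hS I) fun I _ J _ h => disjoint_atom S h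

/-- Independent scattering concerns disjoint sets, while the S i may overlap one another. Both
vectors are almost surely sums over atoms, and the atoms of S are disjoint from those of R, so the
vectors are functions of disjoint blocks of one independent family. -/
theorem indepFun_pi (hL : IsHomogeneousLevyBasis P T L) {ι κ : Type*} [Fintype ι] [Fintype κ]
    {S : ι → Set (ℝ × ℝ)} {R : κ → Set (ℝ × ℝ)} (hS : ∀ i, IsBoundedBorel (S i))
    (hR : ∀ j, IsBoundedBorel (R j)) (hd : ∀ i j, Disjoint (S i) (R j)) :
    IndepFun (fun ω i => L (S i) ω) (fun ω j => L (R j) ω) P := by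
  classical
  let A : Finset ι ⊕ Finset κ → Set (ℝ × ℝ) := Sum.elim (atom S) (atom R)
  have hA : ∀ x, IsBoundedBorel (A x) := by
    rintro (I | J)
    exacts [isBoundedBorel_atom hS I, isBoundedBorel_atom hR J]
  have hcross : ∀ I J, Disjoint (atom S I) (atom R J) := fun I J => by
    rw [Set.disjoint_left]
    rintro p ⟨⟨i, hi⟩, hp⟩ ⟨⟨j, hj⟩, hq⟩
    exact Set.disjoint_left.1 (hd i j) ((hp i).2 hi) ((hq j).2 hj)
  have hAd : Pairwise (Function.onFun Disjoint A) := by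
    rintro (I | J) (I' | J') h
    · exact disjoint_atom S fun e => h (e ▸ rfl)
    · exact hcross _ _
    · exact (hcross _ _).symm
    · exact disjoint_atom R fun e => h (e ▸ rfl)
  have h1 := (hL.iIndepFun_of_countable hA hAd).indepFun_finset
    (Finset.univ.map Function.Embedding.inl) (Finset.univ.map Function.Embedding.inr)
    (by rw [Finset.disjoint_left]; simp) (fun x => hL.measurable _ (hA x))
  have h2 := h1.comp
    (φ := fun (f : Finset.univ.map Function.Embedding.inl → ℝ) (i : ι) => ∑ I : Finset ι with i ∈ I, f ⟨Sum.inl I, by simp⟩)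
    (ψ := fun (f : Finset.univ.map Function.Embedding.inr → ℝ) (j : κ) => ∑ J : Finset κ with j ∈ J, f ⟨Sum.inr J, by simp⟩)
    (by fun_prop) (by fun_prop)
  refine h2.congr ?_ ?_
  · filter_upwards [ae_all_iff.2 fun i => hL.ae_eq_sum_atom hS i] with ω hω
    exact funext fun i => (hω i).symm
  · filter_upwards [ae_all_iff.2 fun j => hL.ae_eq_sum_atom hR j] with ω hω
    exact funext fun j => (hω j).symm

theorem isConvolutionSemigroup [IsProbabilityMeasure P] (hL : IsHomogeneousLevyBasis P T L) :
    IsConvolutionSemigroup T.exponent fun v => P.map (L (rectangle v)) where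
  isProbabilityMeasure v := Measure.isProbabilityMeasure_map
    (hL.measurable _ (isBoundedBorel_rectangle v)).aemeasurable
  charFun_eq v hv z := by
    rw [hL.charFun_eq _ (isBoundedBorel_rectangle v), volume_rectangle, ENNReal.toReal_ofReal hv]

/-- The law depends on the area alone, so all moment questions reduce to the semigroup of the
rectangles. -/
theorem map_eq [IsProbabilityMeasure P] (hL : IsHomogeneousLevyBasis P T L) {A : Set (ℝ × ℝ)}
    (hA : IsBoundedBorel A) : P.map (L A) = P.map (L (rectangle (volume.real A))) := by
  have := Measure.isProbabilityMeasure_map (μ := P) (hL.measurable A hA).aemeasurable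
  have := Measure.isProbabilityMeasure_map (μ := P)
    (hL.measurable _ (isBoundedBorel_rectangle (volume.real A))).aemeasurable
  refine Measure.ext_of_charFun (funext fun z => ?_)
  rw [hL.charFun_eq A hA, hL.isConvolutionSemigroup.charFun_eq _ measureReal_nonneg, Measure.real]

end IsHomogeneousLevyBasis

/-- A centred, square-normalised, independently scattered random measure with fourth cumulant `c`
per unit volume and with fourth and fifth moments of small sets bounded by `K` times the volume. -/
structure IsCenteredBasis (P : Measure Ω) (K c : ℝ) (X : Set (ℝ × ℝ) → Ω → ℝ) : Prop where
  measurable : ∀ A, IsBoundedBorel A → Measurable (X A)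
  memLp : ∀ A, IsBoundedBorel A → MemLp (X A) 5 P
  ae_union : ∀ A B, IsBoundedBorel A → IsBoundedBorel B → Disjoint A B →
    X (A ∪ B) =ᵐ[P] X A + X B
  indepFun : ∀ (k l : ℕ) (S : Fin k → Set (ℝ × ℝ)) (R : Fin l → Set (ℝ × ℝ)),
    (∀ i, IsBoundedBorel (S i)) → (∀ j, IsBoundedBorel (R j)) → (∀ i j, Disjoint (S i) (R j)) →
    IndepFun (fun ω i => X (S i) ω) (fun ω j => X (R j) ω) P
  integral_eq_zero : ∀ A, IsBoundedBorel A → ∫ ω, X A ω ∂P = 0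
  integral_sq : ∀ A, IsBoundedBorel A → ∫ ω, X A ω ^ 2 ∂P = volume.real A
  integral_pow_four_eq : ∀ A B, IsBoundedBorel A → IsBoundedBorel B →
    volume.real A = volume.real B → ∫ ω, X A ω ^ 4 ∂P = ∫ ω, X B ω ^ 4 ∂P
  integral_pow_four_le : ∀ A, IsBoundedBorel A → volume.real A ≤ 1 →
    ∫ ω, X A ω ^ 4 ∂P ≤ K * volume.real A
  integral_abs_pow_five_le : ∀ A, IsBoundedBorel A → volume.real A ≤ 1 →
    ∫ ω, |X A ω| ^ 5 ∂P ≤ K * volume.real A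
  pow_four_asymptotics : ∀ ε > 0, ∃ δ > 0, ∀ A, IsBoundedBorel A → 0 < volume.real A →
    volume.real A < δ → |(∫ ω, X A ω ^ 4 ∂P) - c * volume.real A| ≤ ε * volume.real A

/-- The centred basis `A ↦ L A - E (L A)`. -/
noncomputable def centered (P : Measure Ω) (L : Set (ℝ × ℝ) → Ω → ℝ) (A : Set (ℝ × ℝ)) (ω : Ω) :
    ℝ := L A ω - ∫ ω, L A ω ∂P

theorem IsHomogeneousLevyBasis.isCenteredBasis [IsProbabilityMeasure P]
    (hL : IsHomogeneousLevyBasis P T L) (h5 : MemLp id 5 (P.map (L (rectangle 1))))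
    (hvar : Var[id; P.map (L (rectangle 1))] = 1) :
    ∃ K, 0 ≤ K ∧ IsCenteredBasis P K T.c4 (centered P L) := by
  set m : ℝ → Measure ℝ := fun v => P.map (L (rectangle v)) with hmdef
  have hm : IsConvolutionSemigroup T.exponent m := hL.isConvolutionSemigroup
  have := hm.isProbabilityMeasure
  have h12 : MemLp id 2 (m 1) := MemLp.mono_exponent h5 (by norm_num)
  have hm5 : ∀ v, 0 ≤ v → MemLp id 5 (m v) := fun v => hm.memLp (by simp) (by simp) h5
  have hmV : ∀ v, 0 ≤ v → Var[id; m v] = v := fun v => hm.variance_eq h12 hvar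
  have law : ∀ A, IsBoundedBorel A → P.map (L A) = m (volume.real A) := fun A => hL.map_eq
  have hmean : ∀ A, IsBoundedBorel A → ∫ ω, L A ω ∂P = mean (m (volume.real A)) := fun A hA => by
    rw [← law A hA, mean, integral_map (hL.measurable A hA).aemeasurable (by fun_prop)]
  have transfer : ∀ (f : ℝ → ℝ), Measurable f → ∀ A, IsBoundedBorel A →
      ∫ ω, f (centered P L A ω) ∂P
        = ∫ x, f (x - mean (m (volume.real A))) ∂m (volume.real A) := fun f hf A hA => by
    rw [← law A hA, integral_map (hL.measurable A hA).aemeasurable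
      (by fun_prop : Measurable _).aestronglyMeasurable]
    simp only [centered, law A hA, hmean A hA]
  have hLp : ∀ A, IsBoundedBorel A → MemLp (L A) 5 P := fun A hA => by
    have := hm5 _ (measureReal_nonneg (μ := volume) (s := A))
    rw [← law A hA] at this
    exact (memLp_map_measure_iff (by fun_prop) (hL.measurable A hA).aemeasurable).1 this
  set C := 16 * absCentralMomentFive (m 1) with hC
  have hC0 : 0 ≤ C := mul_nonneg (by norm_num) (integral_nonneg fun x => by positivity)
  -- From x⁴ ≤ x² + |x|⁵: the variance contributes 1 and the fifth moment contributes C.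
  refine ⟨1 + C, by positivity, ?_⟩
  exact {
    measurable := fun A hA => (hL.measurable A hA).sub_const _
    memLp := fun A hA => (hLp A hA).sub (memLp_const _)
    ae_union := fun A B hA hB hAB => by
      have h := hL.ae_union hA hB hAB
      have e : ∫ ω, L (A ∪ B) ω ∂P = ∫ ω, L A ω ∂P + ∫ ω, L B ω ∂P := by
        rw [integral_congr_ae h]
        exact integral_add ((hLp A hA).integrable (by norm_num))
          ((hLp B hB).integrable (by norm_num))
      filter_upwards [h] with ω hω
      simp only [centered, hω, e, Pi.add_apply]
      ring
    indepFun := fun k l S R hS hR hd =>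
      (hL.indepFun_pi hS hR hd).comp
        (φ := fun (f : Fin k → ℝ) i => f i - ∫ ω, L (S i) ω ∂P)
        (ψ := fun (f : Fin l → ℝ) i => f i - ∫ ω, L (R i) ω ∂P)
        (by fun_prop) (by fun_prop)
    integral_eq_zero := fun A hA => by
      rw [transfer (fun x => x) (by fun_prop) A hA]
      exact integral_sub_mean ((hm5 _ measureReal_nonneg).integrable (by norm_num))
    integral_sq := fun A hA => by
      rw [transfer (fun x => x ^ 2) (by fun_prop) A hA]
      exact (variance_eq_integral measurable_id.aemeasurable).symm.trans (hmV _ measureReal_nonneg)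
    integral_pow_four_eq := fun A B hA hB h => by
      rw [transfer (fun x => x ^ 4) (by fun_prop) A hA, transfer (fun x => x ^ 4) (by fun_prop) B hB,
        h]
    integral_pow_four_le := fun A hA hA1 => by
      rw [transfer (fun x => x ^ 4) (by fun_prop) A hA]
      have h1 := IsConvolutionSemigroup.integral_sub_mean_pow_four_le
        (hm5 _ (measureReal_nonneg (μ := volume) (s := A)))
      have h2 := hm.absCentralMomentFive_le h5 measureReal_nonneg hA1
      rw [hmV _ measureReal_nonneg] at h1
      linarith
    integral_abs_pow_five_le := fun A hA hA1 => by
      rw [transfer (fun x => |x| ^ 5) (by fun_prop) A hA]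
      have h2 := hm.absCentralMomentFive_le h5 measureReal_nonneg hA1
      have h3 := measureReal_nonneg (μ := volume) (s := A)
      rw [← hC] at h2
      exact h2.trans (by linarith)
    pow_four_asymptotics := fun ε hε => by
      have h := Metric.tendsto_nhdsWithin_nhds.1 (hm.tendsto_fourth_moment h5 hvar) ε hε
      obtain ⟨δ, hδ, h⟩ := h
      refine ⟨δ, hδ, fun A hA h0 h1 => ?_⟩
      have := h h0 (by rw [Real.dist_eq, sub_zero, abs_of_pos h0]; exact h1)
      rw [transfer (fun x => x ^ 4) (by fun_prop) A hA]
      rw [Real.dist_eq, div_sub' h0.ne', abs_div, abs_of_pos h0, div_lt_iff₀ h0] at this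
      rw [mul_comm (T.c4)]
      exact this.le }

end LevyBasis

/-! ### Mixed moments of a centred basis -/

section CenteredBasis

variable {Ω : Type*} [MeasurableSpace Ω] {P : Measure Ω} {K c : ℝ}
  {X : Set (ℝ × ℝ) → Ω → ℝ}

/-- The mixed fourth moment of a random set function. -/
noncomputable def mixedMoment (P : Measure Ω) (X : Set (ℝ × ℝ) → Ω → ℝ) (A B C D : Set (ℝ × ℝ)) :
    ℝ := ∫ ω, X A ω * X B ω * X C ω * X D ω ∂P

theorem mixedMoment_swap (A B C D : Set (ℝ × ℝ)) :
    mixedMoment P X A B C D = mixedMoment P X C D A B :=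
  integral_congr_ae (ae_of_all _ fun ω => by ring)

theorem mixedMoment_swap_left (A B C D : Set (ℝ × ℝ)) :
    mixedMoment P X A B C D = mixedMoment P X B A C D :=
  integral_congr_ae (ae_of_all _ fun ω => by ring)

theorem mixedMoment_swap_mid (A B C D : Set (ℝ × ℝ)) :
    mixedMoment P X A B C D = mixedMoment P X A D C B :=
  integral_congr_ae (ae_of_all _ fun ω => by ring)

theorem abs_mul_four_le (a b c d : ℝ) :
    |a * b * c * d| ≤ |a| ^ 4 + |b| ^ 4 + |c| ^ 4 + |d| ^ 4 := by
  rw [abs_mul, abs_mul, abs_mul]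
  nlinarith [sq_nonneg (|a| * |b| - |c| * |d|), sq_nonneg (|a| ^ 2 - |b| ^ 2),
    sq_nonneg (|c| ^ 2 - |d| ^ 2), sq_nonneg (|a| ^ 2), sq_nonneg (|b| ^ 2), sq_nonneg (|c| ^ 2),
    sq_nonneg (|d| ^ 2)]

namespace IsCenteredBasis

theorem ae_inter_add_diff (hX : IsCenteredBasis P K c X) {A S : Set (ℝ × ℝ)}
    (hA : IsBoundedBorel A) (hS : IsBoundedBorel S) :
    ∀ᵐ ω ∂P, X A ω = X (A ∩ S) ω + X (A \ S) ω := by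
  have h := hX.ae_union (A ∩ S) (A \ S) (hA.inter hS) (hA.diff hS)
    Set.disjoint_sdiff_inter.symm
  rwa [Set.inter_union_sdiff] at h

theorem indepFun_of_disjoint (hX : IsCenteredBasis P K c X) {A B : Set (ℝ × ℝ)}
    (hA : IsBoundedBorel A) (hB : IsBoundedBorel B) (h : Disjoint A B) :
    IndepFun (X A) (X B) P :=
  (hX.indepFun 1 1 (fun _ => A) (fun _ => B) (fun _ => hA) (fun _ => hB) (fun _ _ => h)).comp
    (φ := fun f : Fin 1 → ℝ => f 0) (ψ := fun f : Fin 1 → ℝ => f 0)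
    (by fun_prop) (by fun_prop)

theorem integral_comp_mul_comp (hX : IsCenteredBasis P K c X) {A B : Set (ℝ × ℝ)}
    (hA : IsBoundedBorel A) (hB : IsBoundedBorel B) (h : Disjoint A B) {f g : ℝ → ℝ}
    (hf : Measurable f) (hg : Measurable g) :
    ∫ ω, f (X A ω) * g (X B ω) ∂P = (∫ ω, f (X A ω) ∂P) * ∫ ω, g (X B ω) ∂P :=
  ((hX.indepFun_of_disjoint hA hB h).comp hf hg).integral_fun_mul_eq_mul_integral
    (hf.comp (hX.measurable A hA)).aestronglyMeasurable
    (hg.comp (hX.measurable B hB)).aestronglyMeasurable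

theorem integral_mul_of_disjoint (hX : IsCenteredBasis P K c X) {A B : Set (ℝ × ℝ)}
    (hA : IsBoundedBorel A) (hB : IsBoundedBorel B) (h : Disjoint A B) :
    ∫ ω, X A ω * X B ω ∂P = 0 := by
  rw [hX.integral_comp_mul_comp hA hB h measurable_id' measurable_id',
    hX.integral_eq_zero A hA, zero_mul]

variable [IsProbabilityMeasure P]

theorem integrable_abs_pow (hX : IsCenteredBasis P K c X) {A : Set (ℝ × ℝ)} (hA : IsBoundedBorel A)
    {k : ℕ} (hk : k ≤ 5) : Integrable (fun ω => |X A ω| ^ k) P := by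
  rcases Nat.eq_zero_or_pos k with rfl | h0
  · simp
  have h1 : MemLp (X A) k P := (hX.memLp A hA).mono_exponent (by exact_mod_cast hk)
  simpa using h1.integrable_norm_pow h0.ne'

theorem integrable_pow (hX : IsCenteredBasis P K c X) {A : Set (ℝ × ℝ)} (hA : IsBoundedBorel A)
    {k : ℕ} (hk : k ≤ 5) : Integrable (fun ω => X A ω ^ k) P :=
  (hX.integrable_abs_pow hA hk).mono' ((hX.measurable A hA).pow_const k).aestronglyMeasurable
    (by simp)

theorem integrable (hX : IsCenteredBasis P K c X) {A : Set (ℝ × ℝ)} (hA : IsBoundedBorel A) :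
    Integrable (X A) P := (hX.memLp A hA).integrable (by norm_num)

theorem integrable_mul (hX : IsCenteredBasis P K c X) {A B : Set (ℝ × ℝ)} (hA : IsBoundedBorel A)
    (hB : IsBoundedBorel B) : Integrable (fun ω => X A ω * X B ω) P := by
  refine ((hX.integrable_pow hA (k := 2) (by norm_num)).add
    (hX.integrable_pow hB (k := 2) (by norm_num))).mono'
    ((hX.measurable A hA).mul (hX.measurable B hB)).aestronglyMeasurable
    (ae_of_all _ fun ω => ?_)
  rw [Real.norm_eq_abs, abs_mul, Pi.add_apply, ← sq_abs (X A ω), ← sq_abs (X B ω)]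
  nlinarith [sq_nonneg (|X A ω| - |X B ω|), sq_nonneg |X A ω|, sq_nonneg |X B ω|]

theorem integrable_mul_four (hX : IsCenteredBasis P K c X) {A B C D : Set (ℝ × ℝ)}
    (hA : IsBoundedBorel A) (hB : IsBoundedBorel B) (hC : IsBoundedBorel C)
    (hD : IsBoundedBorel D) : Integrable (fun ω => X A ω * X B ω * X C ω * X D ω) P :=
  ((((hX.integrable_abs_pow hA (k := 4) (by norm_num)).add
    (hX.integrable_abs_pow hB (k := 4) (by norm_num))).add
    (hX.integrable_abs_pow hC (k := 4) (by norm_num))).add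
    (hX.integrable_abs_pow hD (k := 4) (by norm_num))).mono'
    ((((hX.measurable A hA).mul (hX.measurable B hB)).mul (hX.measurable C hC)).mul
      (hX.measurable D hD)).aestronglyMeasurable
    (ae_of_all _ fun ω => abs_mul_four_le _ _ _ _)

/-- Split both sets along A ∩ B; every product other than the square of X(A ∩ B) involves disjoint
sets and has mean zero. -/
theorem integral_mul (hX : IsCenteredBasis P K c X) {A B : Set (ℝ × ℝ)}
    (hA : IsBoundedBorel A) (hB : IsBoundedBorel B) :
    ∫ ω, X A ω * X B ω ∂P = volume.real (A ∩ B) := by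
  have hi := hA.inter hB
  have hi' := hB.diff hA
  have e : (fun ω => X A ω * X B ω) =ᵐ[P] fun ω => X (A ∩ B) ω ^ 2 + X (A \ B) ω * X (A ∩ B) ω
      + X A ω * X (B \ A) ω := by
    filter_upwards [hX.ae_inter_add_diff hA hB, hX.ae_inter_add_diff hB hA] with ω h1 h2
    rw [h2, h1, Set.inter_comm B A]
    ring
  rw [integral_congr_ae e, integral_add
    (by exact (hX.integrable_pow hi (by norm_num)).add (hX.integrable_mul (hA.diff hB) hi))
    (hX.integrable_mul hA hi'), integral_add (hX.integrable_pow hi (by norm_num))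
    (hX.integrable_mul (hA.diff hB) hi), hX.integral_sq _ hi,
    hX.integral_mul_of_disjoint (hA.diff hB) hi Set.disjoint_sdiff_inter,
    hX.integral_mul_of_disjoint hA hi' Set.disjoint_sdiff_right]
  ring

theorem mixedMoment_split (hX : IsCenteredBasis P K c X) {A B C D S : Set (ℝ × ℝ)}
    (hA : IsBoundedBorel A) (hB : IsBoundedBorel B) (hC : IsBoundedBorel C)
    (hD : IsBoundedBorel D) (hS : IsBoundedBorel S) :
    mixedMoment P X A B C D = mixedMoment P X (A ∩ S) B C D + mixedMoment P X (A \ S) B C D := by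
  unfold mixedMoment
  rw [← integral_add (hX.integrable_mul_four (hA.inter hS) hB hC hD)
    (hX.integrable_mul_four (hA.diff hS) hB hC hD)]
  refine integral_congr_ae ?_
  filter_upwards [hX.ae_inter_add_diff hA hS] with ω h
  rw [h]
  ring

/-- X(A) is centred and independent of the other three factors jointly. -/
theorem mixedMoment_eq_zero (hX : IsCenteredBasis P K c X) {A B C D : Set (ℝ × ℝ)}
    (hA : IsBoundedBorel A) (hB : IsBoundedBorel B) (hC : IsBoundedBorel C)
    (hD : IsBoundedBorel D) (hAB : Disjoint A B) (hAC : Disjoint A C) (hAD : Disjoint A D) :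
    mixedMoment P X A B C D = 0 := by
  have h0 : Measurable (fun f : Fin 1 → ℝ => f 0) := measurable_pi_apply 0
  have h := (hX.indepFun 1 3 (fun _ => A) ![B, C, D] (fun _ => hA)
    (fun j => by fin_cases j <;> assumption) (fun _ j => by fin_cases j <;> assumption)).comp
    (φ := fun f : Fin 1 → ℝ => f 0) (ψ := fun f : Fin 3 → ℝ => f 0 * f 1 * f 2)
    h0 (by fun_prop)
  have h2 := h.integral_fun_mul_eq_mul_integral (hX.measurable A hA).aestronglyMeasurable
    (((hX.measurable B hB).mul (hX.measurable C hC)).mul (hX.measurable D hD)).aestronglyMeasurable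
  have e : ∫ ω, ((fun f : Fin 1 → ℝ => f 0) ∘ fun ω (_ : Fin 1) => X A ω) ω ∂P = 0 :=
    hX.integral_eq_zero A hA
  rw [e, zero_mul] at h2
  rw [← h2]
  refine integral_congr_ae (ae_of_all _ fun ω => ?_)
  simp
  ring

theorem mixedMoment_eq_mul (hX : IsCenteredBasis P K c X) {A B C D : Set (ℝ × ℝ)}
    (hA : IsBoundedBorel A) (hB : IsBoundedBorel B) (hC : IsBoundedBorel C)
    (hD : IsBoundedBorel D) (hAC : Disjoint A C) (hAD : Disjoint A D) (hBC : Disjoint B C)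
    (hBD : Disjoint B D) :
    mixedMoment P X A B C D = volume.real (A ∩ B) * volume.real (C ∩ D) := by
  have h := (hX.indepFun 2 2 ![A, B] ![C, D] (fun i => by fin_cases i <;> assumption)
    (fun j => by fin_cases j <;> assumption)
    (fun i j => by fin_cases i <;> fin_cases j <;> assumption)).comp
    (φ := fun f : Fin 2 → ℝ => f 0 * f 1) (ψ := fun f : Fin 2 → ℝ => f 0 * f 1) (by fun_prop) (by fun_prop)
  have h2 := h.integral_fun_mul_eq_mul_integral
    ((hX.measurable A hA).mul (hX.measurable B hB)).aestronglyMeasurable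
    ((hX.measurable C hC).mul (hX.measurable D hD)).aestronglyMeasurable
  rw [← hX.integral_mul hA hB, ← hX.integral_mul hC hD]
  refine Eq.trans ?_ h2
  refine integral_congr_ae (ae_of_all _ fun ω => ?_)
  simp
  ring

/-- Wick's formula for the mixed fourth moment when the second and the fourth set are disjoint. -/
theorem mixedMoment_of_disjoint (hX : IsCenteredBasis P K c X) {A B C D : Set (ℝ × ℝ)}
    (hA : IsBoundedBorel A) (hB : IsBoundedBorel B) (hC : IsBoundedBorel C)
    (hD : IsBoundedBorel D) (hBD : Disjoint B D) :
    mixedMoment P X A B C D = volume.real (A ∩ B) * volume.real (C ∩ D)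
      + volume.real (A ∩ D) * volume.real (C ∩ B) := by
  have dB : ∀ {E : Set (ℝ × ℝ)}, Disjoint (E \ B) B := by
    intro E; exact Set.disjoint_sdiff_left
  have dD : ∀ {E : Set (ℝ × ℝ)}, Disjoint (E \ D) D := by
    intro E; exact Set.disjoint_sdiff_left
  have iB : ∀ {E : Set (ℝ × ℝ)}, Disjoint (E ∩ B) D := by
    intro E; exact hBD.mono_left Set.inter_subset_right
  have iD : ∀ {E : Set (ℝ × ℝ)}, Disjoint (E ∩ D) B := by
    intro E; exact hBD.symm.mono_left Set.inter_subset_right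
  have bB : ∀ {E}, IsBoundedBorel E → IsBoundedBorel (E ∩ B) := fun h => h.inter hB
  have bD : ∀ {E}, IsBoundedBorel E → IsBoundedBorel (E ∩ D) := fun h => h.inter hD
  have bO : ∀ {E}, IsBoundedBorel E → IsBoundedBorel ((E \ B) \ D) := fun h =>
    (h.diff hB).diff hD
  have split1 : ∀ {E F G H : Set (ℝ × ℝ)}, IsBoundedBorel E → IsBoundedBorel F →
      IsBoundedBorel G → IsBoundedBorel H → mixedMoment P X E F G H
        = mixedMoment P X (E ∩ B) F G H + mixedMoment P X (E ∩ D) F G H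
          + mixedMoment P X ((E \ B) \ D) F G H := fun {E F G H} hE hF hG hH => by
    rw [hX.mixedMoment_split hE hF hG hH hB, hX.mixedMoment_split (hE.diff hB) hF hG hH hD,
      show (E \ B) ∩ D = E ∩ D by
        ext p
        simp only [Set.mem_inter_iff, Set.mem_sdiff]
        exact ⟨fun h => ⟨h.1.1, h.2⟩, fun h => ⟨⟨h.1, fun hb => Set.disjoint_left.1 hBD hb h.2⟩, h.2⟩⟩]
    ring
  have zeroB : ∀ {E F : Set (ℝ × ℝ)}, IsBoundedBorel E → IsBoundedBorel F → Disjoint E B →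
      Disjoint F B → mixedMoment P X E B F D = 0 := fun hE hF h1 h2 => by
    rw [mixedMoment_swap_left]
    exact hX.mixedMoment_eq_zero hB hE hF hD h1.symm h2.symm hBD
  have zeroD : ∀ {E F : Set (ℝ × ℝ)}, IsBoundedBorel E → IsBoundedBorel F → Disjoint E D →
      Disjoint F D → mixedMoment P X E B F D = 0 := fun hE hF h1 h2 => by
    rw [mixedMoment_swap, mixedMoment_swap_left]
    exact hX.mixedMoment_eq_zero hD hF hE hB h2.symm h1.symm hBD.symm
  have main1 : mixedMoment P X (A ∩ B) B (C ∩ D) D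
      = volume.real (A ∩ B) * volume.real (C ∩ D) := by
    rw [hX.mixedMoment_eq_mul (bB hA) hB (bD hC) hD (iB.mono_right Set.inter_subset_right) iB
      (iD.symm) hBD, Set.inter_assoc, Set.inter_self, Set.inter_assoc, Set.inter_self]
  have main2 : mixedMoment P X (A ∩ D) B (C ∩ B) D
      = volume.real (A ∩ D) * volume.real (C ∩ B) := by
    rw [mixedMoment_swap_mid, hX.mixedMoment_eq_mul (bD hA) hD (bB hC) hB
      (iD.mono_right Set.inter_subset_right) iD iB.symm hBD.symm, Set.inter_assoc, Set.inter_self,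
      Set.inter_assoc, Set.inter_self]
  have splitC : ∀ {E : Set (ℝ × ℝ)}, IsBoundedBorel E → mixedMoment P X E B C D
      = mixedMoment P X E B (C ∩ B) D + mixedMoment P X E B (C ∩ D) D
        + mixedMoment P X E B ((C \ B) \ D) D := fun {E} hE => by
    rw [mixedMoment_swap, split1 hC hD hE hB, mixedMoment_swap, mixedMoment_swap (C ∩ D),
      mixedMoment_swap ((C \ B) \ D)]
  have oB : ∀ {E : Set (ℝ × ℝ)}, Disjoint ((E \ B) \ D) B := by
    intro E; exact dB.mono_left Set.sdiff_subset
  -- A and C are each cut into the parts in B, in D and in neither. Of the nine terms only (A ∩ B, C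
  -- ∩ D) and (A ∩ D, C ∩ B) survive; in the others X(B) or X(D) stands alone.
  rw [split1 hA hB hC hD, splitC (bB hA), splitC (bD hA), splitC (bO hA), main1, main2,
    zeroD (bB hA) (bB hC) iB iB, zeroD (bB hA) (bO hC) iB dD, zeroB (bD hA) (bD hC) iD iD,
    zeroB (bD hA) (bO hC) iD oB, zeroD (bO hA) (bB hC) dD iB, zeroB (bO hA) (bD hC) oB iD,
    zeroB (bO hA) (bO hC) oB oB]
  ring

theorem integrable_mul_sq (hX : IsCenteredBasis P K c X) {A B : Set (ℝ × ℝ)}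
    (hA : IsBoundedBorel A) (hB : IsBoundedBorel B) :
    Integrable (fun ω => (X A ω * X B ω) ^ 2) P :=
  (hX.integrable_mul_four hA hB hA hB).congr (ae_of_all _ fun ω => by ring)

/-- The point is linearity in |B| although A need not be small: X(A \ B) is independent of X(B), and
X(A ∩ B) is handled by fourth moments of small sets. -/
theorem integral_mul_sq_le (hX : IsCenteredBasis P K c X) {A B : Set (ℝ × ℝ)}
    (hA : IsBoundedBorel A) (hB : IsBoundedBorel B) (hB1 : volume.real B ≤ 1) (hK : 0 ≤ K) :
    ∫ ω, (X A ω * X B ω) ^ 2 ∂P ≤ (2 * volume.real A + 2 * K) * volume.real B := by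
  have hi := hA.inter hB
  have hd := hA.diff hB
  have i4 : ∀ {E}, IsBoundedBorel E → Integrable (fun ω => X E ω ^ 4) P := fun h =>
    hX.integrable_pow h (by norm_num)
  have hmono : volume.real (A ∩ B) ≤ volume.real B :=
    measureReal_mono Set.inter_subset_right hB.2.ne
  have hmono' : volume.real (A \ B) ≤ volume.real A := measureReal_mono Set.sdiff_subset hA.2.ne
  have e1 : ∫ ω, X (A \ B) ω ^ 2 * X B ω ^ 2 ∂P = volume.real (A \ B) * volume.real B := by
    rw [hX.integral_comp_mul_comp hd hB Set.disjoint_sdiff_left (f := fun x => x ^ 2)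
      (g := fun x => x ^ 2) (by fun_prop) (by fun_prop), hX.integral_sq _ hd, hX.integral_sq _ hB]
  have i1 : Integrable (fun ω => X (A \ B) ω ^ 2 * X B ω ^ 2) P := by
    simpa only [mul_pow] using hX.integrable_mul_sq hd hB
  calc ∫ ω, (X A ω * X B ω) ^ 2 ∂P
      ≤ ∫ ω, (2 * (X (A \ B) ω ^ 2 * X B ω ^ 2) + (X (A ∩ B) ω ^ 4 + X B ω ^ 4)) ∂P := by
        refine integral_mono_ae (hX.integrable_mul_sq hA hB)
          ((i1.const_mul 2).add ((i4 hi).add (i4 hB))) ?_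
        filter_upwards [hX.ae_inter_add_diff hA hB] with ω h
        rw [h, mul_pow]
        have a1 : (X (A ∩ B) ω + X (A \ B) ω) ^ 2 ≤ 2 * X (A \ B) ω ^ 2 + 2 * X (A ∩ B) ω ^ 2 := by
          nlinarith [sq_nonneg (X (A ∩ B) ω - X (A \ B) ω)]
        nlinarith [mul_le_mul_of_nonneg_right a1 (sq_nonneg (X B ω)),
          sq_nonneg (X (A ∩ B) ω ^ 2 - X B ω ^ 2)]
    _ = 2 * (volume.real (A \ B) * volume.real B)
          + (∫ ω, X (A ∩ B) ω ^ 4 ∂P + ∫ ω, X B ω ^ 4 ∂P) := by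
        rw [integral_add (i1.const_mul 2) (by exact (i4 hi).add (i4 hB)), integral_const_mul, e1,
          integral_add (i4 hi) (i4 hB)]
    _ ≤ 2 * (volume.real A * volume.real B) + (K * volume.real B + K * volume.real B) := by
        have b1 := hX.integral_pow_four_le _ hi (hmono.trans hB1)
        have b2 := hX.integral_pow_four_le _ hB hB1
        have b3 : K * volume.real (A ∩ B) ≤ K * volume.real B := by gcongr
        have b4 : volume.real (A \ B) * volume.real B ≤ volume.real A * volume.real B := by gcongr
        linarith
    _ = _ := by ring

/-- Second moment bound for sums of products along a disjoint family. -/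
theorem integral_sum_mul_sub_sq_le (hX : IsCenteredBasis P K c X) (hK : 0 ≤ K) (s : Finset ℕ)
    {A B : ℕ → Set (ℝ × ℝ)} (hA : ∀ k, IsBoundedBorel (A k)) (hB : ∀ k, IsBoundedBorel (B k))
    (hd : Pairwise (Function.onFun Disjoint B)) {a b : ℝ} (ha : ∀ k, volume.real (A k) ≤ a)
    (hb : ∀ k, volume.real (B k) ≤ b) (hb1 : b ≤ 1) :
    Integrable (fun ω => (∑ k ∈ s, (X (A k) ω * X (B k) ω - volume.real (A k ∩ B k))) ^ 2) P ∧
    ∫ ω, (∑ k ∈ s, (X (A k) ω * X (B k) ω - volume.real (A k ∩ B k))) ^ 2 ∂P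
      ≤ s.card * ((2 * a + 2 * K) * b) + ∑ k ∈ s, ∑ j ∈ s.erase k,
          volume.real (A k ∩ B j) * volume.real (A j ∩ B k) := by
  set W : ℕ → Ω → ℝ := fun k ω => X (A k) ω * X (B k) ω - volume.real (A k ∩ B k) with hW
  have iP : ∀ k, Integrable (fun ω => X (A k) ω * X (B k) ω) P := fun k =>
    hX.integrable_mul (hA k) (hB k)
  have i4 : ∀ k j, Integrable (fun ω => X (A k) ω * X (B k) ω * X (A j) ω * X (B j) ω) P :=
    fun k j => hX.integrable_mul_four (hA k) (hB k) (hA j) (hB j)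
  have eW : ∀ k j, (fun ω => W k ω * W j ω) = fun ω =>
      X (A k) ω * X (B k) ω * X (A j) ω * X (B j) ω
        - volume.real (A j ∩ B j) * (X (A k) ω * X (B k) ω)
        - volume.real (A k ∩ B k) * (X (A j) ω * X (B j) ω)
        + volume.real (A k ∩ B k) * volume.real (A j ∩ B j) := fun k j => by
    funext ω
    simp only [hW]
    ring
  have iW : ∀ k j, Integrable (fun ω => W k ω * W j ω) P := fun k j => by
    rw [eW]
    exact (((i4 k j).sub ((iP k).const_mul _)).sub ((iP j).const_mul _)).add
      (integrable_const _)
  have eI : ∀ k j, ∫ ω, W k ω * W j ω ∂P = mixedMoment P X (A k) (B k) (A j) (B j)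
      - volume.real (A k ∩ B k) * volume.real (A j ∩ B j) := fun k j => by
    rw [eW, integral_add (by exact ((i4 k j).sub ((iP k).const_mul _)).sub ((iP j).const_mul _))
      (integrable_const _), integral_sub (by exact (i4 k j).sub ((iP k).const_mul _))
      ((iP j).const_mul _), integral_sub (i4 k j) ((iP k).const_mul _), integral_const_mul,
      integral_const_mul, hX.integral_mul (hA k) (hB k), hX.integral_mul (hA j) (hB j),
      integral_const, mixedMoment]
    simp
    ring
  have e2 : (fun ω => (∑ k ∈ s, W k ω) ^ 2) = fun ω => ∑ k ∈ s, ∑ j ∈ s, W k ω * W j ω := by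
    funext ω
    rw [sq, Finset.sum_mul_sum]
  refine ⟨by
    rw [e2]
    exact integrable_finsetSum _ fun k _ => integrable_finsetSum _ fun j _ => iW k j, ?_⟩
  rw [e2, integral_finsetSum _ fun k _ => integrable_finsetSum _ fun j _ => iW k j]
  have hterm : ∀ k ∈ s, ∫ ω, ∑ j ∈ s, W k ω * W j ω ∂P ≤ (2 * a + 2 * K) * b
      + ∑ j ∈ s.erase k, volume.real (A k ∩ B j) * volume.real (A j ∩ B k) := fun k hk => by
    rw [integral_finsetSum _ fun j _ => iW k j, ← Finset.add_sum_erase _ _ hk]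
    refine add_le_add ?_ (Finset.sum_le_sum fun j hj => ?_)
    · rw [eI]
      have h1 := hX.integral_mul_sq_le (hA k) (hB k) ((hb k).trans hb1) hK
      have h2 : mixedMoment P X (A k) (B k) (A k) (B k) = ∫ ω, (X (A k) ω * X (B k) ω) ^ 2 ∂P :=
        integral_congr_ae (ae_of_all _ fun ω => by ring)
      have h3 : (2 * volume.real (A k) + 2 * K) * volume.real (B k) ≤ (2 * a + 2 * K) * b := by
        have := (measureReal_nonneg (μ := volume) (s := A k)).trans (ha k)
        gcongr
        exacts [ha k, hb k]
      nlinarith [mul_self_nonneg (volume.real (A k ∩ B k))]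
    -- The first Wick term is the product of the means and cancels; the crossed overlaps remain.
    · rw [eI, hX.mixedMoment_of_disjoint (hA k) (hB k) (hA j) (hB j)
        (hd (Finset.ne_of_mem_erase hj).symm)]
      linarith
  refine (Finset.sum_le_sum hterm).trans (le_of_eq ?_)
  rw [Finset.sum_add_distrib, Finset.sum_const, nsmul_eq_mul]

end IsCenteredBasis

end CenteredBasis

/-! ### Laws of large numbers for squares and fourth powers over disjoint sets -/

section IncrementSums

variable {Ω : Type*} [MeasurableSpace Ω] {P : Measure Ω} [IsProbabilityMeasure P] {K c : ℝ}
  {X : Set (ℝ × ℝ) → Ω → ℝ}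

theorem abs_le_add_sq_div {η : ℝ} (hη : 0 < η) (z : ℝ) : |z| ≤ η + z ^ 2 / η := by
  rw [← sub_le_iff_le_add', le_div_iff₀ hη, ← sq_abs z]
  nlinarith [sq_nonneg (|z| - η), abs_nonneg z, sq_nonneg (2 * |z| - η)]

namespace IsCenteredBasis

/-- A quantitative weak law of large numbers for the fourth powers along a disjoint family. -/
theorem integral_abs_sum_pow_four_sub_le (hX : IsCenteredBasis P K c X) (s : Finset ℕ)
    {B : ℕ → Set (ℝ × ℝ)} (hB : ∀ k, IsBoundedBorel (B k))
    (hd : Pairwise (Function.onFun Disjoint B)) {v : ℝ} (hv : ∀ k, volume.real (B k) = v)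
    (hv1 : v ≤ 1) {M η : ℝ} (hM : 0 < M) (hη : 0 < η) :
    Integrable (fun ω => ∑ k ∈ s, (X (B k) ω ^ 4 - ∫ ω, X (B k) ω ^ 4 ∂P)) P ∧
    ∫ ω, |∑ k ∈ s, (X (B k) ω ^ 4 - ∫ ω, X (B k) ω ^ 4 ∂P)| ∂P
      ≤ s.card * (2 * K * v / M) + η + s.card * (M ^ 4 * K * v) / η := by
  -- Eighth moments are not available, so x⁴ is truncated at M⁴: the excess costs |x|⁵ / M in mean,
  -- and the truncated sum has a variance.
  set f : ℝ → ℝ := fun x => min (x ^ 4) (M ^ 4) with hf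
  have f0 : ∀ x, 0 ≤ f x := fun x => le_min (by positivity) (by positivity)
  have f1 : ∀ x, f x ≤ x ^ 4 := fun x => min_le_left _ _
  have f2 : ∀ x, f x ≤ M ^ 4 := fun x => min_le_right _ _
  have g1 : ∀ x, x ^ 4 - f x ≤ |x| ^ 5 / M := fun x => by
    rw [le_div_iff₀ hM]
    have e : x ^ 4 = |x| ^ 4 := (Even.pow_abs (by decide) x).symm
    have a0 := abs_nonneg x
    rcases le_total |x| M with h | h
    · rw [hf]
      simp only
      rw [min_eq_left (by rw [e]; gcongr), sub_self, zero_mul]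
      positivity
    · have := f0 x
      have h3 : |x| ^ 4 * M ≤ |x| ^ 4 * |x| := by gcongr
      rw [e]
      nlinarith
  have hfm : Measurable f := by fun_prop
  have mB : ∀ k, Measurable (X (B k)) := fun k => hX.measurable _ (hB k)
  have i4 : ∀ k, Integrable (fun ω => X (B k) ω ^ 4) P := fun k =>
    hX.integrable_pow (hB k) (by norm_num)
  have i5 : ∀ k, Integrable (fun ω => |X (B k) ω| ^ 5) P := fun k =>
    hX.integrable_abs_pow (hB k) le_rfl
  have iF : ∀ k, MemLp (fun ω => f (X (B k) ω)) 2 P := fun k =>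
    MemLp.of_bound (hfm.comp (mB k)).aestronglyMeasurable (M ^ 4) (ae_of_all _ fun ω => by
      rw [Real.norm_of_nonneg (f0 _)]; exact f2 _)
  have if1 : ∀ k, Integrable (fun ω => f (X (B k) ω)) P := fun k => (iF k).integrable (by norm_num)
  have ig : ∀ k, Integrable (fun ω => X (B k) ω ^ 4 - f (X (B k) ω)) P := fun k =>
    (i4 k).sub (if1 k)
  have Eg : ∀ k, ∫ ω, (X (B k) ω ^ 4 - f (X (B k) ω)) ∂P ≤ K * v / M := fun k => by
    calc _ ≤ ∫ ω, |X (B k) ω| ^ 5 / M ∂P :=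
          integral_mono (ig k) ((i5 k).div_const M) fun ω => g1 _
      _ = (∫ ω, |X (B k) ω| ^ 5 ∂P) / M := integral_div _ _
      _ ≤ K * v / M := by
          gcongr
          have := hX.integral_abs_pow_five_le _ (hB k) ((hv k).trans_le hv1)
          rwa [hv k] at this
  set Z : Ω → ℝ := fun ω => ∑ k ∈ s, f (X (B k) ω) - ∫ ω, ∑ k ∈ s, f (X (B k) ω) ∂P with hZ
  have iS : MemLp (fun ω => ∑ k ∈ s, f (X (B k) ω)) 2 P := memLp_finsetSum s fun k _ => iF k
  have iZ : MemLp Z 2 P := iS.sub (memLp_const _)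
  -- Variances of independent terms add, and f² ≤ M⁴ x⁴ keeps each of them of order v.
  have varZ : ∫ ω, Z ω ^ 2 ∂P ≤ s.card * (M ^ 4 * K * v) := by
    have h1 : ∫ ω, Z ω ^ 2 ∂P = Var[∑ k ∈ s, fun ω => f (X (B k) ω); P] := by
      rw [variance_eq_integral (by
        have := iS.aemeasurable
        convert this using 1
        funext ω; simp)]
      simp only [hZ, Finset.sum_apply]
    rw [h1, IndepFun.variance_sum (fun k _ => iF k) fun k _ j _ hkj =>
      (hX.indepFun_of_disjoint (hB k) (hB j) (hd hkj)).comp hfm hfm, ← nsmul_eq_mul]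
    refine Finset.sum_le_card_nsmul _ _ _ fun k _ => ?_
    refine (variance_le_expectation_sq (iF k).aestronglyMeasurable).trans ?_
    calc ∫ ω, ((fun ω => f (X (B k) ω)) ^ 2) ω ∂P ≤ ∫ ω, M ^ 4 * X (B k) ω ^ 4 ∂P := by
          refine integral_mono (iF k).integrable_sq ((i4 k).const_mul _) fun ω => ?_
          simp only [Pi.pow_apply, sq]
          exact mul_le_mul (f2 _) (f1 _) (f0 _) (by positivity)
      _ = M ^ 4 * ∫ ω, X (B k) ω ^ 4 ∂P := integral_const_mul _ _
      _ ≤ M ^ 4 * (K * v) := by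
          gcongr
          have := hX.integral_pow_four_le _ (hB k) ((hv k).trans_le hv1)
          rwa [hv k] at this
      _ = _ := by ring
  have hint : Integrable (fun ω => ∑ k ∈ s, (X (B k) ω ^ 4 - ∫ ω, X (B k) ω ^ 4 ∂P)) P :=
    integrable_finsetSum _ fun k _ => (i4 k).sub (integrable_const _)
  refine ⟨hint, ?_⟩
  have dec : ∀ ω, |∑ k ∈ s, (X (B k) ω ^ 4 - ∫ ω, X (B k) ω ^ 4 ∂P)| ≤ (η + Z ω ^ 2 / η)
      + ∑ k ∈ s, ((X (B k) ω ^ 4 - f (X (B k) ω)) + K * v / M) := fun ω => by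
    have e : ∑ k ∈ s, (X (B k) ω ^ 4 - ∫ ω, X (B k) ω ^ 4 ∂P) = Z ω
        + ∑ k ∈ s, ((X (B k) ω ^ 4 - f (X (B k) ω))
          - ∫ ω, (X (B k) ω ^ 4 - f (X (B k) ω)) ∂P) := by
      simp only [hZ]
      rw [integral_finsetSum _ fun k _ => if1 k]
      simp_rw [fun k => integral_sub (i4 k) (if1 k)]
      simp only [Finset.sum_sub_distrib]
      ring
    rw [e]
    refine (abs_add_le _ _).trans (add_le_add (abs_le_add_sq_div hη _) ?_)
    refine (Finset.abs_sum_le_sum_abs _ _).trans (Finset.sum_le_sum fun k _ => ?_)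
    have a1 := f1 (X (B k) ω)
    have a2 : 0 ≤ ∫ ω, (X (B k) ω ^ 4 - f (X (B k) ω)) ∂P :=
      integral_nonneg fun ω => sub_nonneg.2 (f1 _)
    rw [abs_le]
    constructor <;> linarith [Eg k]
  have iz : Integrable (fun ω => η + Z ω ^ 2 / η) P :=
    (integrable_const _).add (iZ.integrable_sq.div_const _)
  have is : Integrable (fun ω => ∑ k ∈ s, ((X (B k) ω ^ 4 - f (X (B k) ω)) + K * v / M)) P :=
    integrable_finsetSum _ fun k _ => (ig k).add (integrable_const _)
  calc _ ≤ ∫ ω, ((η + Z ω ^ 2 / η)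
      + ∑ k ∈ s, ((X (B k) ω ^ 4 - f (X (B k) ω)) + K * v / M)) ∂P :=
        integral_mono hint.abs (iz.add is) dec
    _ = (η + (∫ ω, Z ω ^ 2 ∂P) / η)
        + ∑ k ∈ s, (∫ ω, (X (B k) ω ^ 4 - f (X (B k) ω)) ∂P + K * v / M) := by
        rw [integral_add iz is, integral_add (integrable_const _) (iZ.integrable_sq.div_const _),
          integral_div, integral_finsetSum _ fun k _ => by exact (ig k).add (integrable_const _)]
        simp_rw [fun k => integral_add (ig k) (integrable_const (K * v / M))]
        simp
    _ ≤ (η + s.card * (M ^ 4 * K * v) / η) + ∑ k ∈ s, (K * v / M + K * v / M) := by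
        gcongr with k _
        exact Eg k
    _ = _ := by
        rw [Finset.sum_const, nsmul_eq_mul]
        ring

theorem integral_abs_le_sqrt (hX : IsCenteredBasis P K c X) {A : Set (ℝ × ℝ)}
    (hA : IsBoundedBorel A) (h0 : 0 < volume.real A) :
    ∫ ω, |X A ω| ∂P ≤ 2 * √(volume.real A) := by
  have hs : 0 < √(volume.real A) := Real.sqrt_pos.2 h0
  have i2 := hX.integrable_pow hA (k := 2) (by norm_num)
  calc ∫ ω, |X A ω| ∂P ≤ ∫ ω, (√(volume.real A) + X A ω ^ 2 / √(volume.real A)) ∂P :=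
        integral_mono (hX.integrable hA).abs ((integrable_const _).add (i2.div_const _))
          fun ω => abs_le_add_sq_div hs _
    _ = √(volume.real A) + volume.real A / √(volume.real A) := by
        rw [integral_add (integrable_const _) (i2.div_const _), integral_div, hX.integral_sq A hA]
        simp
    _ = _ := by
        rw [Real.div_sqrt]
        ring

theorem integral_abs_pow_three_le (hX : IsCenteredBasis P K c X) {A : Set (ℝ × ℝ)}
    (hA : IsBoundedBorel A) (h1 : volume.real A ≤ 1) :
    ∫ ω, |X A ω| ^ 3 ∂P ≤ (1 + K) * volume.real A := by
  have i2 := hX.integrable_pow hA (k := 2) (by norm_num)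
  have i5 := hX.integrable_abs_pow hA (k := 5) (by norm_num)
  calc ∫ ω, |X A ω| ^ 3 ∂P ≤ ∫ ω, (X A ω ^ 2 + |X A ω| ^ 5) ∂P := by
        refine integral_mono (hX.integrable_abs_pow hA (by norm_num)) (i2.add i5) fun ω => ?_
        simp only
        rw [← sq_abs]
        have h := abs_nonneg (X A ω)
        generalize |X A ω| = x at *
        rcases le_total x 1 with h' | h'
        · have : x ^ 3 ≤ x ^ 2 := pow_le_pow_of_le_one h h' (by norm_num)
          have : 0 ≤ x ^ 5 := by positivity
          linarith
        · have : x ^ 3 ≤ x ^ 5 := pow_le_pow_right₀ h' (by norm_num)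
          have : 0 ≤ x ^ 2 := by positivity
          linarith
    _ = volume.real A + ∫ ω, |X A ω| ^ 5 ∂P := by rw [integral_add i2 i5, hX.integral_sq A hA]
    _ ≤ _ := by linarith [hX.integral_abs_pow_five_le A hA h1]

/-- The fourth power of a difference over disjoint sets is, up to an error of smaller order in
mean, the sum of the fourth powers. -/
theorem integral_abs_sub_pow_four_sub_le (hX : IsCenteredBasis P K c X) (hK : 0 ≤ K)
    {A B : Set (ℝ × ℝ)} (hA : IsBoundedBorel A) (hB : IsBoundedBorel B) (hAB : Disjoint A B)
    {v : ℝ} (hAv : volume.real A = v) (hBv : volume.real B = v) (h0 : 0 < v) (h1 : v ≤ 1) :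
    Integrable (fun ω => |(X A ω - X B ω) ^ 4 - X A ω ^ 4 - X B ω ^ 4|) P ∧
    ∫ ω, |(X A ω - X B ω) ^ 4 - X A ω ^ 4 - X B ω ^ 4| ∂P ≤ 16 * (1 + K) * v * √v + 6 * v ^ 2 := by
  have ind := fun {f g : ℝ → ℝ} (hf : Measurable f) (hg : Measurable g) =>
    hX.integral_comp_mul_comp hA hB hAB hf hg
  have i31 : Integrable (fun ω => |X A ω| ^ 3 * |X B ω|) P :=
    ((hX.integrable_mul_four hA hA hA hB).abs).congr (ae_of_all _ fun ω => by
      simp only [abs_mul]; ring)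
  have i13 : Integrable (fun ω => |X A ω| * |X B ω| ^ 3) P :=
    ((hX.integrable_mul_four hA hB hB hB).abs).congr (ae_of_all _ fun ω => by
      simp only [abs_mul]; ring)
  have i22 : Integrable (fun ω => X A ω ^ 2 * X B ω ^ 2) P :=
    (hX.integrable_mul_four hA hA hB hB).congr (ae_of_all _ fun ω => by ring)
  -- Independence factorises the cross term into a third moment O(v) and a first moment O(√v), hence
  -- o(v).
  have e31 : ∫ ω, |X A ω| ^ 3 * |X B ω| ∂P ≤ (1 + K) * v * (2 * √v) := by
    rw [ind (f := fun x => |x| ^ 3) (g := fun x => |x|) (by fun_prop) (by fun_prop)]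
    have a1 := hX.integral_abs_pow_three_le hA (hAv.trans_le h1)
    have a2 := hX.integral_abs_le_sqrt hB (hBv ▸ h0)
    rw [hAv] at a1
    rw [hBv] at a2
    have a3 : 0 ≤ ∫ ω, |X B ω| ∂P := integral_nonneg fun _ => abs_nonneg _
    gcongr
  have e13 : ∫ ω, |X A ω| * |X B ω| ^ 3 ∂P ≤ (1 + K) * v * (2 * √v) := by
    rw [ind (f := fun x => |x|) (g := fun x => |x| ^ 3) (by fun_prop) (by fun_prop), mul_comm]
    have a1 := hX.integral_abs_pow_three_le hB (hBv.trans_le h1)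
    have a2 := hX.integral_abs_le_sqrt hA (hAv ▸ h0)
    rw [hAv] at a2
    rw [hBv] at a1
    have a3 : 0 ≤ ∫ ω, |X A ω| ∂P := integral_nonneg fun _ => abs_nonneg _
    gcongr
  have e22 : ∫ ω, X A ω ^ 2 * X B ω ^ 2 ∂P = v ^ 2 := by
    rw [ind (f := fun x => x ^ 2) (g := fun x => x ^ 2) (by fun_prop) (by fun_prop),
      hX.integral_sq A hA, hX.integral_sq B hB, hAv, hBv, sq]
  have ib : Integrable (fun ω => 4 * (|X A ω| ^ 3 * |X B ω|) + 4 * (|X A ω| * |X B ω| ^ 3)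
      + 6 * (X A ω ^ 2 * X B ω ^ 2)) P :=
    ((i31.const_mul 4).add (i13.const_mul 4)).add (i22.const_mul 6)
  have le : ∀ ω, |(X A ω - X B ω) ^ 4 - X A ω ^ 4 - X B ω ^ 4| ≤ 4 * (|X A ω| ^ 3 * |X B ω|)
      + 4 * (|X A ω| * |X B ω| ^ 3) + 6 * (X A ω ^ 2 * X B ω ^ 2) := fun ω => by
    generalize X A ω = x
    generalize X B ω = y
    rw [show (x - y) ^ 4 - x ^ 4 - y ^ 4 = -(4 * (x ^ 3 * y)) + -(4 * (x * y ^ 3))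
      + 6 * (x ^ 2 * y ^ 2) by ring]
    refine (abs_add_le _ _).trans (add_le_add ((abs_add_le _ _).trans (add_le_add ?_ ?_)) ?_)
    · simp [abs_mul]
    · simp [abs_mul]
    · simp [abs_mul]
  have ii : Integrable (fun ω => |(X A ω - X B ω) ^ 4 - X A ω ^ 4 - X B ω ^ 4|) P := by
    have mA := hX.measurable A hA
    have mB := hX.measurable B hB
    exact ib.mono' (by fun_prop) (ae_of_all _ fun ω => by simpa using le ω)
  refine ⟨ii, (integral_mono ii ib le).trans ?_⟩
  rw [integral_add (by exact (i31.const_mul 4).add (i13.const_mul 4)) (i22.const_mul 6),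
    integral_add (i31.const_mul 4) (i13.const_mul 4), integral_const_mul, integral_const_mul,
    integral_const_mul, e22]
  linarith

/-- A quantitative weak law of large numbers for the fourth powers of the differences of two
disjoint families. -/
theorem integral_abs_sum_sub_pow_four_le (hX : IsCenteredBasis P K c X) (hK : 0 ≤ K)
    (s : Finset ℕ) {A B : ℕ → Set (ℝ × ℝ)} (hA : ∀ k, IsBoundedBorel (A k))
    (hB : ∀ k, IsBoundedBorel (B k)) (hdA : Pairwise (Function.onFun Disjoint A))
    (hdB : Pairwise (Function.onFun Disjoint B)) (hd : ∀ k, Disjoint (A k) (B k)) {v : ℝ}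
    (hAv : ∀ k, volume.real (A k) = v) (hBv : ∀ k, volume.real (B k) = v) (h0 : 0 < v)
    (h1 : v ≤ 1) {ε : ℝ} (hε : ∀ E, IsBoundedBorel E → volume.real E = v →
      |(∫ ω, X E ω ^ 4 ∂P) - c * v| ≤ ε * v) {M η : ℝ} (hM : 0 < M) (hη : 0 < η) :
    Integrable (fun ω => |∑ k ∈ s, (X (A k) ω - X (B k) ω) ^ 4 - s.card * (2 * c * v)|) P ∧
    ∫ ω, |∑ k ∈ s, (X (A k) ω - X (B k) ω) ^ 4 - s.card * (2 * c * v)| ∂P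
      ≤ s.card * (16 * (1 + K) * v * √v + 6 * v ^ 2 + 2 * ε * v)
        + 2 * (s.card * (2 * K * v / M) + η + s.card * (M ^ 4 * K * v) / η) := by
  obtain ⟨iA, bA⟩ := hX.integral_abs_sum_pow_four_sub_le s hA hdA hAv h1 hM hη
  obtain ⟨iB, bB⟩ := hX.integral_abs_sum_pow_four_sub_le s hB hdB hBv h1 hM hη
  have hR := fun k => hX.integral_abs_sub_pow_four_sub_le hK (hA k) (hB k) (hd k) (hAv k) (hBv k)
    h0 h1
  have iR : Integrable (fun ω => ∑ k ∈ s,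
      |(X (A k) ω - X (B k) ω) ^ 4 - X (A k) ω ^ 4 - X (B k) ω ^ 4|) P :=
    integrable_finsetSum _ fun k _ => (hR k).1
  have le : ∀ ω, |∑ k ∈ s, (X (A k) ω - X (B k) ω) ^ 4 - s.card * (2 * c * v)|
      ≤ ∑ k ∈ s, |(X (A k) ω - X (B k) ω) ^ 4 - X (A k) ω ^ 4 - X (B k) ω ^ 4|
        + |∑ k ∈ s, (X (A k) ω ^ 4 - ∫ ω, X (A k) ω ^ 4 ∂P)|
        + |∑ k ∈ s, (X (B k) ω ^ 4 - ∫ ω, X (B k) ω ^ 4 ∂P)| + s.card * (2 * ε * v) := fun ω => by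
    have e : ∑ k ∈ s, (X (A k) ω - X (B k) ω) ^ 4 - s.card * (2 * c * v)
        = ∑ k ∈ s, ((X (A k) ω - X (B k) ω) ^ 4 - X (A k) ω ^ 4 - X (B k) ω ^ 4)
        + ∑ k ∈ s, (X (A k) ω ^ 4 - ∫ ω, X (A k) ω ^ 4 ∂P)
        + ∑ k ∈ s, (X (B k) ω ^ 4 - ∫ ω, X (B k) ω ^ 4 ∂P)
        + ∑ k ∈ s, (((∫ ω, X (A k) ω ^ 4 ∂P) - c * v) + ((∫ ω, X (B k) ω ^ 4 ∂P) - c * v)) := by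
      simp only [Finset.sum_sub_distrib, Finset.sum_add_distrib, Finset.sum_const, nsmul_eq_mul]
      ring
    rw [e]
    refine (abs_add_le _ _).trans (add_le_add ((abs_add_le _ _).trans (add_le_add
      ((abs_add_le _ _).trans (add_le_add (Finset.abs_sum_le_sum_abs _ _) le_rfl)) le_rfl)) ?_)
    refine (Finset.abs_sum_le_sum_abs _ _).trans ?_
    rw [← nsmul_eq_mul]
    refine Finset.sum_le_card_nsmul _ _ _ fun k _ => (abs_add_le _ _).trans ?_
    linarith [hε _ (hA k) (hAv k), hε _ (hB k) (hBv k)]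
  have ib := ((iR.add iA.abs).add iB.abs).add (integrable_const (s.card * (2 * ε * v)))
  have ii : Integrable
      (fun ω => |∑ k ∈ s, (X (A k) ω - X (B k) ω) ^ 4 - s.card * (2 * c * v)|) P := by
    refine ib.mono' (Measurable.aestronglyMeasurable ?_) (ae_of_all _ fun ω => by simpa using le ω)
    have mA := fun k => hX.measurable _ (hA k)
    have mB := fun k => hX.measurable _ (hB k)
    fun_prop
  refine ⟨ii, (integral_mono ii ib le).trans ?_⟩
  simp only [Pi.add_apply]
  rw [integral_add (by exact (iR.add iA.abs).add iB.abs) (integrable_const _),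
    integral_add (by exact iR.add iA.abs) iB.abs, integral_add iR iA.abs, integral_const,
    integral_finsetSum _ fun k _ => (hR k).1]
  have := Finset.sum_le_card_nsmul s _ _ fun k _ => (hR k).2
  rw [nsmul_eq_mul] at this
  simp only [probReal_univ, one_smul]
  linarith

/-- Second moment bound for the realised variance of the differences of two families. -/
theorem integral_sum_sub_sq_sub_sq_le (hX : IsCenteredBasis P K c X) (hK : 0 ≤ K)
    (s : Finset ℕ) {A B : ℕ → Set (ℝ × ℝ)} (hA : ∀ k, IsBoundedBorel (A k))
    (hB : ∀ k, IsBoundedBorel (B k)) (hdA : Pairwise (Function.onFun Disjoint A))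
    (hdB : Pairwise (Function.onFun Disjoint B)) (hd : ∀ k j, k ≤ j → Disjoint (A j) (B k)) {v : ℝ}
    (hAv : ∀ k, volume.real (A k) = v) (hBv : ∀ k, volume.real (B k) = v) (h1 : v ≤ 1) :
    Integrable (fun ω => (∑ k ∈ s, ((X (A k) ω - X (B k) ω) ^ 2 - 2 * v)) ^ 2) P ∧
    ∫ ω, (∑ k ∈ s, ((X (A k) ω - X (B k) ω) ^ 2 - 2 * v)) ^ 2 ∂P
      ≤ 18 * (s.card * ((2 * v + 2 * K) * v)) := by
  have zero_of : ∀ {E F : Set (ℝ × ℝ)}, Disjoint E F → volume.real (E ∩ F) = 0 := fun h => by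
    rw [Set.disjoint_iff_inter_eq_empty.1 h, measureReal_empty]
  obtain ⟨iA, bA⟩ := hX.integral_sum_mul_sub_sq_le hK s hA hA hdA (fun k => (hAv k).le)
    (fun k => (hAv k).le) h1
  obtain ⟨iB, bB⟩ := hX.integral_sum_mul_sub_sq_le hK s hB hB hdB (fun k => (hBv k).le)
    (fun k => (hBv k).le) h1
  obtain ⟨iC, bC⟩ := hX.integral_sum_mul_sub_sq_le hK s hA hB hdB (fun k => (hAv k).le)
    (fun k => (hBv k).le) h1
  rw [Finset.sum_eq_zero fun k _ => Finset.sum_eq_zero fun j hj => by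
    rw [zero_of (hdA (Finset.ne_of_mem_erase hj).symm), zero_mul], add_zero] at bA
  rw [Finset.sum_eq_zero fun k _ => Finset.sum_eq_zero fun j hj => by
    rw [zero_of (hdB (Finset.ne_of_mem_erase hj).symm), zero_mul], add_zero] at bB
  -- Of the two crossed overlaps, the one that pairs the later A with the earlier B is empty.
  rw [Finset.sum_eq_zero fun k _ => Finset.sum_eq_zero fun j hj => by
    rcases le_total k j with h | h
    · rw [zero_of (hd k j h), mul_zero]
    · rw [zero_of (hd j k h), zero_mul], add_zero] at bC
  -- The square expands into two pure sums and twice a mixed sum, and (x + y - 2z)² ≤ 3x² + 3y² +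
  -- 12z²; the weights add up to 18.
  have le : ∀ ω, (∑ k ∈ s, ((X (A k) ω - X (B k) ω) ^ 2 - 2 * v)) ^ 2 ≤
      3 * (∑ k ∈ s, (X (A k) ω * X (A k) ω - volume.real (A k ∩ A k))) ^ 2
      + 3 * (∑ k ∈ s, (X (B k) ω * X (B k) ω - volume.real (B k ∩ B k))) ^ 2
      + 12 * (∑ k ∈ s, (X (A k) ω * X (B k) ω - volume.real (A k ∩ B k))) ^ 2 := fun ω => by
    have e : ∑ k ∈ s, ((X (A k) ω - X (B k) ω) ^ 2 - 2 * v)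
        = ∑ k ∈ s, (X (A k) ω * X (A k) ω - volume.real (A k ∩ A k))
        + ∑ k ∈ s, (X (B k) ω * X (B k) ω - volume.real (B k ∩ B k))
        - 2 * ∑ k ∈ s, (X (A k) ω * X (B k) ω - volume.real (A k ∩ B k)) := by
      rw [← Finset.sum_add_distrib, Finset.mul_sum, ← Finset.sum_sub_distrib]
      refine Finset.sum_congr rfl fun k _ => ?_
      rw [Set.inter_self, Set.inter_self, hAv, hBv, zero_of (hd k k le_rfl)]
      ring
    rw [e]
    generalize ∑ k ∈ s, (X (A k) ω * X (A k) ω - volume.real (A k ∩ A k)) = x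
    generalize ∑ k ∈ s, (X (B k) ω * X (B k) ω - volume.real (B k ∩ B k)) = y
    generalize ∑ k ∈ s, (X (A k) ω * X (B k) ω - volume.real (A k ∩ B k)) = z
    nlinarith [sq_nonneg (x - y), sq_nonneg (x + 2 * z), sq_nonneg (y + 2 * z)]
  have ib := ((iA.const_mul 3).add (iB.const_mul 3)).add (iC.const_mul 12)
  have ii : Integrable (fun ω => (∑ k ∈ s, ((X (A k) ω - X (B k) ω) ^ 2 - 2 * v)) ^ 2) P := by
    refine ib.mono' (Measurable.aestronglyMeasurable ?_) (ae_of_all _ fun ω => by simpa using le ω)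
    have mA := fun k => hX.measurable _ (hA k)
    have mB := fun k => hX.measurable _ (hB k)
    fun_prop
  refine ⟨ii, (integral_mono ii ib le).trans ?_⟩
  simp only [Pi.add_apply]
  rw [integral_add (by exact (iA.const_mul 3).add (iB.const_mul 3)) (iC.const_mul 12),
    integral_add (iA.const_mul 3) (iB.const_mul 3), integral_const_mul, integral_const_mul,
    integral_const_mul]
  linarith

end IsCenteredBasis

end IncrementSums

/-! ### Geometry of shifted trawl sets: gains, losses and overlaps -/

section TrawlGeometry

/-- A sequence of sets of finite area such that every point lies in a set of consecutive members,
with `volume (A i ∩ A j) = g (j - i)`. -/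
structure IsStationarySequence (g : ℕ → ℝ) (A : ℕ → Set (ℝ × ℝ)) : Prop where
  isBoundedBorel : ∀ k, IsBoundedBorel (A k)
  inter_subset : ∀ i j k, i ≤ j → j ≤ k → A i ∩ A k ⊆ A j
  volume_inter : ∀ i l, volume.real (A i ∩ A (i + l)) = g l

/-- The points that enter between the times `k` and `k + 1`. -/
def gain (A : ℕ → Set (ℝ × ℝ)) (k : ℕ) : Set (ℝ × ℝ) := A (k + 1) \ A k

/-- The points that leave between the times `k` and `k + 1`. -/
def loss (A : ℕ → Set (ℝ × ℝ)) (k : ℕ) : Set (ℝ × ℝ) := A k \ A (k + 1)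

namespace IsStationarySequence

variable {g : ℕ → ℝ} {A : ℕ → Set (ℝ × ℝ)}

theorem volume_eq (hA : IsStationarySequence g A) (k : ℕ) : volume.real (A k) = g 0 := by
  simpa using hA.volume_inter k 0

theorem isBoundedBorel_gain (hA : IsStationarySequence g A) (k : ℕ) : IsBoundedBorel (gain A k) :=
  (hA.isBoundedBorel _).diff (hA.isBoundedBorel _)

theorem isBoundedBorel_loss (hA : IsStationarySequence g A) (k : ℕ) : IsBoundedBorel (loss A k) :=
  (hA.isBoundedBorel _).diff (hA.isBoundedBorel _)

/-- A point is present during one block of consecutive times, so a point that enters after time j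
was not there at any time k ≤ j. -/
theorem disjoint_gain (hA : IsStationarySequence g A) {k j : ℕ} (h : k ≤ j) :
    Disjoint (gain A j) (A k) := by
  rw [Set.disjoint_left]
  exact fun p hp hq => hp.2 (hA.inter_subset k j (j + 1) h j.le_succ ⟨hq, hp.1⟩)

theorem disjoint_gain_loss (hA : IsStationarySequence g A) {k j : ℕ} (h : k ≤ j) :
    Disjoint (gain A j) (loss A k) := (hA.disjoint_gain h).mono_right Set.sdiff_subset

theorem pairwise_disjoint_gain (hA : IsStationarySequence g A) :
    Pairwise (Function.onFun Disjoint (gain A)) := by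
  have key : ∀ i j, i < j → Disjoint (gain A i) (gain A j) := fun i j h =>
    ((hA.disjoint_gain h).symm).mono_left Set.sdiff_subset
  intro i j hij
  rcases lt_or_gt_of_ne hij with h | h
  exacts [key i j h, (key j i h).symm]

theorem pairwise_disjoint_loss (hA : IsStationarySequence g A) :
    Pairwise (Function.onFun Disjoint (loss A)) := by
  have key : ∀ i j, i < j → Disjoint (loss A i) (loss A j) := fun i j h => by
    rw [Set.disjoint_left]
    exact fun p hp hq => hp.2 (hA.inter_subset i (i + 1) j i.le_succ h ⟨hp.1, hq.1⟩)
  intro i j hij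
  rcases lt_or_gt_of_ne hij with h | h
  exacts [key i j h, (key j i h).symm]

theorem volume_gain (hA : IsStationarySequence g A) (k : ℕ) :
    volume.real (gain A k) = g 0 - g 1 := by
  have h := measureReal_sdiff_add_inter (μ := volume) (s := A (k + 1)) (t := A k)
    (hA.isBoundedBorel k).1 (h := (hA.isBoundedBorel (k + 1)).2.ne)
  rw [Set.inter_comm, hA.volume_inter, hA.volume_eq] at h
  unfold gain
  linarith

theorem volume_loss (hA : IsStationarySequence g A) (k : ℕ) :
    volume.real (loss A k) = g 0 - g 1 := by
  have h := measureReal_sdiff_add_inter (μ := volume) (s := A k) (t := A (k + 1))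
    (hA.isBoundedBorel (k + 1)).1 (h := (hA.isBoundedBorel k).2.ne)
  rw [hA.volume_inter, hA.volume_eq] at h
  unfold loss
  linarith

/-- This overlap is the mean of a lagged product, the quantity behind the estimator of the trawl
function. -/
theorem volume_inter_loss (hA : IsStationarySequence g A) (k l : ℕ) :
    volume.real (A k ∩ loss A (k + l)) = g l - g (l + 1) := by
  have h := measureReal_sdiff_add_inter (μ := volume) (s := A k ∩ A (k + l)) (t := A (k + l + 1))
    (hA.isBoundedBorel (k + l + 1)).1
    (h := ((hA.isBoundedBorel k).inter (hA.isBoundedBorel _)).2.ne)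
  have e : A k ∩ A (k + l) ∩ A (k + l + 1) = A k ∩ A (k + (l + 1)) := by
    ext p
    exact ⟨fun h => ⟨h.1.1, h.2⟩,
      fun h => ⟨⟨h.1, hA.inter_subset k (k + l) (k + l + 1) (by omega) (by omega) h⟩, h.2⟩⟩
  rw [e, hA.volume_inter, hA.volume_inter] at h
  unfold loss
  rw [← Set.inter_sdiff_assoc]
  linarith

end IsStationarySequence

variable {Ω : Type*} [MeasurableSpace Ω] {P : Measure Ω} {K c : ℝ}
  {X : Set (ℝ × ℝ) → Ω → ℝ} {g : ℕ → ℝ} {A : ℕ → Set (ℝ × ℝ)}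

namespace IsCenteredBasis

theorem ae_sub_eq (hX : IsCenteredBasis P K c X) (hA : IsStationarySequence g A) :
    ∀ᵐ ω ∂P, ∀ k, X (A (k + 1)) ω - X (A k) ω = X (gain A k) ω - X (loss A k) ω := by
  rw [ae_all_iff]
  intro k
  filter_upwards [hX.ae_inter_add_diff (hA.isBoundedBorel (k + 1)) (hA.isBoundedBorel k),
    hX.ae_inter_add_diff (hA.isBoundedBorel k) (hA.isBoundedBorel (k + 1))] with ω h1 h2
  rw [h1, h2, gain, loss, Set.inter_comm]
  ring

variable [IsProbabilityMeasure P]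

/-- In the crossed overlaps one factor is at most b, and the other sums over j to at most |A k|,
because the B j are disjoint. The double sum is therefore linear in the number of terms, however
much the A k overlap. -/
theorem integral_sum_mul_sub_sq_le' (hX : IsCenteredBasis P K c X) (hK : 0 ≤ K) (s : Finset ℕ)
    {A B : ℕ → Set (ℝ × ℝ)} (hA : ∀ k, IsBoundedBorel (A k)) (hB : ∀ k, IsBoundedBorel (B k))
    (hd : Pairwise (Function.onFun Disjoint B)) {a b : ℝ} (ha : ∀ k, volume.real (A k) ≤ a)
    (hb : ∀ k, volume.real (B k) ≤ b) (hb1 : b ≤ 1) :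
    Integrable (fun ω => (∑ k ∈ s, (X (A k) ω * X (B k) ω - volume.real (A k ∩ B k))) ^ 2) P ∧
    ∫ ω, (∑ k ∈ s, (X (A k) ω * X (B k) ω - volume.real (A k ∩ B k))) ^ 2 ∂P
      ≤ s.card * ((3 * a + 2 * K) * b) := by
  obtain ⟨h1, h2⟩ := hX.integral_sum_mul_sub_sq_le hK s hA hB hd ha hb hb1
  refine ⟨h1, h2.trans ?_⟩
  have hb0 : 0 ≤ b := measureReal_nonneg.trans (hb 0)
  have h3 : ∀ k ∈ s, ∑ j ∈ s.erase k, volume.real (A k ∩ B j) * volume.real (A j ∩ B k)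
      ≤ a * b := fun k _ => by
    calc ∑ j ∈ s.erase k, volume.real (A k ∩ B j) * volume.real (A j ∩ B k)
        ≤ ∑ j ∈ s, volume.real (A k ∩ B j) * b := by
          refine (Finset.sum_le_sum_of_subset_of_nonneg (Finset.erase_subset k s)
            fun _ _ _ => by positivity).trans (Finset.sum_le_sum fun j _ => ?_)
          gcongr
          exact (measureReal_mono Set.inter_subset_right (hB k).2.ne).trans (hb k)
      _ = volume.real (⋃ j ∈ s, A k ∩ B j) * b := by
          rw [← Finset.sum_mul, measureReal_biUnion_finset
            (fun i _ j _ hij => (hd hij).mono Set.inter_subset_right Set.inter_subset_right)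
            (fun j _ => ((hA k).inter (hB j)).1) (fun j _ => ((hA k).inter (hB j)).2.ne)]
      _ ≤ a * b := by
          gcongr
          exact (measureReal_mono (Set.iUnion₂_subset fun j _ => Set.inter_subset_left)
            (hA k).2.ne).trans (ha k)
  have h4 := Finset.sum_le_card_nsmul s _ _ h3
  rw [nsmul_eq_mul] at h4
  linarith

/-- Second moment bound, uniform in the lag, for sums of lagged products. -/
theorem integral_lagged_sum_sq_le (hX : IsCenteredBasis P K c X) (hK : 0 ≤ K)
    (hA : IsStationarySequence g A) (h1 : g 0 - g 1 ≤ 1) (s : Finset ℕ) (l : ℕ) :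
    Integrable (fun ω => (∑ k ∈ s, (X (A k) ω * (X (A (k + l)) ω - X (A (k + l + 1)) ω)
      - (g l - g (l + 1)))) ^ 2) P ∧
    ∫ ω, (∑ k ∈ s, (X (A k) ω * (X (A (k + l)) ω - X (A (k + l + 1)) ω)
      - (g l - g (l + 1)))) ^ 2 ∂P ≤ 4 * (s.card * ((3 * g 0 + 2 * K) * (g 0 - g 1))) := by
  have hinj : Function.Injective fun k : ℕ => k + l := add_left_injective l
  obtain ⟨iG, bG⟩ := hX.integral_sum_mul_sub_sq_le' hK s hA.isBoundedBorel
    (B := fun k => gain A (k + l)) (fun k => hA.isBoundedBorel_gain _)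
    (fun i j h => hA.pairwise_disjoint_gain (hinj.ne h))
    (fun k => (hA.volume_eq k).le) (fun k => (hA.volume_gain _).le) h1
  obtain ⟨iL, bL⟩ := hX.integral_sum_mul_sub_sq_le' hK s hA.isBoundedBorel
    (B := fun k => loss A (k + l)) (fun k => hA.isBoundedBorel_loss _)
    (fun i j h => hA.pairwise_disjoint_loss (hinj.ne h))
    (fun k => (hA.volume_eq k).le) (fun k => (hA.volume_loss _).le) h1
  have le : ∀ᵐ ω ∂P, (∑ k ∈ s, (X (A k) ω * (X (A (k + l)) ω - X (A (k + l + 1)) ω)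
      - (g l - g (l + 1)))) ^ 2 ≤
      2 * (∑ k ∈ s, (X (A k) ω * X (loss A (k + l)) ω - volume.real (A k ∩ loss A (k + l)))) ^ 2
      + 2 * (∑ k ∈ s, (X (A k) ω * X (gain A (k + l)) ω
        - volume.real (A k ∩ gain A (k + l)))) ^ 2 := by
    filter_upwards [hX.ae_sub_eq hA] with ω hω
    have e : ∑ k ∈ s, (X (A k) ω * (X (A (k + l)) ω - X (A (k + l + 1)) ω) - (g l - g (l + 1)))
        = ∑ k ∈ s, (X (A k) ω * X (loss A (k + l)) ω - volume.real (A k ∩ loss A (k + l)))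
        - ∑ k ∈ s, (X (A k) ω * X (gain A (k + l)) ω
          - volume.real (A k ∩ gain A (k + l))) := by
      rw [← Finset.sum_sub_distrib]
      refine Finset.sum_congr rfl fun k _ => ?_
      rw [hA.volume_inter_loss, Set.inter_comm (A k) (gain A (k + l)),
        Set.disjoint_iff_inter_eq_empty.1 (hA.disjoint_gain (Nat.le_add_right k l)),
        measureReal_empty, ← neg_sub (X (A (k + l + 1)) ω), hω]
      ring
    rw [e]
    generalize ∑ k ∈ s, (X (A k) ω * X (loss A (k + l)) ω
      - volume.real (A k ∩ loss A (k + l))) = x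
    generalize ∑ k ∈ s, (X (A k) ω * X (gain A (k + l)) ω
      - volume.real (A k ∩ gain A (k + l))) = y
    nlinarith [sq_nonneg (x + y)]
  have ib := (iL.const_mul 2).add (iG.const_mul 2)
  have ii : Integrable (fun ω => (∑ k ∈ s, (X (A k) ω * (X (A (k + l)) ω - X (A (k + l + 1)) ω)
      - (g l - g (l + 1)))) ^ 2) P := by
    refine ib.mono' (Measurable.aestronglyMeasurable ?_) (le.mono fun ω h => by simpa using h)
    have mA := fun k => hX.measurable _ (hA.isBoundedBorel k)
    fun_prop
  refine ⟨ii, (integral_mono_ae ii ib le).trans ?_⟩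
  simp only [Pi.add_apply]
  rw [integral_add (iL.const_mul 2) (iG.const_mul 2), integral_const_mul, integral_const_mul]
  linarith

end IsCenteredBasis

namespace IsTrawlFunction

variable {a : ℝ → ℝ}

/-- Nothing is known about a on negative arguments; composing with max gives a globally continuous,
hence measurable, substitute. -/
theorem continuous_comp_max (ha : IsTrawlFunction a) : Continuous fun s => a (max s 0) :=
  ha.continuousOn.comp_continuous (by fun_prop) fun s => le_max_right s 0

theorem integrableOn_Ioi (ha : IsTrawlFunction a) {h : ℝ} (hh : 0 ≤ h) :
    IntegrableOn a (Set.Ioi h) :=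
  ha.integrableOn.mono_set (Set.Ioi_subset_Ici hh)

end IsTrawlFunction

theorem mem_trawlSetAt {a : ℝ → ℝ} {t : ℝ} {p : ℝ × ℝ} :
    p ∈ trawlSetAt a t ↔ p.1 ≤ t ∧ 0 ≤ p.2 ∧ p.2 ≤ a (t - p.1) := by
  simp [trawlSetAt, trawlSet]

theorem trawlSetAt_inter {a : ℝ → ℝ} (ha : IsTrawlFunction a) {s t : ℝ} (hst : s ≤ t) :
    trawlSetAt a s ∩ trawlSetAt a t = {p | p.1 ≤ s ∧ 0 ≤ p.2 ∧ p.2 ≤ a (max (t - p.1) 0)} := by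
  ext p
  simp only [Set.mem_inter_iff, mem_trawlSetAt, Set.mem_ofPred_eq]
  constructor
  · rintro ⟨⟨h1, h2, h3⟩, h4, h5, h6⟩
    exact ⟨h1, h2, by rwa [max_eq_left (by linarith)]⟩
  · rintro ⟨h1, h2, h3⟩
    rw [max_eq_left (by linarith)] at h3
    refine ⟨⟨h1, h2, h3.trans ?_⟩, h1.trans hst, h2, h3⟩
    exact ha.antitoneOn (Set.mem_Ici.2 (by linarith)) (Set.mem_Ici.2 (by linarith)) (by linarith)

theorem trawlSetAt_inter_subset {a : ℝ → ℝ} (ha : IsTrawlFunction a) {s u t : ℝ} (hsu : s ≤ u)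
    (hut : u ≤ t) : trawlSetAt a s ∩ trawlSetAt a t ⊆ trawlSetAt a u := by
  rintro p ⟨h1, h2⟩
  rw [mem_trawlSetAt] at *
  refine ⟨h1.1.trans hsu, h1.2.1, h2.2.2.trans ?_⟩
  exact ha.antitoneOn (Set.mem_Ici.2 (by linarith [h1.1])) (Set.mem_Ici.2 (by linarith [h1.1]))
    (by linarith)

/-- By monotonicity the section at r ≤ s is [0, a(t - r)]; Fubini and the substitution x = t - r
give the tail integral. -/
theorem volume_trawlSetAt_inter {a : ℝ → ℝ} (ha : IsTrawlFunction a) {s t : ℝ} (hst : s ≤ t) :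
    IsBoundedBorel (trawlSetAt a s ∩ trawlSetAt a t) ∧
    volume.real (trawlSetAt a s ∩ trawlSetAt a t) = ∫ x in Set.Ioi (t - s), a x := by
  have hc := ha.continuous_comp_max
  have hm : MeasurableSet (trawlSetAt a s ∩ trawlSetAt a t) := by
    rw [trawlSetAt_inter ha hst]
    have m1 : MeasurableSet {p : ℝ × ℝ | p.1 ≤ s} := measurableSet_le (by fun_prop) (by fun_prop)
    have m2 : MeasurableSet {p : ℝ × ℝ | 0 ≤ p.2} := measurableSet_le (by fun_prop) (by fun_prop)
    have m3 : MeasurableSet {p : ℝ × ℝ | p.2 ≤ a (max (t - p.1) 0)} :=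
      measurableSet_le (by fun_prop)
        (hc.measurable.comp (measurable_const.sub measurable_fst))
    exact m1.inter (m2.inter m3)
  have hi : IntegrableOn a (Set.Ioi (t - s)) := ha.integrableOn_Ioi (by linarith)
  have hn : ∀ᵐ x ∂volume.restrict (Set.Ioi (t - s)), 0 ≤ a x :=
    (ae_restrict_iff' measurableSet_Ioi).2 (ae_of_all _ fun x hx => ha.nonneg x (by
      have : t - s < x := hx
      linarith))
  have hv : volume (trawlSetAt a s ∩ trawlSetAt a t)
      = ENNReal.ofReal (∫ x in Set.Ioi (t - s), a x) := by
    rw [Measure.volume_eq_prod, Measure.prod_apply hm,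
      ofReal_integral_eq_lintegral_ofReal hi hn, Measure.restrict_congr_set Ioi_ae_eq_Ici,
      ← lintegral_indicator measurableSet_Ici,
      ← lintegral_sub_left_eq_self (fun x => (Set.Ici (t - s)).indicator
        (fun x => ENNReal.ofReal (a x)) x) t]
    refine lintegral_congr fun r => ?_
    rw [trawlSetAt_inter ha hst]
    by_cases hr : r ≤ s
    · rw [Set.indicator_of_mem (Set.mem_Ici.2 (by linarith))]
      have : Prod.mk r ⁻¹' {p : ℝ × ℝ | p.1 ≤ s ∧ 0 ≤ p.2 ∧ p.2 ≤ a (max (t - p.1) 0)}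
          = Set.Icc 0 (a (t - r)) := by
        ext y
        simp [hr, max_eq_left (show 0 ≤ t - r by linarith)]
      rw [this, Real.volume_Icc, sub_zero]
    · rw [Set.indicator_of_notMem (fun h => hr (by have := Set.mem_Ici.1 h; linarith))]
      have : Prod.mk r ⁻¹' {p : ℝ × ℝ | p.1 ≤ s ∧ 0 ≤ p.2 ∧ p.2 ≤ a (max (t - p.1) 0)} = ∅ := by
        ext y
        simp [hr]
      rw [this, measure_empty]
  refine ⟨⟨hm, by rw [hv]; exact ENNReal.ofReal_lt_top⟩, ?_⟩
  rw [Measure.real, hv, ENNReal.toReal_ofReal (integral_nonneg_of_ae hn)]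

/-- The covariances of the trawl process on a grid of mesh `δ`. -/
noncomputable def gridCov (a : ℝ → ℝ) (δ : ℝ) (l : ℕ) : ℝ := ∫ x in Set.Ioi (l * δ), a x

theorem isStationarySequence_trawlSetAt {a : ℝ → ℝ} (ha : IsTrawlFunction a) {δ : ℝ}
    (hδ : 0 ≤ δ) : IsStationarySequence (gridCov a δ) fun k => trawlSetAt a (k * δ) where
  isBoundedBorel k := by
    simpa using (volume_trawlSetAt_inter ha (le_refl (k * δ))).1
  inter_subset i j k hij hjk :=
    trawlSetAt_inter_subset ha (by gcongr) (by gcongr)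
  volume_inter i l := by
    rw [(volume_trawlSetAt_inter ha (by push_cast; nlinarith)).2, gridCov]
    congr 3
    push_cast
    ring

/-- The difference is the integral of a over one mesh cell, bounded by the endpoint values by
monotonicity. -/
theorem gridCov_sub {a : ℝ → ℝ} (ha : IsTrawlFunction a) {δ : ℝ} (hδ : 0 ≤ δ) (l : ℕ) :
    δ * a ((l + 1 : ℕ) * δ) ≤ gridCov a δ l - gridCov a δ (l + 1) ∧
      gridCov a δ l - gridCov a δ (l + 1) ≤ δ * a (l * δ) := by
  have hle : (l : ℝ) * δ ≤ (l + 1 : ℕ) * δ := by gcongr; simp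
  have h0 : (0 : ℝ) ≤ l * δ := by positivity
  have e : gridCov a δ l - gridCov a δ (l + 1)
      = ∫ x in Set.Ioc ((l : ℝ) * δ) ((l + 1 : ℕ) * δ), a x := by
    unfold gridCov
    rw [← Set.Ioc_union_Ioi_eq_Ioi hle, setIntegral_union Set.Ioc_disjoint_Ioi_same
      measurableSet_Ioi ((ha.integrableOn_Ioi h0).mono_set Set.Ioc_subset_Ioi_self)
      (ha.integrableOn_Ioi (h0.trans hle))]
    ring
  have hi : IntegrableOn a (Set.Ioc ((l : ℝ) * δ) ((l + 1 : ℕ) * δ)) :=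
    (ha.integrableOn_Ioi h0).mono_set Set.Ioc_subset_Ioi_self
  have hv : volume.real (Set.Ioc ((l : ℝ) * δ) ((l + 1 : ℕ) * δ)) = δ := by
    rw [Real.volume_real_Ioc_of_le hle]; push_cast; ring
  rw [e]
  constructor
  · have := setIntegral_mono_on (integrableOn_const (C := a ((l + 1 : ℕ) * δ))
      (by simp)) hi measurableSet_Ioc fun x hx =>
        ha.antitoneOn (Set.mem_Ici.2 (h0.trans hx.1.le)) (Set.mem_Ici.2 (h0.trans hle)) hx.2
    rwa [setIntegral_const, hv, smul_eq_mul] at this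
  · have := setIntegral_mono_on hi (integrableOn_const (C := a (l * δ)) (by simp))
      measurableSet_Ioc fun x hx =>
        ha.antitoneOn (Set.mem_Ici.2 h0) (Set.mem_Ici.2 (h0.trans hx.1.le)) hx.1.le
    rwa [setIntegral_const, hv, smul_eq_mul] at this

end TrawlGeometry

/-! ### Algebra of the statistics and mean square error of the trawl estimator -/

section Statistics

theorem sampleMean_sub_const (x : ℕ → ℝ) (c : ℝ) {n : ℕ} (hn : 0 < n) :
    sampleMean (fun k => x k - c) n = sampleMean x n - c := by
  have : (n : ℝ) ≠ 0 := by positivity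
  simp only [sampleMean, Finset.sum_sub_distrib, Finset.sum_const, Finset.card_range, nsmul_eq_mul]
  field_simp

theorem sampleAutocov_sub_const (x : ℕ → ℝ) (c : ℝ) {n : ℕ} (hn : 0 < n) (l : ℕ) :
    sampleAutocov (fun k => x k - c) n l = sampleAutocov x n l := by
  simp only [sampleAutocov, sampleMean_sub_const x c hn, sub_sub_sub_cancel_right]

theorem trawlEst_sub_const (x : ℕ → ℝ) (c : ℝ) {n : ℕ} (hn : 0 < n) (δ t : ℝ) :
    trawlEst (fun k => x k - c) n δ t = trawlEst x n δ t := by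
  simp only [trawlEst, sampleAutocov_sub_const x c hn, sub_sub_sub_cancel_right]

/-- Only increments and deviations from the sample mean enter, so the basis may be centred at its
mean. -/
theorem avarEst_sub_const (x : ℕ → ℝ) (c : ℝ) {n : ℕ} (hn : 0 < n) (δ : ℝ) (N : ℕ) (t : ℝ) :
    avarEst (fun k => x k - c) n δ N t = avarEst x n δ N t := by
  simp only [avarEst, v1, v2, v3, v4, c4Est, quarticity, trawlEst_sub_const x c hn,
    sub_sub_sub_cancel_right]

theorem gridIndex_mul {δ : ℝ} (hδ : 0 < δ) (l : ℕ) : gridIndex δ (l * δ) = l := by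
  rw [gridIndex, mul_div_cancel_right₀ _ hδ.ne', Nat.floor_natCast]

theorem trawlEst_eq_of_pos (x : ℕ → ℝ) (n : ℕ) {δ t : ℝ} (ht : 0 < t) :
    trawlEst x n δ t
      = -(1 / δ) * (sampleAutocov x n (gridIndex δ t + 1) - sampleAutocov x n (gridIndex δ t)) := by
  rw [trawlEst, if_neg ht.ne']

/-- For 0 < t < δ this can fail: t would use the lag-zero difference quotient, while its grid point
0 uses the realised variance. -/
theorem trawlEst_gridIndex (x : ℕ → ℝ) (n : ℕ) {δ t : ℝ} (hδ : 0 < δ) (ht : δ ≤ t) :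
    trawlEst x n δ t = trawlEst x n δ (gridIndex δ t * δ) := by
  have h1 : 0 < gridIndex δ t := Nat.floor_pos.2 (by rwa [le_div_iff₀ hδ, one_mul])
  rw [trawlEst_eq_of_pos x n (hδ.trans_le ht), trawlEst_eq_of_pos x n (by positivity),
    gridIndex_mul hδ]

/-- The part of the lagged sample autocovariance difference that stems from centring at the sample
mean and from the boundary. -/
noncomputable def autocovRemainder (x : ℕ → ℝ) (n l : ℕ) : ℝ :=
  -sampleMean x n * (x l - x (n - 1))
    + (x (n - 1) - sampleMean x n) * (x (n - l - 1) - sampleMean x n)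

/-- The autocovariance at lag l has one summand more than that at lag l + 1, giving the boundary
product; centring the factor x k produces a telescoping sum times the sample mean. -/
theorem sampleAutocov_sub (x : ℕ → ℝ) {n l : ℕ} (hl : l + 1 ≤ n) :
    n * (sampleAutocov x n l - sampleAutocov x n (l + 1))
      = ∑ k ∈ Finset.range (n - l - 1), x k * (x (k + l) - x (k + l + 1))
        + autocovRemainder x n l := by
  obtain ⟨m, rfl⟩ : ∃ m, n = m + l + 1 := ⟨n - l - 1, by omega⟩
  have hn : ((m + l + 1 : ℕ) : ℝ) ≠ 0 := by positivity
  rw [show m + l + 1 - l - 1 = m by omega]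
  have tel : ∑ k ∈ Finset.range m, (x (k + l) - x (k + l + 1)) = x l - x (m + l + 1 - 1) := by
    have := Finset.sum_range_sub' (fun k => x (k + l)) m
    simp only [zero_add] at this
    rw [Nat.add_sub_cancel, ← this]
    exact Finset.sum_congr rfl fun k _ => by rw [show k + l + 1 = k + 1 + l by ring]
  unfold sampleAutocov autocovRemainder
  rw [← mul_sub, ← mul_assoc, mul_one_div_cancel hn, one_mul,
    show m + l + 1 - l - 1 = m by omega, show m + l + 1 - l = m + 1 by omega,
    show m + l + 1 - (l + 1) = m by omega, Finset.sum_range_succ,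
    show l + m = m + l + 1 - 1 by omega,
    add_sub_right_comm, ← Finset.sum_sub_distrib, ← tel, Finset.mul_sum, ← add_assoc,
    ← Finset.sum_add_distrib]
  congr 1
  refine Finset.sum_congr rfl fun k _ => ?_
  rw [show l + k = k + l by ring, show l + 1 + k = k + l + 1 by ring]
  ring

theorem trawlEst_natCast_mul (x : ℕ → ℝ) {n l : ℕ} {δ : ℝ} (hδ : 0 < δ) (h0 : 0 < l)
    (hl : l + 1 ≤ n) : trawlEst x n δ (l * δ)
      = (∑ k ∈ Finset.range (n - l - 1), x k * (x (k + l) - x (k + l + 1))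
        + autocovRemainder x n l) / (n * δ) := by
  have hn : (n : ℝ) ≠ 0 := by
    have : 0 < n := by omega
    positivity
  rw [← sampleAutocov_sub x hl, trawlEst_eq_of_pos x n (by positivity), gridIndex_mul hδ]
  field_simp
  ring

theorem sampleMean_pow_four_le (x : ℕ → ℝ) {n : ℕ} (hn : 0 < n) :
    sampleMean x n ^ 4 ≤ (∑ k ∈ Finset.range n, x k ^ 4) / n := by
  have hn' : (0 : ℝ) < n := by positivity
  have h1 := sq_sum_le_card_mul_sum_sq (s := Finset.range n) (f := x)
  have h2 := sq_sum_le_card_mul_sum_sq (s := Finset.range n) (f := fun k => x k ^ 2)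
  rw [Finset.card_range] at h1 h2
  simp_rw [← pow_mul] at h2
  have h3 : (∑ k ∈ Finset.range n, x k) ^ 4 ≤ n ^ 3 * ∑ k ∈ Finset.range n, x k ^ 4 := by
    calc (∑ k ∈ Finset.range n, x k) ^ 4 = ((∑ k ∈ Finset.range n, x k) ^ 2) ^ 2 := by ring
      _ ≤ (n * ∑ k ∈ Finset.range n, x k ^ 2) ^ 2 := by gcongr
      _ = n ^ 2 * (∑ k ∈ Finset.range n, x k ^ 2) ^ 2 := by ring
      _ ≤ n ^ 2 * (n * ∑ k ∈ Finset.range n, x k ^ 4) := by gcongr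
      _ = _ := by ring
  rw [sampleMean, mul_pow, div_pow, one_pow, le_div_iff₀ hn', one_div, inv_mul_eq_div,
    div_mul_eq_mul_div, div_le_iff₀ (by positivity)]
  nlinarith

/-- For stationary data the right-hand side has mean 16 E x₀⁴, free of n and l, so after division by
nδ the remainder is harmless. -/
theorem autocovRemainder_sq_le (x : ℕ → ℝ) {n : ℕ} (hn : 0 < n) (l : ℕ) :
    autocovRemainder x n l ^ 2 ≤ 8 * ((∑ k ∈ Finset.range n, x k ^ 4) / n) + 2 * x l ^ 4
      + 2 * x (n - 1) ^ 4 + 4 * x (n - l - 1) ^ 4 := by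
  have h := sampleMean_pow_four_le x hn
  unfold autocovRemainder
  generalize sampleMean x n = m at *
  generalize x l = p
  generalize x (n - 1) = q
  generalize x (n - l - 1) = r
  have e : (-m * (p - q) + (q - m) * (r - m)) ^ 2 = (-(m * p) + q * r - m * r + m * m) ^ 2 := by
    ring
  have h1 : (-(m * p) + q * r - m * r + m * m) ^ 2
      ≤ 4 * ((m * p) ^ 2 + (q * r) ^ 2 + (m * r) ^ 2 + (m * m) ^ 2) := by
    generalize m * p = a
    generalize q * r = b
    generalize m * r = c
    generalize m * m = d
    nlinarith [sq_nonneg (a + b), sq_nonneg (a - c), sq_nonneg (a + d), sq_nonneg (b + c),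
      sq_nonneg (b - d), sq_nonneg (c + d)]
  rw [e]
  nlinarith [sq_nonneg (m ^ 2 - p ^ 2), sq_nonneg (q ^ 2 - r ^ 2), sq_nonneg (m ^ 2 - r ^ 2)]

variable {Ω : Type*} [MeasurableSpace Ω] {P : Measure Ω} [IsProbabilityMeasure P] {K c : ℝ}
  {X : Set (ℝ × ℝ) → Ω → ℝ} {a : ℝ → ℝ}

/-- Two sources of bias: the variation of a over one mesh cell, and the normalisation by n = m + l +
1 of a sum of only m terms. -/
theorem abs_bias_le {d δ a₀ a₁ : ℝ} {m l : ℕ} (hδ : 0 < δ) (h0 : 0 ≤ a₁) (h1 : δ * a₁ ≤ d)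
    (h2 : d ≤ δ * a₀) :
    (m * d / ((m + l + 1 : ℕ) * δ) - a₀) ^ 2
      ≤ 2 * (a₀ - a₁) ^ 2 + 2 * ((l + 1) / (m + l + 1 : ℕ)) ^ 2 * a₀ ^ 2 := by
  obtain ⟨e, rfl⟩ : ∃ e, d = δ * e := ⟨d / δ, by field_simp⟩
  have h1 := le_of_mul_le_mul_left h1 hδ
  have h2 := le_of_mul_le_mul_left h2 hδ
  set n : ℝ := ((m + l + 1 : ℕ) : ℝ) with hn
  have hn0 : 0 < n := by positivity
  have hm : (m : ℝ) = n - (l + 1) := by rw [hn]; push_cast; ring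
  have e1 : m * (δ * e) / (n * δ) - a₀ = -((a₀ - e) + (l + 1) / n * e) := by
    rw [hm]
    field_simp
    ring
  have hq : 0 ≤ (l + 1) / n * e := mul_nonneg (by positivity) (h0.trans h1)
  have hq2 : (l + 1) / n * e ≤ (l + 1) / n * a₀ := by gcongr
  have s1 : (a₀ - e) ^ 2 ≤ (a₀ - a₁) ^ 2 := by
    apply pow_le_pow_left₀ <;> linarith
  have s2 : ((l + 1) / n * e) ^ 2 ≤ ((l + 1) / n * a₀) ^ 2 := pow_le_pow_left₀ hq hq2 2
  rw [e1, neg_sq]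
  rw [mul_pow _ a₀] at s2
  nlinarith [sq_nonneg (a₀ - e - (l + 1) / n * e)]

set_option maxHeartbeats 1000000 in
/-- Mean square error of the estimator of the trawl function on the grid. -/
theorem IsCenteredBasis.integral_trawlEst_sub_sq_le (hX : IsCenteredBasis P K c X) (hK : 0 ≤ K)
    (ha : IsTrawlFunction a) : ∃ C, 0 ≤ C ∧ ∀ δ, 0 < δ → δ * a 0 ≤ 1 → ∀ n l : ℕ, l + 1 ≤ n →
      Integrable (fun ω => (trawlEst (fun k => X (trawlSetAt a (k * δ)) ω) n δ (l * δ)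
        - a (l * δ)) ^ 2) P ∧
      ∫ ω, (trawlEst (fun k => X (trawlSetAt a (k * δ)) ω) n δ (l * δ) - a (l * δ)) ^ 2 ∂P
        ≤ C * (1 / (n * δ) + 1 / (n * δ) ^ 2) + 6 * (a (l * δ) - a ((l + 1 : ℕ) * δ)) ^ 2
          + 6 * ((l + 1) / n) ^ 2 * a (l * δ) ^ 2 := by
  set g₀ : ℝ := ∫ x in Set.Ioi 0, a x with hg₀
  set m₄ : ℝ := ∫ ω, X (trawlSetAt a 0) ω ^ 4 ∂P with hm₄
  have a0 : 0 ≤ a 0 := ha.nonneg 0 le_rfl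
  have hg0 : 0 ≤ g₀ := setIntegral_nonneg measurableSet_Ioi fun x hx => ha.nonneg x (le_of_lt hx)
  have hm0 : 0 ≤ m₄ := integral_nonneg fun ω => by positivity
  -- The contributions, in order: the lagged sum and the remainder, both for l > 0, and the realised
  -- variance for l = 0.
  refine ⟨12 * (3 * g₀ + 2 * K) * a 0 + 48 * m₄ + 9 * (2 + 2 * K) * a 0, by positivity, ?_⟩
  intro δ hδ hδ1 n l hl
  have hA := isStationarySequence_trawlSetAt ha hδ.le
  set A : ℕ → Set (ℝ × ℝ) := fun k => trawlSetAt a (k * δ) with hAdef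
  have hgz : gridCov a δ 0 = g₀ := by simp [gridCov, hg₀]
  have hd : ∀ l, δ * a ((l + 1 : ℕ) * δ) ≤ gridCov a δ l - gridCov a δ (l + 1) ∧
      gridCov a δ l - gridCov a δ (l + 1) ≤ δ * a (l * δ) := gridCov_sub ha hδ.le
  have hv : gridCov a δ 0 - gridCov a δ 1 ≤ δ * a 0 := by simpa using (hd 0).2
  have hv0 : 0 ≤ gridCov a δ 0 - gridCov a δ 1 :=
    (mul_nonneg hδ.le (ha.nonneg _ (by positivity))).trans (hd 0).1
  have hv1 : gridCov a δ 0 - gridCov a δ 1 ≤ 1 := hv.trans hδ1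
  have i4 : ∀ k, Integrable (fun ω => X (A k) ω ^ 4) P := fun k =>
    hX.integrable_pow (hA.isBoundedBorel k) (by norm_num)
  have e4 : ∀ k, ∫ ω, X (A k) ω ^ 4 ∂P = m₄ := fun k =>
    hX.integral_pow_four_eq _ _ (hA.isBoundedBorel k) (by simpa [hAdef] using hA.isBoundedBorel 0)
      (by rw [hA.volume_eq k, ← hA.volume_eq 0]; simp [hAdef])
  have hn : 0 < n := by omega
  have hn' : (0 : ℝ) < n := by positivity
  have hnδ : 0 < n * δ := by positivity
  have mA : ∀ k, Measurable (X (A k)) := fun k => hX.measurable _ (hA.isBoundedBorel k)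
  obtain ⟨m, rfl⟩ : ∃ m, n = m + l + 1 := ⟨n - l - 1, by omega⟩
  have hbias := abs_bias_le (m := m) (l := l) hδ
    (ha.nonneg ((l + 1 : ℕ) * δ) (by positivity)) (hd l).1 (hd l).2
  have hcard : (m : ℝ) ≤ (m + l + 1 : ℕ) := by push_cast; linarith
  set b : ℝ := m * (gridCov a δ l - gridCov a δ (l + 1)) / ((m + l + 1 : ℕ) * δ) - a (l * δ)
    with hb
  rcases Nat.eq_zero_or_pos l with rfl | hl0
  · obtain ⟨iS, bS⟩ := hX.integral_sum_sub_sq_sub_sq_le hK (Finset.range m)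
      hA.isBoundedBorel_gain hA.isBoundedBorel_loss hA.pairwise_disjoint_gain
      hA.pairwise_disjoint_loss (fun k j => hA.disjoint_gain_loss) hA.volume_gain hA.volume_loss hv1
    rw [Finset.card_range] at bS
    set v := gridCov a δ 0 - gridCov a δ 1 with hvdef
    set n : ℝ := ((m + 0 + 1 : ℕ) : ℝ) with hndef
    have eq : ∀ᵐ ω ∂P, trawlEst (fun k => X (A k) ω) (m + 0 + 1) δ ((0 : ℕ) * δ) - a ((0 : ℕ) * δ)
        = (∑ k ∈ Finset.range m, ((X (gain A k) ω - X (loss A k) ω) ^ 2 - 2 * v)) / (2 * n * δ)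
          + b := by
      filter_upwards [hX.ae_sub_eq hA] with ω hω
      simp only [Nat.cast_zero, zero_mul, trawlEst, if_true, hω, Finset.sum_sub_distrib,
        Finset.sum_const, Finset.card_range, nsmul_eq_mul, hb,
        Nat.add_zero, Nat.add_sub_cancel, ← hndef]
      field_simp
      ring
    have le : ∀ᵐ ω ∂P, (trawlEst (fun k => X (A k) ω) (m + 0 + 1) δ ((0 : ℕ) * δ)
        - a ((0 : ℕ) * δ)) ^ 2 ≤ (1 / (2 * (n * δ) ^ 2)) *
          (∑ k ∈ Finset.range m, ((X (gain A k) ω - X (loss A k) ω) ^ 2 - 2 * v)) ^ 2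
          + 3 * b ^ 2 := by
      filter_upwards [eq] with ω hω
      rw [hω]
      generalize ∑ k ∈ Finset.range m, ((X (gain A k) ω - X (loss A k) ω) ^ 2 - 2 * v) = S
      have : (1 / (2 * (n * δ) ^ 2)) * S ^ 2 = 2 * (S / (2 * n * δ)) ^ 2 := by
        field_simp
      rw [this]
      nlinarith [sq_nonneg (S / (2 * n * δ) - b), sq_nonneg b]
    have ib := (iS.const_mul (1 / (2 * (n * δ) ^ 2))).add (integrable_const (3 * b ^ 2))
    have ii : Integrable (fun ω => (trawlEst (fun k => X (A k) ω) (m + 0 + 1) δ ((0 : ℕ) * δ)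
        - a ((0 : ℕ) * δ)) ^ 2) P := by
      refine ib.mono' (Measurable.aestronglyMeasurable ?_) (le.mono fun ω h => by simpa using h)
      simp only [Nat.cast_zero, zero_mul, trawlEst, if_true]
      fun_prop
    refine ⟨ii, (integral_mono_ae ii ib le).trans ?_⟩
    simp only [Pi.add_apply]
    rw [integral_add (iS.const_mul _) (integrable_const _), integral_const_mul, integral_const]
    simp only [probReal_univ, one_smul]
    have h1 : 1 / (2 * (n * δ) ^ 2) * (∫ ω, (∑ k ∈ Finset.range m,
        ((X (gain A k) ω - X (loss A k) ω) ^ 2 - 2 * v)) ^ 2 ∂P)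
        ≤ 9 * (2 + 2 * K) * a 0 * (1 / (n * δ)) := by
      calc _ ≤ 1 / (2 * (n * δ) ^ 2) * (18 * (n * ((2 * 1 + 2 * K) * (δ * a 0)))) := by
            refine mul_le_mul_of_nonneg_left (bS.trans ?_) (by positivity)
            gcongr
        _ = _ := by field_simp; ring
    have h2 : 0 ≤ (12 * (3 * g₀ + 2 * K) * a 0 + 48 * m₄) * (1 / (n * δ) + 1 / (n * δ) ^ 2)
        + 9 * (2 + 2 * K) * a 0 * (1 / (n * δ) ^ 2) := by positivity
    linarith
  · obtain ⟨iS, bS⟩ := hX.integral_lagged_sum_sq_le hK hA hv1 (Finset.range m) l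
    rw [Finset.card_range] at bS
    set n : ℝ := ((m + l + 1 : ℕ) : ℝ) with hndef
    set d := gridCov a δ l - gridCov a δ (l + 1) with hddef
    have iR : Integrable (fun ω => 8 * ((∑ k ∈ Finset.range (m + l + 1), X (A k) ω ^ 4) / n)
        + 2 * X (A l) ω ^ 4 + 2 * X (A (m + l + 1 - 1)) ω ^ 4
        + 4 * X (A (m + l + 1 - l - 1)) ω ^ 4) P :=
      ((((integrable_finsetSum _ fun k _ => i4 k).div_const _).const_mul 8).add
        ((i4 _).const_mul 2)).add ((i4 _).const_mul 2) |>.add ((i4 _).const_mul 4)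
    have bR : ∫ ω, (8 * ((∑ k ∈ Finset.range (m + l + 1), X (A k) ω ^ 4) / n)
        + 2 * X (A l) ω ^ 4 + 2 * X (A (m + l + 1 - 1)) ω ^ 4
        + 4 * X (A (m + l + 1 - l - 1)) ω ^ 4) ∂P = 16 * m₄ := by
      have j1 := ((integrable_finsetSum (Finset.range (m + l + 1)) fun k _ => i4 k).div_const
        n).const_mul 8
      rw [integral_add (by exact (j1.add ((i4 _).const_mul 2)).add ((i4 _).const_mul 2))
        ((i4 _).const_mul 4), integral_add (by exact j1.add ((i4 _).const_mul 2))
        ((i4 _).const_mul 2), integral_add j1 ((i4 _).const_mul 2), integral_const_mul,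
        integral_const_mul, integral_const_mul, integral_const_mul, integral_div,
        integral_finsetSum _ fun k _ => i4 k]
      simp only [e4, Finset.sum_const, Finset.card_range, nsmul_eq_mul, ← hndef]
      field_simp
      ring
    have le : ∀ ω, (trawlEst (fun k => X (A k) ω) (m + l + 1) δ (l * δ) - a (l * δ)) ^ 2
        ≤ (3 / (n * δ) ^ 2) * (∑ k ∈ Finset.range m,
          (X (A k) ω * (X (A (k + l)) ω - X (A (k + l + 1)) ω) - d)) ^ 2
        + (3 / (n * δ) ^ 2) * (8 * ((∑ k ∈ Finset.range (m + l + 1), X (A k) ω ^ 4) / n)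
          + 2 * X (A l) ω ^ 4 + 2 * X (A (m + l + 1 - 1)) ω ^ 4
          + 4 * X (A (m + l + 1 - l - 1)) ω ^ 4) + 3 * b ^ 2 := fun ω => by
      have hR := autocovRemainder_sq_le (fun k => X (A k) ω) hn l
      have hE := trawlEst_natCast_mul (fun k => X (A k) ω) hδ hl0 hl
      rw [show m + l + 1 - l - 1 = m by omega] at hE hR ⊢
      rw [hE]
      refine le_trans ?_ (add_le_add_left (add_le_add_right
        (mul_le_mul_of_nonneg_left hR (by positivity)) _) _)
      simp only [Finset.sum_sub_distrib, Finset.sum_const, Finset.card_range, nsmul_eq_mul, hb]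
      simp only [← hndef]
      generalize ∑ k ∈ Finset.range m, X (A k) ω * (X (A (k + l)) ω - X (A (k + l + 1)) ω) = S
      generalize autocovRemainder (fun k => X (A k) ω) (m + l + 1) l = R
      have e : (S + R) / (n * δ) - a (l * δ)
          = (S - m * d) / (n * δ) + R / (n * δ) + (m * d / (n * δ) - a (l * δ)) := by ring
      have e1 : 3 / (n * δ) ^ 2 * (S - m * d) ^ 2 = 3 * ((S - m * d) / (n * δ)) ^ 2 := by ring
      have e2 : 3 / (n * δ) ^ 2 * R ^ 2 = 3 * (R / (n * δ)) ^ 2 := by ring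
      rw [e, e1, e2]
      generalize (S - m * d) / (n * δ) = x
      generalize R / (n * δ) = y
      generalize m * d / (n * δ) - a (l * δ) = z
      nlinarith [sq_nonneg (x - y), sq_nonneg (y - z), sq_nonneg (x - z)]
    have ib := ((iS.const_mul (3 / (n * δ) ^ 2)).add (iR.const_mul (3 / (n * δ) ^ 2))).add
      (integrable_const (3 * b ^ 2))
    have ii : Integrable (fun ω =>
        (trawlEst (fun k => X (A k) ω) (m + l + 1) δ (l * δ) - a (l * δ)) ^ 2) P := by
      refine ib.mono' (Measurable.aestronglyMeasurable ?_) (ae_of_all _ fun ω => by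
        simpa using le ω)
      simp only [trawlEst, sampleAutocov, sampleMean]
      split_ifs <;> fun_prop
    refine ⟨ii, (integral_mono ii ib le).trans ?_⟩
    simp only [Pi.add_apply]
    rw [integral_add (by exact (iS.const_mul _).add (iR.const_mul _)) (integrable_const _),
      integral_add (iS.const_mul _) (iR.const_mul _), integral_const_mul, integral_const_mul, bR,
      integral_const]
    simp only [probReal_univ, one_smul]
    have h1 : 3 / (n * δ) ^ 2 * (∫ ω, (∑ k ∈ Finset.range m,
          (X (A k) ω * (X (A (k + l)) ω - X (A (k + l + 1)) ω) - d)) ^ 2 ∂P)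
        ≤ 12 * (3 * g₀ + 2 * K) * a 0 * (1 / (n * δ)) := by
      calc _ ≤ 3 / (n * δ) ^ 2 * (4 * (n * ((3 * g₀ + 2 * K) * (δ * a 0)))) := by
            refine mul_le_mul_of_nonneg_left (bS.trans ?_) (by positivity)
            rw [hgz] at hv hv0 ⊢
            gcongr
        _ = _ := by field_simp; ring
    have h2 : 3 / (n * δ) ^ 2 * (16 * m₄) = 48 * m₄ * (1 / (n * δ) ^ 2) := by ring
    have h3 : 0 ≤ 12 * (3 * g₀ + 2 * K) * a 0 * (1 / (n * δ) ^ 2) + 48 * m₄ * (1 / (n * δ))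
        + 9 * (2 + 2 * K) * a 0 * (1 / (n * δ) + 1 / (n * δ) ^ 2) := by positivity
    linarith

end Statistics

/-! ### Riemann sums on the half-line by dominated convergence -/

section RiemannSums

/-- As an integral of a step function on a fixed domain, a Riemann sum with growing range becomes
accessible to dominated convergence. -/
theorem sum_mul_eq_integral_floor (F : ℕ → ℝ) (M : ℕ) {δ : ℝ} (hδ : 0 < δ) :
    Integrable (fun s : ℝ => if ⌊s / δ⌋₊ ≤ M then F ⌊s / δ⌋₊ else 0)
      (volume.restrict (Set.Ioi 0)) ∧
    ∑ l ∈ Finset.range (M + 1), F l * δ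
      = ∫ s in Set.Ioi (0 : ℝ), if ⌊s / δ⌋₊ ≤ M then F ⌊s / δ⌋₊ else 0 := by
  have hi : ∀ l : ℕ, Integrable ((Set.Ico (l * δ) ((l + 1) * δ)).indicator fun _ => F l)
      (volume.restrict (Set.Ici 0)) := fun l =>
    (integrable_indicator_iff measurableSet_Ico).2 (integrableOn_const (by
      refine ((Measure.restrict_apply_le _ _).trans_lt ?_).ne
      simp))
  have eq : ∀ᵐ s ∂volume.restrict (Set.Ici (0 : ℝ)),
      (∑ l ∈ Finset.range (M + 1), (Set.Ico (l * δ) ((l + 1) * δ)).indicator (fun _ => F l) s)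
        = if ⌊s / δ⌋₊ ≤ M then F ⌊s / δ⌋₊ else 0 := by
    refine (ae_restrict_iff' measurableSet_Ici).2 (ae_of_all _ fun s hs => ?_)
    have hs : 0 ≤ s := hs
    have key : ∀ l : ℕ, s ∈ Set.Ico (l * δ) ((l + 1) * δ) ↔ ⌊s / δ⌋₊ = l := fun l => by
      rw [Nat.floor_eq_iff (by positivity), le_div_iff₀ hδ, div_lt_iff₀ hδ, Set.mem_Ico]
    simp only [Set.indicator_apply, key]
    rw [Finset.sum_ite_eq]
    simp
  rw [Measure.restrict_congr_set Ioi_ae_eq_Ici]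
  refine ⟨(integrable_finsetSum _ fun l _ => hi l).congr eq, ?_⟩
  rw [← integral_congr_ae eq, integral_finsetSum _ fun l _ => hi l]
  refine Finset.sum_congr rfl fun l _ => ?_
  rw [integral_indicator measurableSet_Ico, Measure.restrict_restrict measurableSet_Ico,
    Set.inter_eq_left.2 fun s hs => ?_, setIntegral_const, Real.volume_real_Ico_of_le (by nlinarith),
    smul_eq_mul]
  · ring
  · exact Set.mem_Ici.2 ((by positivity : 0 ≤ (l : ℝ) * δ).trans hs.1)

/-- Convergence of Riemann sums under domination. -/
theorem tendsto_sum_mul_mesh {Δ : ℕ → ℝ} (hΔ : ∀ᶠ n in atTop, 0 < Δ n) {M : ℕ → ℕ}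
    {F : ℕ → ℕ → ℝ} {f B : ℝ → ℝ}
    (hlim : ∀ᵐ s ∂volume.restrict (Set.Ioi (0 : ℝ)), Tendsto (fun n =>
      if ⌊s / Δ n⌋₊ ≤ M n then F n ⌊s / Δ n⌋₊ else 0) atTop (𝓝 (f s)))
    (hB : IntegrableOn B (Set.Ioi 0))
    (hFB : ∀ᶠ n in atTop, ∀ s, 0 < s → ⌊s / Δ n⌋₊ ≤ M n → |F n ⌊s / Δ n⌋₊| ≤ B s)
    (hB0 : ∀ s, 0 < s → 0 ≤ B s) :
    Tendsto (fun n => ∑ l ∈ Finset.range (M n + 1), F n l * Δ n) atTop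
      (𝓝 (∫ s in Set.Ioi (0 : ℝ), f s)) := by
  have h := tendsto_integral_filter_of_dominated_convergence (l := atTop) (F := fun n s =>
      if ⌊s / Δ n⌋₊ ≤ M n then F n ⌊s / Δ n⌋₊ else 0) (f := f) B
    (hΔ.mono fun n hn => (sum_mul_eq_integral_floor (F n) (M n) hn).1.aestronglyMeasurable)
    (hFB.mono fun n hn => (ae_restrict_iff' measurableSet_Ioi).2 (ae_of_all _ fun s hs => by
      split_ifs with h
      · exact hn s hs h
      · simpa using hB0 s hs)) hB hlim
  refine h.congr' ?_
  filter_upwards [hΔ] with n hn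
  exact (sum_mul_eq_integral_floor (F n) (M n) hn).2.symm

theorem floor_div_mul_le {s δ : ℝ} (hs : 0 ≤ s) (hδ : 0 < δ) : (⌊s / δ⌋₊ : ℝ) * δ ≤ s := by
  rw [← le_div_iff₀ hδ]
  exact Nat.floor_le (by positivity)

theorem lt_floor_div_mul_add {s δ : ℝ} (hδ : 0 < δ) : s < (⌊s / δ⌋₊ : ℝ) * δ + δ := by
  have := Nat.lt_floor_add_one (s / δ)
  rw [div_lt_iff₀ hδ] at this
  linarith

theorem tendsto_floor_div_mul {Δ : ℕ → ℝ} (hΔ : Tendsto Δ atTop (𝓝[>] 0)) {s : ℝ} (hs : 0 ≤ s) :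
    Tendsto (fun n => (⌊s / Δ n⌋₊ : ℝ) * Δ n) atTop (𝓝 s) := by
  have h1 := tendsto_nhdsWithin_iff.1 hΔ
  have h2 : Tendsto (fun n => s - Δ n) atTop (𝓝 s) := by
    simpa using tendsto_const_nhds.sub h1.1
  refine tendsto_of_tendsto_of_tendsto_of_le_of_le' h2 tendsto_const_nhds ?_ ?_
  · filter_upwards [h1.2] with n hn
    linarith [lt_floor_div_mul_add (s := s) hn]
  · filter_upwards [h1.2] with n hn using floor_div_mul_le hs hn

variable {a : ℝ → ℝ}

theorem IsTrawlFunction.tendsto_comp (ha : IsTrawlFunction a) {u : ℕ → ℝ} {s : ℝ} (hs : 0 ≤ s)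
    (hu0 : ∀ᶠ n in atTop, 0 ≤ u n) (hu : Tendsto u atTop (𝓝 s)) :
    Tendsto (fun n => a (u n)) atTop (𝓝 (a s)) := by
  have h := (ha.continuous_comp_max.tendsto s).comp hu
  simp only [max_eq_left hs] at h
  refine h.congr' ?_
  filter_upwards [hu0] with n hn
  simp [max_eq_left hn]

theorem IsTrawlFunction.le_zero (ha : IsTrawlFunction a) {s : ℝ} (hs : 0 ≤ s) : a s ≤ a 0 :=
  ha.antitoneOn (Set.mem_Ici.2 le_rfl) (Set.mem_Ici.2 hs) hs

/-- For mesh at most 1 the grid point below s is above s - 1, so this function dominates the step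
functions of a. -/
theorem IsTrawlFunction.integrableOn_shift (ha : IsTrawlFunction a) :
    IntegrableOn (fun s => a (max (s - 1) 0)) (Set.Ioi 0) := by
  have h1 : IntegrableOn (fun s => a (max (s - 1) 0)) (Set.Ioc 0 1) :=
    ((ha.continuous_comp_max.comp (by fun_prop : Continuous fun s : ℝ => s - 1)).integrableOn_Icc
      (a := 0) (b := 1)).mono_set Set.Ioc_subset_Icc_self
  have h2 : IntegrableOn (fun s => a (max (s - 1) 0)) (Set.Ioi 1) := by
    have := ((integrable_indicator_iff measurableSet_Ioi).2
      (ha.integrableOn_Ioi le_rfl)).comp_sub_right 1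
    refine ((integrable_indicator_iff measurableSet_Ioi).1 (this.congr (ae_of_all _ fun s => ?_)))
    by_cases hs : 1 < s
    · simp only [Set.indicator_apply, Set.mem_Ioi, sub_pos, hs, if_true]
      rw [max_eq_left (by linarith)]
    · simp only [Set.indicator_apply, Set.mem_Ioi, sub_pos, hs, if_false]
  rw [← Set.Ioc_union_Ioi_eq_Ioi zero_le_one]
  exact h1.union h2

theorem IsTrawlFunction.floor_le_shift (ha : IsTrawlFunction a) {s δ : ℝ} (hδ : 0 < δ)
    (hδ1 : δ ≤ 1) : a (⌊s / δ⌋₊ * δ) ≤ a (max (s - 1) 0) := by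
  have h : 0 ≤ (⌊s / δ⌋₊ : ℝ) * δ := by positivity
  refine ha.antitoneOn (Set.mem_Ici.2 (le_max_right _ _)) (Set.mem_Ici.2 h) (max_le ?_ h)
  linarith [lt_floor_div_mul_add (s := s) hδ]

variable {Δ : ℕ → ℝ}

theorem eventually_mesh (hΔ : Tendsto Δ atTop (𝓝[>] 0)) {ε : ℝ} (hε : 0 < ε) :
    ∀ᶠ n in atTop, 0 < Δ n ∧ Δ n ≤ ε :=
  hΔ.eventually (Ioc_mem_nhdsGT hε)

theorem eventually_floor_le (hΔ : Tendsto Δ atTop (𝓝[>] 0)) {M : ℕ → ℕ}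
    (hM : Tendsto (fun n => (M n : ℝ) * Δ n) atTop atTop) (s : ℝ) :
    ∀ᶠ n in atTop, ⌊s / Δ n⌋₊ ≤ M n := by
  filter_upwards [eventually_mesh hΔ zero_lt_one, hM.eventually_ge_atTop s] with n hn hs'
  refine Nat.floor_le_of_le ?_
  rwa [div_le_iff₀ hn.1]

theorem IsTrawlFunction.tendsto_sum_sq (ha : IsTrawlFunction a) (hΔ : Tendsto Δ atTop (𝓝[>] 0))
    {M : ℕ → ℕ} (hM : Tendsto (fun n => (M n : ℝ) * Δ n) atTop atTop) :
    Tendsto (fun n => ∑ l ∈ Finset.range (M n + 1), a (l * Δ n) ^ 2 * Δ n) atTop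
      (𝓝 (∫ s in Set.Ioi (0 : ℝ), a s ^ 2)) := by
  refine tendsto_sum_mul_mesh ((eventually_mesh hΔ zero_lt_one).mono fun n h => h.1)
    (F := fun n l => a (l * Δ n) ^ 2) ?_ (ha.integrableOn_shift.const_mul (a 0)) ?_ ?_
  · refine (ae_restrict_iff' measurableSet_Ioi).2 (ae_of_all _ fun s hs => ?_)
    have hs : 0 < s := hs
    have := (ha.tendsto_comp hs.le ((eventually_mesh hΔ zero_lt_one).mono fun n h => by
      have := h.1; positivity) (tendsto_floor_div_mul hΔ hs.le)).pow 2
    refine this.congr' ?_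
    filter_upwards [eventually_floor_le hΔ hM s] with n hn
    rw [if_pos hn]
  · filter_upwards [eventually_mesh hΔ zero_lt_one] with n hn s _ _
    have h1 : (0 : ℝ) ≤ ⌊s / Δ n⌋₊ * Δ n := by have := hn.1; positivity
    have h2 := ha.nonneg _ h1
    rw [abs_of_nonneg (by positivity), sq]
    exact mul_le_mul (ha.le_zero h1) (ha.floor_le_shift hn.1 hn.2) h2 (ha.nonneg 0 le_rfl)
  · exact fun s _ => mul_nonneg (ha.nonneg 0 le_rfl) (ha.nonneg _ (le_max_right _ _))

theorem IsTrawlFunction.tendsto_sum_mul_reflected (ha : IsTrawlFunction a)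
    (hΔ : Tendsto Δ atTop (𝓝[>] 0)) {t : ℝ} (ht : 0 < t) :
    Tendsto (fun n => ∑ l ∈ Finset.range (gridIndex (Δ n) t + 1),
      a ((gridIndex (Δ n) t - l : ℕ) * Δ n) * a ((gridIndex (Δ n) t + l : ℕ) * Δ n) * Δ n) atTop
      (𝓝 (∫ s in (0 : ℝ)..t, a (t - s) * a (t + s))) := by
  have e : ∫ s in (0 : ℝ)..t, a (t - s) * a (t + s) = ∫ s in Set.Ioi (0 : ℝ),
      (Set.Ioc 0 t).indicator (fun s => a (t - s) * a (t + s)) s := by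
    rw [intervalIntegral.integral_of_le ht.le, integral_indicator measurableSet_Ioc,
      Measure.restrict_restrict measurableSet_Ioc, Set.inter_eq_left.2 Set.Ioc_subset_Ioi_self]
  rw [e]
  have mesh := eventually_mesh hΔ zero_lt_one
  have ht' := tendsto_floor_div_mul hΔ ht.le
  refine tendsto_sum_mul_mesh (mesh.mono fun n h => h.1)
    (F := fun n l => a ((gridIndex (Δ n) t - l : ℕ) * Δ n) * a ((gridIndex (Δ n) t + l : ℕ) * Δ n))
    (B := (Set.Ioc 0 (t + 1)).indicator fun _ => a 0 ^ 2) ?_ ?_ ?_ ?_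
  · refine (ae_restrict_iff' measurableSet_Ioi).2 ?_
    -- At s = t the truncated step function tends to a(0) a(2t), the value of the indicator form
    -- too, but excluding this null point leaves only the two open cases.
    have : ∀ᵐ s : ℝ, s ≠ t := by simp [ae_iff, measure_singleton]
    filter_upwards [this] with s hst hs
    have hs : 0 < s := hs
    have hs' := tendsto_floor_div_mul hΔ hs.le
    rcases lt_or_gt_of_ne hst with h | h
    · rw [Set.indicator_of_mem (Set.mem_Ioc.2 ⟨hs, h.le⟩)]
      have le : ∀ᶠ n in atTop, ⌊s / Δ n⌋₊ ≤ gridIndex (Δ n) t := by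
        filter_upwards [mesh] with n hn
        exact Nat.floor_mono (div_le_div_of_nonneg_right h.le hn.1.le)
      have c1 : Tendsto (fun n => ((gridIndex (Δ n) t - ⌊s / Δ n⌋₊ : ℕ) : ℝ) * Δ n) atTop
          (𝓝 (t - s)) := by
        refine (ht'.sub hs').congr' ?_
        filter_upwards [le] with n hn
        rw [Nat.cast_sub hn, gridIndex]
        ring
      have c2 : Tendsto (fun n => ((gridIndex (Δ n) t + ⌊s / Δ n⌋₊ : ℕ) : ℝ) * Δ n) atTop
          (𝓝 (t + s)) := by
        refine (ht'.add hs').congr fun n => ?_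
        rw [Nat.cast_add, gridIndex]
        ring
      refine ((ha.tendsto_comp (by linarith) (mesh.mono fun n hn => ?_) c1).mul
        (ha.tendsto_comp (by linarith) (mesh.mono fun n hn => ?_) c2)).congr' ?_
      · have := hn.1; positivity
      · have := hn.1; positivity
      · filter_upwards [le] with n hn
        rw [if_pos hn]
    · rw [Set.indicator_of_notMem (fun h' => not_lt.2 h'.2 h)]
      refine tendsto_const_nhds.congr' ?_
      -- Once the mesh is at most s - t, the grid index of s exceeds that of t and the truncated
      -- term is zero.
      filter_upwards [eventually_mesh hΔ (sub_pos.2 h)] with n hn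
      rw [if_neg]
      intro hle
      have h1 := lt_floor_div_mul_add (s := s) hn.1
      have h2 := floor_div_mul_le ht.le hn.1
      have h3 : (⌊s / Δ n⌋₊ : ℝ) < ⌊t / Δ n⌋₊ + 0 ∨ (⌊s / Δ n⌋₊ : ℝ) = ⌊t / Δ n⌋₊ := by
        rcases hle.lt_or_eq with h | h
        · left; rw [add_zero]; exact_mod_cast h
        · right; exact_mod_cast h
      have h4 : (⌊t / Δ n⌋₊ : ℝ) * Δ n + Δ n ≤ s := by linarith [hn.2]
      have h5 : t / Δ n + 1 ≤ s / Δ n := by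
        rw [← div_self hn.1.ne', ← add_div]
        exact div_le_div_of_nonneg_right (by linarith [hn.2]) hn.1.le
      have h6 := Nat.floor_mono h5
      rw [Nat.floor_add_one (div_nonneg ht.le hn.1.le)] at h6
      have h7 : ⌊s / Δ n⌋₊ ≤ ⌊t / Δ n⌋₊ := hle
      omega
  · exact ((integrable_indicator_iff measurableSet_Ioc).2
      (integrableOn_const (by simp))).integrableOn
  · filter_upwards [mesh] with n hn s hs hle
    have h1 := lt_floor_div_mul_add (s := s) hn.1
    have h2 := floor_div_mul_le ht.le hn.1
    have h3 : (⌊s / Δ n⌋₊ : ℝ) * Δ n ≤ ⌊t / Δ n⌋₊ * Δ n := by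
      have : (⌊s / Δ n⌋₊ : ℝ) ≤ ⌊t / Δ n⌋₊ := by exact_mod_cast hle
      have := hn.1
      gcongr
    rw [Set.indicator_of_mem (Set.mem_Ioc.2 ⟨hs, by linarith [hn.2]⟩), sq]
    have p1 : (0 : ℝ) ≤ (gridIndex (Δ n) t - ⌊s / Δ n⌋₊ : ℕ) * Δ n := by
      have := hn.1; positivity
    have p2 : (0 : ℝ) ≤ (gridIndex (Δ n) t + ⌊s / Δ n⌋₊ : ℕ) * Δ n := by
      have := hn.1; positivity
    rw [abs_of_nonneg (mul_nonneg (ha.nonneg _ p1) (ha.nonneg _ p2))]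
    exact mul_le_mul (ha.le_zero p1) (ha.le_zero p2) (ha.nonneg _ p2) (ha.nonneg 0 le_rfl)
  · exact fun s _ => Set.indicator_nonneg (fun _ _ => by positivity) _

/-- After the substitution s ↦ s + t the integral is ∫ a(s) a(s + 2t) ds over s > 0. The upper index
still spans an unbounded range, because twice the grid index of t covers at most length 2t. -/
theorem IsTrawlFunction.tendsto_sum_mul_shifted (ha : IsTrawlFunction a)
    (hΔ : Tendsto Δ atTop (𝓝[>] 0)) {N : ℕ → ℕ}
    (hN : Tendsto (fun n => (N n : ℝ) * Δ n) atTop atTop) {t : ℝ} (ht : 0 < t) :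
    Tendsto (fun n => ∑ l ∈ Finset.range (N n - 2 * gridIndex (Δ n) t + 1),
      a (l * Δ n) * a ((l + 2 * gridIndex (Δ n) t : ℕ) * Δ n) * Δ n) atTop
      (𝓝 (∫ s in Set.Ioi t, a (s - t) * a (t + s))) := by
  have e : ∫ s in Set.Ioi t, a (s - t) * a (t + s)
      = ∫ s in Set.Ioi (0 : ℝ), a s * a (s + 2 * t) := by
    rw [← integral_indicator measurableSet_Ioi, ← integral_indicator measurableSet_Ioi,
      ← integral_add_right_eq_self _ t]
    refine integral_congr_ae (ae_of_all _ fun s => ?_)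
    by_cases hs : 0 < s
    · simp only [Set.indicator_apply, Set.mem_Ioi, lt_add_iff_pos_left, hs, if_true]
      congr 2 <;> ring
    · simp only [Set.indicator_apply, Set.mem_Ioi, lt_add_iff_pos_left, hs, if_false]
  rw [e]
  have mesh := eventually_mesh hΔ zero_lt_one
  have ht' := tendsto_floor_div_mul hΔ ht.le
  have hM : Tendsto (fun n => ((N n - 2 * gridIndex (Δ n) t : ℕ) : ℝ) * Δ n) atTop atTop := by
    refine tendsto_atTop_mono' _ ?_ (tendsto_atTop_add_const_right _ (-(2 * t)) hN)
    filter_upwards [mesh] with n hn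
    have h1 := floor_div_mul_le ht.le hn.1
    have h2 : (N n : ℝ) - 2 * gridIndex (Δ n) t ≤ ((N n - 2 * gridIndex (Δ n) t : ℕ) : ℝ) := by
      have := Nat.sub_le_iff_le_add (a := N n) (b := 2 * gridIndex (Δ n) t)
        (c := N n - 2 * gridIndex (Δ n) t) |>.1 le_rfl
      have : (N n : ℝ) ≤ (N n - 2 * gridIndex (Δ n) t : ℕ) + 2 * gridIndex (Δ n) t := by
        exact_mod_cast this
      linarith
    have h3 := mul_le_mul_of_nonneg_right h2 hn.1.le
    rw [gridIndex] at *
    linarith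
  refine tendsto_sum_mul_mesh (mesh.mono fun n h => h.1)
    (F := fun n l => a (l * Δ n) * a ((l + 2 * gridIndex (Δ n) t : ℕ) * Δ n))
    ?_ (ha.integrableOn_shift.mul_const (a 0)) ?_ ?_
  · refine (ae_restrict_iff' measurableSet_Ioi).2 (ae_of_all _ fun s hs => ?_)
    have hs : 0 < s := hs
    have hs' := tendsto_floor_div_mul hΔ hs.le
    have c2 : Tendsto (fun n => ((⌊s / Δ n⌋₊ + 2 * gridIndex (Δ n) t : ℕ) : ℝ) * Δ n) atTop
        (𝓝 (s + 2 * t)) := by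
      refine (hs'.add (ht'.const_mul 2)).congr fun n => ?_
      push_cast [gridIndex]
      ring
    refine ((ha.tendsto_comp hs.le (mesh.mono fun n hn => ?_) hs').mul
      (ha.tendsto_comp (by linarith) (mesh.mono fun n hn => ?_) c2)).congr' ?_
    · have := hn.1; positivity
    · have := hn.1; positivity
    · filter_upwards [eventually_floor_le hΔ hM s] with n hn
      rw [if_pos hn]
  · filter_upwards [mesh] with n hn s _ _
    have h1 : (0 : ℝ) ≤ ⌊s / Δ n⌋₊ * Δ n := by have := hn.1; positivity
    have h2 : (0 : ℝ) ≤ (⌊s / Δ n⌋₊ + 2 * gridIndex (Δ n) t : ℕ) * Δ n := by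
      have := hn.1; positivity
    rw [abs_of_nonneg (mul_nonneg (ha.nonneg _ h1) (ha.nonneg _ h2))]
    exact mul_le_mul (ha.floor_le_shift hn.1 hn.2) (ha.le_zero h2) (ha.nonneg _ h2)
      (ha.nonneg _ (le_max_right _ _))
  · exact fun s _ => mul_nonneg (ha.nonneg _ (le_max_right _ _)) (ha.nonneg 0 le_rfl)

end RiemannSums

/-! ### Tools for convergence in probability to constants -/

section ConvergenceInProbability

variable {Ω : Type*} [MeasurableSpace Ω] {P : Measure Ω}

/-- The continuous mapping theorem for limits in probability that are constants. -/
theorem tendstoInMeasure_comp₂ {f g : ℕ → Ω → ℝ} {c d : ℝ}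
    (hf : TendstoInMeasure P f atTop fun _ => c) (hg : TendstoInMeasure P g atTop fun _ => d)
    {φ : ℝ × ℝ → ℝ} (hφ : ContinuousAt φ (c, d)) :
    TendstoInMeasure P (fun n ω => φ (f n ω, g n ω)) atTop fun _ => φ (c, d) := by
  rw [tendstoInMeasure_iff_dist] at *
  intro ε hε
  obtain ⟨δ, hδ, h⟩ := Metric.continuousAt_iff.1 hφ ε hε
  refine tendsto_of_tendsto_of_tendsto_of_le_of_le tendsto_const_nhds
    (by simpa using (hf δ hδ).add (hg δ hδ)) (fun _ => bot_le) fun n => ?_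
  refine (measure_mono ?_).trans (measure_union_le _ _)
  intro ω hω
  by_contra hcon
  simp only [Set.mem_union, Set.mem_ofPred_eq, not_or, not_le] at hcon
  exact absurd (h (x := (f n ω, g n ω)) (by rw [Prod.dist_eq]; exact max_lt hcon.1 hcon.2))
    (not_lt.2 hω)

theorem tendstoInMeasure_of_tendsto [IsFiniteMeasure P] {u : ℕ → ℝ} {c : ℝ}
    (hu : Tendsto u atTop (𝓝 c)) :
    TendstoInMeasure P (fun n _ => u n) atTop fun _ => c :=
  tendstoInMeasure_of_tendsto_ae (fun _ => aestronglyMeasurable_const) (ae_of_all _ fun _ => hu)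

theorem tendstoInMeasure_of_integral_abs [IsFiniteMeasure P] {f : ℕ → Ω → ℝ} {u : ℕ → ℝ}
    (hf : ∀ᶠ n in atTop, Integrable (fun ω => |f n ω|) P ∧ ∫ ω, |f n ω| ∂P ≤ u n)
    (hu : Tendsto u atTop (𝓝 0)) : TendstoInMeasure P f atTop fun _ => 0 := by
  rw [tendstoInMeasure_iff_measureReal_norm]
  intro ε hε
  have h1 : Tendsto (fun n => u n / ε) atTop (𝓝 0) := by simpa using hu.div_const ε
  refine squeeze_zero' (Eventually.of_forall fun n => measureReal_nonneg) ?_ h1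
  filter_upwards [hf] with n hn
  rw [le_div_iff₀' hε]
  have := mul_meas_ge_le_integral_of_nonneg (ae_of_all _ fun ω => abs_nonneg (f n ω)) hn.1 ε
  simpa using this.trans hn.2

theorem tendstoInMeasure_of_integral_sq [IsFiniteMeasure P] {f : ℕ → Ω → ℝ} {u : ℕ → ℝ}
    (hf : ∀ᶠ n in atTop, Integrable (fun ω => f n ω ^ 2) P ∧ ∫ ω, f n ω ^ 2 ∂P ≤ u n)
    (hu : Tendsto u atTop (𝓝 0)) : TendstoInMeasure P f atTop fun _ => 0 := by
  have h := tendstoInMeasure_of_integral_abs (f := fun n ω => f n ω ^ 2) (u := u) (P := P)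
    (by simpa only [abs_sq] using hf) hu
  rw [tendstoInMeasure_iff_norm] at *
  intro ε hε
  refine (h (ε ^ 2) (by positivity)).congr fun n => ?_
  congr 1
  ext ω
  simp only [Set.mem_ofPred_eq, sub_zero, Real.norm_eq_abs, abs_sq]
  rw [← sq_abs (f n ω)]
  exact pow_le_pow_iff_left₀ hε.le (abs_nonneg _) two_ne_zero

theorem tendstoInMeasure_of_abs_sub_le [IsFiniteMeasure P] {f g : ℕ → Ω → ℝ} {u : ℕ → ℝ} {c : ℝ}
    (hf : TendstoInMeasure P f atTop fun _ => 0) (h : ∀ᶠ n in atTop, ∀ ω, |g n ω - u n| ≤ f n ω)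
    (hu : Tendsto u atTop (𝓝 c)) : TendstoInMeasure P g atTop fun _ => c := by
  have h0 : TendstoInMeasure P (fun n ω => g n ω - u n) atTop fun _ => 0 := by
    rw [tendstoInMeasure_iff_norm] at *
    intro ε hε
    refine tendsto_of_tendsto_of_tendsto_of_le_of_le' tendsto_const_nhds (hf ε hε)
      (Eventually.of_forall fun _ => bot_le) ?_
    filter_upwards [h] with n hn
    refine measure_mono fun ω hω => ?_
    simp only [Set.mem_ofPred_eq, sub_zero, Real.norm_eq_abs] at hω ⊢
    exact hω.trans ((hn ω).trans (le_abs_self _))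
  have := tendstoInMeasure_comp₂ h0 (tendstoInMeasure_of_tendsto (P := P) hu)
    (φ := fun p => p.1 + p.2) (by fun_prop)
  simpa using this

end ConvergenceInProbability

/-! ### Consistency of the trawl estimator, pointwise and in empirical L² -/

section Consistency

/-- Cauchy–Schwarz; injectivity of the lag maps ensures that no lag in r is counted twice. -/
theorem abs_sum_mul_le {ι : Type*} (s : Finset ι) {r : Finset ℕ} {p q : ι → ℕ}
    (hp : Set.InjOn p s) (hq : Set.InjOn q s) (hpr : ∀ i ∈ s, p i ∈ r) (hqr : ∀ i ∈ s, q i ∈ r)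
    (f g : ℕ → ℝ) (δ : ℝ) :
    |∑ i ∈ s, f (p i) * g (q i) * δ| ≤ √((∑ l ∈ r, f l ^ 2 * δ) * ∑ l ∈ r, g l ^ 2 * δ) := by
  have le : ∀ {p : ι → ℕ} (f : ℕ → ℝ), Set.InjOn p s → (∀ i ∈ s, p i ∈ r) →
      ∑ i ∈ s, f (p i) ^ 2 ≤ ∑ l ∈ r, f l ^ 2 := fun f hp hpr => by
    rw [← Finset.sum_image (f := fun l => f l ^ 2) hp]
    exact Finset.sum_le_sum_of_subset_of_nonneg (Finset.image_subset_iff.2 hpr)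
      fun _ _ _ => sq_nonneg _
  refine Real.abs_le_sqrt ?_
  rw [← Finset.sum_mul, ← Finset.sum_mul, ← Finset.sum_mul, mul_pow]
  calc (∑ i ∈ s, f (p i) * g (q i)) ^ 2 * δ ^ 2
      ≤ ((∑ i ∈ s, f (p i) ^ 2) * ∑ i ∈ s, g (q i) ^ 2) * δ ^ 2 := by
        gcongr
        exact Finset.sum_mul_sq_le_sq_mul_sq _ _ _
    _ ≤ ((∑ l ∈ r, f l ^ 2) * ∑ l ∈ r, g l ^ 2) * δ ^ 2 := by
        exact mul_le_mul_of_nonneg_right (mul_le_mul (le f hp hpr) (le g hq hqr)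
          (Finset.sum_nonneg fun _ _ => sq_nonneg _) (Finset.sum_nonneg fun _ _ => sq_nonneg _))
          (sq_nonneg δ)
    _ = _ := by ring

/-- With e = α + d, the difference of products is dd + αd + dα, each term controlled by the
empirical L² norms. One bound thus serves all three quadratic functionals. -/
theorem abs_sum_mul_sub_sum_mul_le {ι : Type*} (s : Finset ι) {r : Finset ℕ} {p q : ι → ℕ}
    (hp : Set.InjOn p s) (hq : Set.InjOn q s) (hpr : ∀ i ∈ s, p i ∈ r) (hqr : ∀ i ∈ s, q i ∈ r)
    (e α : ℕ → ℝ) {δ : ℝ} (hδ : 0 ≤ δ) {B : ℝ} (hB : ∑ l ∈ r, α l ^ 2 * δ ≤ B) :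
    |∑ i ∈ s, e (p i) * e (q i) * δ - ∑ i ∈ s, α (p i) * α (q i) * δ|
      ≤ (∑ l ∈ r, (e l - α l) ^ 2 * δ) + 2 * √(B * ∑ l ∈ r, (e l - α l) ^ 2 * δ) := by
  set E := ∑ l ∈ r, (e l - α l) ^ 2 * δ with hE
  have hE0 : 0 ≤ E := Finset.sum_nonneg fun _ _ => by positivity
  have h1 := abs_sum_mul_le s hp hq hpr hqr (fun l => e l - α l) (fun l => e l - α l) δ
  have h2 := abs_sum_mul_le s hp hq hpr hqr α (fun l => e l - α l) δ
  have h3 := abs_sum_mul_le s hp hq hpr hqr (fun l => e l - α l) α δ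
  rw [← hE] at h1 h2 h3
  rw [Real.sqrt_mul_self hE0] at h1
  have h4 : √((∑ l ∈ r, α l ^ 2 * δ) * E) ≤ √(B * E) :=
    Real.sqrt_le_sqrt (mul_le_mul_of_nonneg_right hB hE0)
  rw [mul_comm E] at h3
  have e1 : ∑ i ∈ s, e (p i) * e (q i) * δ - ∑ i ∈ s, α (p i) * α (q i) * δ
      = ∑ i ∈ s, (e (p i) - α (p i)) * (e (q i) - α (q i)) * δ
        + ∑ i ∈ s, α (p i) * (e (q i) - α (q i)) * δ
        + ∑ i ∈ s, (e (p i) - α (p i)) * α (q i) * δ := by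
    rw [← Finset.sum_add_distrib, ← Finset.sum_add_distrib, ← Finset.sum_sub_distrib]
    exact Finset.sum_congr rfl fun i _ => by ring
  rw [e1]
  refine (abs_add_three _ _ _).trans ?_
  linarith

variable {Ω : Type*} [MeasurableSpace Ω] {P : Measure Ω} [IsProbabilityMeasure P] {K c : ℝ}
  {X : Set (ℝ × ℝ) → Ω → ℝ} {a : ℝ → ℝ} {Δ : ℕ → ℝ}

theorem tendsto_inv_span (hspan : Tendsto (fun n : ℕ => (n : ℝ) * Δ n) atTop atTop) (C : ℝ) :
    Tendsto (fun n : ℕ => C * (1 / (n * Δ n) + 1 / (n * Δ n) ^ 2)) atTop (𝓝 0) := by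
  have h : Tendsto (fun n : ℕ => 1 / (n * Δ n)) atTop (𝓝 0) := tendsto_const_nhds.div_atTop hspan
  have h2 := (h.add (h.pow 2)).const_mul C
  simp only [div_pow, one_pow] at h2
  simpa using h2

theorem tendsto_natCast_div {i : ℕ → ℕ} {s : ℝ} (hΔ : Tendsto Δ atTop (𝓝[>] 0))
    (hspan : Tendsto (fun n : ℕ => (n : ℝ) * Δ n) atTop atTop)
    (hi : Tendsto (fun n => (i n : ℝ) * Δ n) atTop (𝓝 s)) :
    Tendsto (fun n : ℕ => ((i n : ℝ) + 1) / n) atTop (𝓝 0) := by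
  have h := (hi.add (tendsto_nhdsWithin_iff.1 hΔ).1).div_atTop hspan
  refine h.congr' ?_
  filter_upwards [eventually_mesh hΔ zero_lt_one] with n hn
  rw [← mul_div_mul_right _ (n : ℝ) hn.1.ne']
  ring

theorem eventually_add_one_le {i : ℕ → ℕ}
    (h : Tendsto (fun n : ℕ => ((i n : ℝ) + 1) / n) atTop (𝓝 0)) :
    ∀ᶠ n in atTop, i n + 1 ≤ n := by
  filter_upwards [h.eventually_lt_const zero_lt_one, eventually_gt_atTop 0] with n hn h0
  rw [div_lt_one (by positivity)] at hn
  exact_mod_cast hn.le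

theorem eventually_mesh_mul_le (hΔ : Tendsto Δ atTop (𝓝[>] 0)) (b : ℝ) :
    ∀ᶠ n in atTop, Δ n * b ≤ 1 := by
  have h : Tendsto (fun n => Δ n * b) atTop (𝓝 0) := by
    simpa using (tendsto_nhdsWithin_iff.1 hΔ).1.mul_const b
  exact (h.eventually_lt_const zero_lt_one).mono fun n => le_of_lt

/-- Consistency of the estimator of the trawl function. -/
theorem IsCenteredBasis.tendsto_trawlEst (hX : IsCenteredBasis P K c X) (hK : 0 ≤ K)
    (ha : IsTrawlFunction a) (hΔ : Tendsto Δ atTop (𝓝[>] 0))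
    (hspan : Tendsto (fun n : ℕ => (n : ℝ) * Δ n) atTop atTop) {i : ℕ → ℕ} {s : ℝ} (hs : 0 ≤ s)
    (hi : Tendsto (fun n => (i n : ℝ) * Δ n) atTop (𝓝 s)) :
    TendstoInMeasure P (fun n ω => trawlEst (fun k => X (trawlSetAt a (k * Δ n)) ω) n (Δ n)
      (i n * Δ n)) atTop fun _ => a s := by
  obtain ⟨C, -, hC⟩ := hX.integral_trawlEst_sub_sq_le hK ha
  have mesh := eventually_mesh hΔ zero_lt_one
  have hin := tendsto_natCast_div hΔ hspan hi
  have hi1 : Tendsto (fun n => ((i n + 1 : ℕ) : ℝ) * Δ n) atTop (𝓝 s) := by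
    have := hi.add (tendsto_nhdsWithin_iff.1 hΔ).1
    rw [add_zero] at this
    exact this.congr fun n => by push_cast; ring
  have c0 := ha.tendsto_comp hs (mesh.mono fun n hn => by have := hn.1; positivity) hi
  have c1 := ha.tendsto_comp hs (mesh.mono fun n hn => by have := hn.1; positivity) hi1
  have hu : Tendsto (fun n : ℕ => C * (1 / (n * Δ n) + 1 / (n * Δ n) ^ 2)
      + 6 * (a (i n * Δ n) - a ((i n + 1 : ℕ) * Δ n)) ^ 2
      + 6 * (((i n : ℝ) + 1) / n) ^ 2 * a (i n * Δ n) ^ 2) atTop (𝓝 0) := by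
    have := ((tendsto_inv_span hspan C).add (((c0.sub c1).pow 2).const_mul 6)).add
      (((hin.pow 2).const_mul 6).mul (c0.pow 2))
    simpa using this
  have h := tendstoInMeasure_of_integral_sq (P := P) (f := fun n ω =>
    trawlEst (fun k => X (trawlSetAt a (k * Δ n)) ω) n (Δ n) (i n * Δ n) - a (i n * Δ n)) (by
      filter_upwards [mesh, eventually_mesh_mul_le hΔ (a 0), eventually_add_one_le hin]
        with n h1 h2 h3
      exact hC _ h1.1 h2 _ _ h3) hu
  have := tendstoInMeasure_comp₂ h (tendstoInMeasure_of_tendsto (P := P) c0)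
    (φ := fun p => p.1 + p.2) (by fun_prop)
  simpa using this

/-- Consistency of the estimator of the trawl function in the empirical `L²` distance. -/
theorem IsCenteredBasis.tendsto_sum_trawlEst_sub_sq (hX : IsCenteredBasis P K c X) (hK : 0 ≤ K)
    (ha : IsTrawlFunction a) (hΔ : Tendsto Δ atTop (𝓝[>] 0))
    (hspan : Tendsto (fun n : ℕ => (n : ℝ) * Δ n) atTop atTop) {N : ℕ → ℕ}
    (hN : TuningCondition Δ N) :
    TendstoInMeasure P (fun n ω => ∑ l ∈ Finset.range (N n + 1),
      (trawlEst (fun k => X (trawlSetAt a (k * Δ n)) ω) n (Δ n) (l * Δ n) - a (l * Δ n)) ^ 2 * Δ n)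
      atTop fun _ => 0 := by
  obtain ⟨C, hC0, hC⟩ := hX.integral_trawlEst_sub_sq_le hK ha
  have mesh := eventually_mesh hΔ zero_lt_one
  have hΔ0 := (tendsto_nhdsWithin_iff.1 hΔ).1
  have inv : Tendsto (fun n : ℕ => 1 / (n : ℝ)) atTop (𝓝 0) :=
    tendsto_const_nhds.div_atTop tendsto_natCast_atTop_atTop
  have hNn : Tendsto (fun n : ℕ => ((N n : ℝ) + 1) / n) atTop (𝓝 0) := by
    have := hN.tendsto_ratio.add inv
    simpa only [← add_div, add_zero] using this
  have hA := ha.tendsto_sum_sq hΔ hN.tendsto_span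
  have hu : Tendsto (fun n : ℕ => C * (((N n : ℝ) + 1) / n) * (1 + 1 / (n * Δ n))
      + 6 * a 0 ^ 2 * Δ n + 6 * (((N n : ℝ) + 1) / n) ^ 2
        * ∑ l ∈ Finset.range (N n + 1), a (l * Δ n) ^ 2 * Δ n) atTop (𝓝 0) := by
    have h : Tendsto (fun n : ℕ => 1 / (n * Δ n)) atTop (𝓝 0) := tendsto_const_nhds.div_atTop hspan
    have := (((hNn.const_mul C).mul (h.const_add 1)).add (hΔ0.const_mul (6 * a 0 ^ 2))).add
      (((hNn.pow 2).const_mul 6).mul hA)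
    simpa using this
  refine tendstoInMeasure_of_integral_abs ?_ hu
  filter_upwards [mesh, eventually_mesh_mul_le hΔ (a 0), eventually_add_one_le hNn,
    eventually_gt_atTop 0] with n h1 h2 h3 hn0
  have hδ := h1.1
  have key := fun l (hl : l ∈ Finset.range (N n + 1)) => hC _ h1.1 h2 n l (by
    have := Finset.mem_range.1 hl; omega)
  have hn : (0 : ℝ) < n := by positivity
  have pt : ∀ l ∈ Finset.range (N n + 1), ∫ ω, (trawlEst (fun k => X (trawlSetAt a (k * Δ n)) ω)
      n (Δ n) (l * Δ n) - a (l * Δ n)) ^ 2 * Δ n ∂P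
      ≤ C / n * (1 + 1 / (n * Δ n)) + 6 * a 0 * Δ n * (a (l * Δ n) - a ((l + 1 : ℕ) * Δ n))
        + 6 * (((N n : ℝ) + 1) / n) ^ 2 * (a (l * Δ n) ^ 2 * Δ n) := fun l hl => by
    have hl' : (l : ℝ) ≤ N n := by
      have := Finset.mem_range.1 hl
      exact_mod_cast (by omega : l ≤ N n)
    have p0 : (0 : ℝ) ≤ l * Δ n := by positivity
    have p1 : (0 : ℝ) ≤ (l + 1 : ℕ) * Δ n := by positivity
    have q1 : 0 ≤ a (l * Δ n) - a ((l + 1 : ℕ) * Δ n) := sub_nonneg.2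
      (ha.antitoneOn (Set.mem_Ici.2 p0) (Set.mem_Ici.2 p1) (by gcongr; simp))
    have q2 : a (l * Δ n) - a ((l + 1 : ℕ) * Δ n) ≤ a 0 := by
      linarith [ha.le_zero p0, ha.nonneg _ p1]
    rw [integral_mul_const]
    have b := mul_le_mul_of_nonneg_right (key l hl).2 hδ.le
    -- One factor of the squared discretisation bias is bounded by a(0) and the other telescopes
    -- over l, so the total is at most a(0)², however large the number of lags.
    have b1 : (a (l * Δ n) - a ((l + 1 : ℕ) * Δ n)) ^ 2
        ≤ a 0 * (a (l * Δ n) - a ((l + 1 : ℕ) * Δ n)) := by rw [sq]; gcongr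
    have b2 : (((l : ℝ) + 1) / n) ^ 2 ≤ (((N n : ℝ) + 1) / n) ^ 2 := by gcongr
    have b3 : C * (1 / (n * Δ n) + 1 / (n * Δ n) ^ 2) * Δ n = C / n * (1 + 1 / (n * Δ n)) := by
      field_simp
    have b4 := mul_le_mul_of_nonneg_right b2 (by positivity : 0 ≤ a (l * Δ n) ^ 2 * Δ n)
    have b5 := mul_le_mul_of_nonneg_right b1 hδ.le
    linarith
  have nn : ∀ ω, 0 ≤ ∑ l ∈ Finset.range (N n + 1),
      (trawlEst (fun k => X (trawlSetAt a (k * Δ n)) ω) n (Δ n) (l * Δ n) - a (l * Δ n)) ^ 2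
        * Δ n := fun ω => Finset.sum_nonneg fun _ _ => by positivity
  simp only [abs_of_nonneg (nn _)]
  refine ⟨integrable_finsetSum _ fun l hl => (key l hl).1.mul_const _, ?_⟩
  rw [integral_finsetSum _ fun l hl => (key l hl).1.mul_const _]
  refine (Finset.sum_le_sum pt).trans ?_
  rw [Finset.sum_add_distrib, Finset.sum_add_distrib, Finset.sum_const, Finset.card_range,
    nsmul_eq_mul, ← Finset.mul_sum, ← Finset.mul_sum (a := 6 * (((N n : ℝ) + 1) / n) ^ 2),
    Finset.sum_range_sub' (fun l : ℕ => a (l * Δ n))]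
  have hlast : 0 ≤ a ((N n + 1 : ℕ) * Δ n) := ha.nonneg _ (by positivity)
  have h5 : 6 * a 0 * Δ n * (a ((0 : ℕ) * Δ n) - a ((N n + 1 : ℕ) * Δ n)) ≤ 6 * a 0 ^ 2 * Δ n := by
    rw [Nat.cast_zero, zero_mul]
    have := mul_nonneg (mul_nonneg (ha.nonneg 0 le_rfl) hδ.le) hlast
    nlinarith
  have h6 : ((N n + 1 : ℕ) : ℝ) * (C / n * (1 + 1 / (n * Δ n)))
      = C * (((N n : ℝ) + 1) / n) * (1 + 1 / (n * Δ n)) := by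
    push_cast
    ring
  rw [h6]
  exact add_le_add (add_le_add le_rfl h5) le_rfl

/-- Consistency of products of estimates along a family of pairs of lags. -/
theorem IsCenteredBasis.tendsto_sum_mul_trawlEst (hX : IsCenteredBasis P K c X) (hK : 0 ≤ K)
    (ha : IsTrawlFunction a) (hΔ : Tendsto Δ atTop (𝓝[>] 0))
    (hspan : Tendsto (fun n : ℕ => (n : ℝ) * Δ n) atTop atTop) {N : ℕ → ℕ}
    (hN : TuningCondition Δ N) {m : ℕ → ℕ} {p q : ℕ → ℕ → ℕ}
    (hpq : ∀ᶠ n in atTop, Set.InjOn (p n) (Finset.range (m n)) ∧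
      Set.InjOn (q n) (Finset.range (m n)) ∧ ∀ l < m n, p n l ≤ N n ∧ q n l ≤ N n) {I : ℝ}
    (hI : Tendsto (fun n => ∑ l ∈ Finset.range (m n), a (p n l * Δ n) * a (q n l * Δ n) * Δ n)
      atTop (𝓝 I)) :
    TendstoInMeasure P (fun n ω => ∑ l ∈ Finset.range (m n),
      trawlEst (fun k => X (trawlSetAt a (k * Δ n)) ω) n (Δ n) (p n l * Δ n)
        * trawlEst (fun k => X (trawlSetAt a (k * Δ n)) ω) n (Δ n) (q n l * Δ n) * Δ n)
      atTop fun _ => I := by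
  have hE := hX.tendsto_sum_trawlEst_sub_sq hK ha hΔ hspan hN
  have hA := ha.tendsto_sum_sq hΔ hN.tendsto_span
  set B := (∫ s in Set.Ioi (0 : ℝ), a s ^ 2) + 1
  have hφ := tendstoInMeasure_comp₂ hE hE (φ := fun x => x.1 + 2 * √(B * x.2)) (by fun_prop)
  simp only [mul_zero, Real.sqrt_zero, add_zero] at hφ
  refine tendstoInMeasure_of_abs_sub_le hφ ?_ hI
  filter_upwards [hpq, eventually_mesh hΔ zero_lt_one,
    hA.eventually_le_const (lt_add_one _)] with n h1 h2 h3 ω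
  exact abs_sum_mul_sub_sum_mul_le (Finset.range (m n)) (r := Finset.range (N n + 1)) h1.1 h1.2.1
    (fun l hl => Finset.mem_range_succ_iff.2 (h1.2.2 l (Finset.mem_range.1 hl)).1)
    (fun l hl => Finset.mem_range_succ_iff.2 (h1.2.2 l (Finset.mem_range.1 hl)).2)
    (fun l => trawlEst (fun k => X (trawlSetAt a (k * Δ n)) ω) n (Δ n) (l * Δ n))
    (fun l => a (l * Δ n)) h2.1.le h3

end Consistency

/-! ### Consistency of the quarticity -/

section Quarticity

variable {Ω : Type*} [MeasurableSpace Ω] {P : Measure Ω} [IsProbabilityMeasure P] {K c : ℝ}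
  {X : Set (ℝ × ℝ) → Ω → ℝ} {a : ℝ → ℝ} {Δ : ℕ → ℝ}

theorem IsCenteredBasis.integral_abs_quarticity_sub_le (hX : IsCenteredBasis P K c X) (hK : 0 ≤ K)
    (ha : IsTrawlFunction a) {δ v : ℝ} (hδ : 0 < δ) (hv : v = gridCov a δ 0 - gridCov a δ 1)
    (h0 : 0 < v) (h1 : v ≤ 1) {ε : ℝ} (hε : 0 < ε)
    (hεv : ∀ E, IsBoundedBorel E → volume.real E = v →
      |(∫ ω, X E ω ^ 4 ∂P) - c * v| ≤ ε * v) {n : ℕ} (hn : 0 < n) :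
    Integrable (fun ω => |quarticity (fun k => X (trawlSetAt a (k * δ)) ω) n δ
      - (n - 1 : ℕ) / n * c * (v / δ)|) P ∧
    ∫ ω, |quarticity (fun k => X (trawlSetAt a (k * δ)) ω) n δ
      - (n - 1 : ℕ) / n * c * (v / δ)| ∂P
      ≤ (8 * (1 + K) * √v + 3 * v + ε + 2 * K * ε) * (v / δ) + ε
        + (1 / ε) ^ 5 * K * (v / δ) * (1 / (n * δ)) := by
  have hA := isStationarySequence_trawlSetAt ha hδ.le
  set A : ℕ → Set (ℝ × ℝ) := fun k => trawlSetAt a (k * δ) with hAdef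
  have hn' : (0 : ℝ) < n := by positivity
  -- Truncating at M = 1/ε makes the excess of order ε, and η = ε n δ becomes ε after normalisation;
  -- the variance term keeps a factor 1/(nδ), which vanishes for fixed ε.
  obtain ⟨iS, bS⟩ := hX.integral_abs_sum_sub_pow_four_le hK (Finset.range (n - 1))
    hA.isBoundedBorel_gain hA.isBoundedBorel_loss hA.pairwise_disjoint_gain
    hA.pairwise_disjoint_loss (fun k => hA.disjoint_gain_loss le_rfl)
    (fun k => (hA.volume_gain k).trans hv.symm) (fun k => (hA.volume_loss k).trans hv.symm)
    h0 h1 hεv (M := 1 / ε) (η := ε * (n * δ)) (by positivity) (by positivity)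
  rw [Finset.card_range] at iS bS
  have eq : ∀ᵐ ω ∂P, (1 / (2 * (n * δ))) * |∑ k ∈ Finset.range (n - 1),
      (X (gain A k) ω - X (loss A k) ω) ^ 4 - (n - 1 : ℕ) * (2 * c * v)|
      = |quarticity (fun k => X (A k) ω) n δ - (n - 1 : ℕ) / n * c * (v / δ)| := by
    filter_upwards [hX.ae_sub_eq hA] with ω hω
    rw [← abs_of_pos (by positivity : 0 < 1 / (2 * (n * δ))), ← abs_mul]
    congr 1
    simp only [quarticity, hω]
    field_simp
  refine ⟨(iS.const_mul _).congr eq, ?_⟩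
  rw [← integral_congr_ae eq, integral_const_mul]
  have hcard : ((n - 1 : ℕ) : ℝ) ≤ n := by exact_mod_cast Nat.sub_le _ _
  calc _ ≤ 1 / (2 * (n * δ)) * (n * (16 * (1 + K) * v * √v + 6 * v ^ 2 + 2 * ε * v)
        + 2 * (n * (2 * K * v / (1 / ε)) + ε * (n * δ)
          + n * ((1 / ε) ^ 4 * K * v) / (ε * (n * δ)))) := by
        refine mul_le_mul_of_nonneg_left (bS.trans ?_) (by positivity)
        gcongr
    _ = _ := by
        field_simp
        ring

/-- Consistency of the quarticity. -/
theorem IsCenteredBasis.tendsto_quarticity (hX : IsCenteredBasis P K c X) (hK : 0 ≤ K)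
    (ha : IsTrawlFunction a) (ha0 : 0 < a 0) (hΔ : Tendsto Δ atTop (𝓝[>] 0))
    (hspan : Tendsto (fun n : ℕ => (n : ℝ) * Δ n) atTop atTop) :
    TendstoInMeasure P (fun n ω => quarticity (fun k => X (trawlSetAt a (k * Δ n)) ω) n (Δ n))
      atTop fun _ => c * a 0 := by
  set v : ℕ → ℝ := fun n => gridCov a (Δ n) 0 - gridCov a (Δ n) 1 with hvdef
  have mesh := eventually_mesh hΔ zero_lt_one
  have hΔ0 := (tendsto_nhdsWithin_iff.1 hΔ).1
  have ca : Tendsto (fun n => a (Δ n)) atTop (𝓝 (a 0)) :=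
    ha.tendsto_comp le_rfl (mesh.mono fun n hn => hn.1.le) hΔ0
  have bounds : ∀ᶠ n in atTop, Δ n * a (Δ n) ≤ v n ∧ v n ≤ Δ n * a 0 :=
    mesh.mono fun n hn => by
      simpa only [Nat.cast_zero, zero_mul, zero_add, Nat.cast_one, one_mul]
        using gridCov_sub ha hn.1.le 0
  have hvΔ : Tendsto (fun n => v n / Δ n) atTop (𝓝 (a 0)) := by
    refine tendsto_of_tendsto_of_tendsto_of_le_of_le' ca tendsto_const_nhds ?_ ?_
    · filter_upwards [mesh, bounds] with n hn hb
      rw [le_div_iff₀ hn.1]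
      linarith [hb.1]
    · filter_upwards [mesh, bounds] with n hn hb
      rw [div_le_iff₀ hn.1]
      linarith [hb.2]
  have hv0 : Tendsto v atTop (𝓝 0) := by
    have := hvΔ.mul hΔ0
    rw [mul_zero] at this
    refine this.congr' ?_
    filter_upwards [mesh] with n hn
    rw [div_mul_cancel₀ _ hn.1.ne']
  have vpos : ∀ᶠ n in atTop, 0 < v n := by
    filter_upwards [mesh, bounds, ca.eventually_const_lt ha0] with n hn hb h
    exact (mul_pos hn.1 h).trans_le hb.1
  have hinv : Tendsto (fun n : ℕ => 1 / (n * Δ n)) atTop (𝓝 0) := tendsto_const_nhds.div_atTop hspan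
  set D : ℕ → Ω → ℝ := fun n ω => quarticity (fun k => X (trawlSetAt a (k * Δ n)) ω) n (Δ n)
    - (n - 1 : ℕ) / n * c * (v n / Δ n) with hD
  have key : ∀ ε > 0, ∀ᶠ n in atTop, Integrable (fun ω => |D n ω|) P ∧
      ∫ ω, |D n ω| ∂P ≤ (8 * (1 + K) * √(v n) + 3 * v n + ε + 2 * K * ε) * (v n / Δ n) + ε
        + (1 / ε) ^ 5 * K * (v n / Δ n) * (1 / (n * Δ n)) := fun ε hε => by
    obtain ⟨d, hd, h⟩ := hX.pow_four_asymptotics ε hε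
    filter_upwards [mesh, vpos, hv0.eventually_lt_const hd, hv0.eventually_le_const zero_lt_one,
      eventually_gt_atTop 0] with n h1 h2 h3 h4 h5
    exact hX.integral_abs_quarticity_sub_le hK ha h1.1 rfl h2 h4 hε (fun E hE hEv => by
      have := h E hE (by rwa [hEv]) (by rwa [hEv])
      rwa [hEv] at this) h5
  have lim : ∀ ε, Tendsto (fun n : ℕ => (8 * (1 + K) * √(v n) + 3 * v n + ε + 2 * K * ε)
      * (v n / Δ n) + ε + (1 / ε) ^ 5 * K * (v n / Δ n) * (1 / (n * Δ n))) atTop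
      (𝓝 (((1 + 2 * K) * a 0 + 1) * ε)) := fun ε => by
    have h1 := ((((hv0.sqrt.const_mul (8 * (1 + K))).add (hv0.const_mul 3)).add_const ε).add_const
      (2 * K * ε)).mul hvΔ
    have h2 := (h1.add_const ε).add (((hvΔ.const_mul ((1 / ε) ^ 5 * K))).mul hinv)
    convert h2 using 2
    rw [Real.sqrt_zero]
    ring
  have hpos : 0 < (1 + 2 * K) * a 0 + 1 := by positivity
  have hD1 : Tendsto (fun n => ∫ ω, |D n ω| ∂P) atTop (𝓝 0) := by
    rw [Metric.tendsto_atTop']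
    intro ε hε
    -- For fixed ε' the error bound tends to ((1 + 2K) a(0) + 1) ε', which this choice makes ε/2.
    set ε' := ε / (2 * ((1 + 2 * K) * a 0 + 1)) with hε'
    have hlt : ((1 + 2 * K) * a 0 + 1) * ε' < ε := by
      rw [hε']
      field_simp
      norm_num
    obtain ⟨M, hM⟩ := eventually_atTop.1
      ((key ε' (by positivity)).and ((lim ε').eventually_lt_const hlt))
    refine ⟨M, fun n hn => ?_⟩
    rw [Real.dist_eq, sub_zero, abs_of_nonneg (integral_nonneg fun ω => abs_nonneg _)]
    exact (hM n hn.le).1.2.trans_lt (hM n hn.le).2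
  have hDm : TendstoInMeasure P D atTop fun _ => 0 :=
    tendstoInMeasure_of_integral_abs ((key 1 one_pos).mono fun n h => ⟨h.1, le_rfl⟩) hD1
  have hdet : Tendsto (fun n : ℕ => ((n - 1 : ℕ) : ℝ) / n * c * (v n / Δ n)) atTop
      (𝓝 (c * a 0)) := by
    have h1 : Tendsto (fun n : ℕ => 1 - 1 / (n : ℝ)) atTop (𝓝 1) := by
      simpa using (tendsto_const_nhds (x := (1 : ℝ))).sub
        ((tendsto_const_nhds (x := (1 : ℝ))).div_atTop tendsto_natCast_atTop_atTop)
    have h2 := (h1.mul_const c).mul hvΔ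
    rw [one_mul] at h2
    refine h2.congr' ?_
    filter_upwards [eventually_gt_atTop 0] with n hn
    have : (n : ℝ) ≠ 0 := by positivity
    rw [Nat.cast_pred hn, sub_div (n : ℝ), div_self this]
  have := tendstoInMeasure_comp₂ hDm (tendstoInMeasure_of_tendsto (P := P) hdet)
    (φ := fun p => p.1 + p.2) (by fun_prop)
  simpa [hD] using this

end Quarticity

/-! ### Assembly of the plug-in estimator -/

section PlugIn

/-- The decay of φ is needed to make it integrable: the Bochner integral of a non-integrable
function is 0 by default, and positivity would be lost. -/
theorem TrawlCondition.zero_pos {a : ℝ → ℝ} (h : TrawlCondition a) : 0 < a 0 := by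
  obtain ⟨φ, hc, hpos, ⟨α, hα, hO⟩, hφ⟩ := h
  have hi : IntegrableOn φ (Set.Ici 0) :=
    (hc.locallyIntegrableOn measurableSet_Ici).integrableOn_of_isBigO_atTop hO
      ⟨Set.Ioi 1, Ioi_mem_atTop 1, integrableOn_Ioi_rpow_of_lt (by linarith) one_pos⟩
  rw [hφ 0 le_rfl, setIntegral_pos_iff_support_of_nonneg_ae
    ((ae_restrict_iff' measurableSet_Ioi).2 (ae_of_all _ fun s hs => (hpos s (le_of_lt hs)).le))
    (hi.mono_set Set.Ioi_subset_Ici_self),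
    show Function.support φ ∩ Set.Ioi 0 = Set.Ioi 0 from
      Set.inter_eq_right.2 fun s hs => (hpos s (le_of_lt hs)).ne']
  simp

variable {Ω Ω' : Type*} [MeasurableSpace Ω] [MeasurableSpace Ω'] {P : Measure Ω}
  [IsProbabilityMeasure P] {P' : Measure Ω'} [IsProbabilityMeasure P'] {T : LevyTriplet}
  {L : Set (ℝ × ℝ) → Ω → ℝ} {L' : Ω' → ℝ}

/-- Both laws have characteristic function exp ψ; in this way the moment assumptions on the seed
reach the basis. -/
theorem IsLevySeed.map_eq (hL' : IsLevySeed P' T L') (hL : IsHomogeneousLevyBasis P T L) :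
    P'.map L' = P.map (L (rectangle 1)) := by
  have hr := isBoundedBorel_rectangle 1
  have := Measure.isProbabilityMeasure_map (μ := P') hL'.measurable.aemeasurable
  have := Measure.isProbabilityMeasure_map (μ := P) (hL.measurable _ hr).aemeasurable
  refine Measure.ext_of_charFun (funext fun z => ?_)
  rw [hL'.charFun_eq, hL.charFun_eq _ hr, volume_rectangle]
  simp

theorem IsLevySeed.isCenteredBasis (hL' : IsLevySeed P' T L') (hL : IsHomogeneousLevyBasis P T L)
    (hvar : Var[L'; P'] = 1) {p : ℝ} (hp : 5 ≤ p) (hmom : Integrable (fun ω => |L' ω| ^ p) P') :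
    ∃ K, 0 ≤ K ∧ IsCenteredBasis P K T.c4 (centered P L) := by
  have hp0 : 0 < p := by linarith
  have hLp : MemLp L' (ENNReal.ofReal p) P' := by
    rw [← integrable_norm_rpow_iff hL'.measurable.aestronglyMeasurable (by simpa using hp0)
      ENNReal.ofReal_ne_top, ENNReal.toReal_ofReal hp0.le]
    exact hmom
  refine hL.isCenteredBasis ?_ ?_
  · rw [← hL'.map_eq hL, memLp_map_measure_iff (by fun_prop) hL'.measurable.aemeasurable]
    refine hLp.mono_exponent ?_
    rw [← ENNReal.ofReal_ofNat]
    exact ENNReal.ofReal_le_ofReal hp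
  · rw [← hL'.map_eq hL, variance_id_map hL'.measurable.aemeasurable, hvar]

variable {K c : ℝ} {X : Set (ℝ × ℝ) → Ω → ℝ} {a : ℝ → ℝ} {Δ : ℕ → ℝ} {N : ℕ → ℕ} {t : ℝ}

theorem TuningCondition.eventually_two_mul_gridIndex_le (hN : TuningCondition Δ N)
    (hΔ : Tendsto Δ atTop (𝓝[>] 0)) (ht : 0 ≤ t) :
    ∀ᶠ n in atTop, 2 * gridIndex (Δ n) t ≤ N n := by
  filter_upwards [eventually_mesh hΔ zero_lt_one, hN.tendsto_span.eventually_ge_atTop (2 * t)]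
    with n h1 h2
  have h3 := floor_div_mul_le ht h1.1
  have h4 : (2 * (gridIndex (Δ n) t : ℝ)) * Δ n ≤ N n * Δ n := by
    rw [gridIndex]
    linarith
  exact_mod_cast le_of_mul_le_mul_right h4 h1.1

theorem v2_eq (x : ℕ → ℝ) (n : ℕ) (δ : ℝ) (M : ℕ) :
    v2 x n δ M = 2 * ∑ l ∈ Finset.range (M + 1),
      trawlEst x n δ (l * δ) * trawlEst x n δ (l * δ) * δ := by
  simp only [v2, Nat.range_succ_eq_Icc_zero, sq]

/-- The minimum in the range is then attained by the grid index, and the lag differences are genuine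
natural numbers. -/
theorem v3_eq (x : ℕ → ℝ) {n : ℕ} {δ t : ℝ} (h : 2 * gridIndex δ t + 1 ≤ n) :
    v3 x n δ t = 2 * ∑ l ∈ Finset.range (gridIndex δ t + 1),
      trawlEst x n δ ((gridIndex δ t - l : ℕ) * δ)
        * trawlEst x n δ ((gridIndex δ t + l : ℕ) * δ) * δ := by
  rw [v3, min_eq_left (by omega), ← Nat.range_succ_eq_Icc_zero]
  congr 1
  refine Finset.sum_congr rfl fun l hl => ?_
  rw [Nat.cast_sub (Finset.mem_range_succ_iff.1 hl), Nat.cast_add]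

/-- Reindexing by the distance from the grid index turns the pairs of lags into (l, l + 2i), the
form of `tendsto_sum_mul_shifted`. -/
theorem v4_eq (x : ℕ → ℝ) (n : ℕ) {δ t : ℝ} {M : ℕ} (h : 2 * gridIndex δ t ≤ M) :
    v4 x n δ M t = -(2 * ∑ l ∈ Finset.range (M - 2 * gridIndex δ t + 1),
      trawlEst x n δ (l * δ) * trawlEst x n δ ((l + 2 * gridIndex δ t : ℕ) * δ) * δ) := by
  rw [v4, ← Finset.Ico_add_one_right_eq_Icc, Finset.sum_Ico_eq_sum_range,
    show M - gridIndex δ t + 1 - gridIndex δ t = M - 2 * gridIndex δ t + 1 by omega]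
  congr 2
  refine Finset.sum_congr rfl fun l _ => ?_
  push_cast
  ring_nf

/-- Consistency of the plug-in estimator for a centred basis. -/
theorem IsCenteredBasis.tendsto_avarEst (hX : IsCenteredBasis P K T.c4 X) (hK : 0 ≤ K)
    (ha : IsTrawlFunction a) (ha0 : 0 < a 0) (hΔ : Tendsto Δ atTop (𝓝[>] 0))
    (hspan : Tendsto (fun n : ℕ => (n : ℝ) * Δ n) atTop atTop) (hN : TuningCondition Δ N)
    (ht : 0 < t) :
    TendstoInMeasure P (fun n ω => avarEst (fun k => X (trawlSetAt a (k * Δ n)) ω) n (Δ n) (N n) t)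
      atTop fun _ => avar T a t := by
  have mesh := eventually_mesh hΔ ht
  have hi := tendsto_floor_div_mul hΔ ht.le
  have hiN := hN.eventually_two_mul_gridIndex_le hΔ ht.le
  have hin : ∀ᶠ n in atTop, 2 * gridIndex (Δ n) t + 1 ≤ n := by
    refine eventually_add_one_le (tendsto_natCast_div (s := 2 * t) hΔ hspan ?_)
    refine (hi.const_mul 2).congr fun n => ?_
    push_cast [gridIndex]
    ring
  have e0 := hX.tendsto_trawlEst hK ha hΔ hspan (i := fun _ => 0) le_rfl (by simp)
  simp only [Nat.cast_zero, zero_mul] at e0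
  have et := hX.tendsto_trawlEst hK ha hΔ hspan ht.le hi
  have hQ := hX.tendsto_quarticity hK ha ha0 hΔ hspan
  -- The quotient is continuous at the limit point because a(0) > 0; there c₄ a(0) / a(0) = c₄.
  have h1 := tendstoInMeasure_comp₂ (tendstoInMeasure_comp₂ hQ e0 (φ := fun p => p.1 / p.2)
    (ContinuousAt.div continuousAt_fst continuousAt_snd ha0.ne')) et (φ := fun p => p.1 * p.2)
    (by fun_prop)
  simp only [mul_div_assoc, div_self ha0.ne', mul_one] at h1
  have h2 := hX.tendsto_sum_mul_trawlEst hK ha hΔ hspan hN (m := fun n => N n + 1)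
    (p := fun _ l => l) (q := fun _ l => l) (Eventually.of_forall fun n =>
      ⟨fun _ _ _ _ h => h, fun _ _ _ _ h => h, fun l hl => by omega⟩)
    (by simpa only [← sq] using ha.tendsto_sum_sq hΔ hN.tendsto_span)
  have h3 := hX.tendsto_sum_mul_trawlEst hK ha hΔ hspan hN
    (m := fun n => gridIndex (Δ n) t + 1) (p := fun n l => gridIndex (Δ n) t - l)
    (q := fun n l => gridIndex (Δ n) t + l) (hiN.mono fun n hn => ⟨fun l hl k hk h => by
      have := Finset.mem_range.1 hl
      have := Finset.mem_range.1 hk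
      simp only at h
      omega, fun l _ k _ h => by simpa using h, fun l hl => by omega⟩)
    (ha.tendsto_sum_mul_reflected hΔ ht)
  have h4 := hX.tendsto_sum_mul_trawlEst hK ha hΔ hspan hN
    (m := fun n => N n - 2 * gridIndex (Δ n) t + 1) (p := fun _ l => l)
    (q := fun n l => l + 2 * gridIndex (Δ n) t) (hiN.mono fun n hn => ⟨fun _ _ _ _ h => h,
      fun l _ k _ h => by simpa using h, fun l hl => by omega⟩)
    (ha.tendsto_sum_mul_shifted hΔ hN.tendsto_span ht)
  have key := tendstoInMeasure_comp₂ (tendstoInMeasure_comp₂ h1 h2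
    (φ := fun p => p.1 + 2 * p.2) (by fun_prop)) (tendstoInMeasure_comp₂ h3 h4
    (φ := fun p => 2 * p.1 + -(2 * p.2)) (by fun_prop)) (φ := fun p => p.1 + p.2) (by fun_prop)
  refine (key.congr' ?_ (ae_of_all _ fun ω => ?_))
  · filter_upwards [mesh, hiN, hin] with n g1 g2 g3
    refine ae_of_all _ fun ω => ?_
    simp only [avarEst, v1, c4Est, v2_eq, v3_eq _ g3, v4_eq _ n g2,
      trawlEst_gridIndex _ n g1.1 g1.2]
    rw [gridIndex]
    ring
  · simp only [avar]
    ring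

/-- All trawl sets have the same area, hence the same mean, so centring the basis subtracts one
constant from all observations. -/
theorem centered_trawlSetAt (hL : IsHomogeneousLevyBasis P T L) (ha : IsTrawlFunction a) {δ : ℝ}
    (hδ : 0 ≤ δ) (k : ℕ) (ω : Ω) :
    centered P L (trawlSetAt a (k * δ)) ω
      = trawlProcess L a (k * δ) ω - ∫ ω, L (trawlSetAt a 0) ω ∂P := by
  have hA := isStationarySequence_trawlSetAt ha hδ
  have h0 : IsBoundedBorel (trawlSetAt a 0) := by simpa using hA.isBoundedBorel 0
  have hv : volume.real (trawlSetAt a (k * δ)) = volume.real (trawlSetAt a 0) := by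
    simpa using (hA.volume_eq k).trans (hA.volume_eq 0).symm
  have hm : ∀ A, IsBoundedBorel A →
      ∫ ω, L A ω ∂P = ∫ x, x ∂P.map (L (rectangle (volume.real A))) := fun A hA => by
    rw [← hL.map_eq hA, integral_map (hL.measurable A hA).aemeasurable (by fun_prop)]
  rw [centered, trawlProcess, hm _ (hA.isBoundedBorel k), hm _ h0, hv]

end PlugIn

end Trawl

theorem mainTheorem6 {Ω Ω' : Type*} [MeasurableSpace Ω] [MeasurableSpace Ω']
    (P : Measure Ω) [IsProbabilityMeasure P] (P' : Measure Ω') [IsProbabilityMeasure P']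
    (T : Trawl.LevyTriplet)
    (L : Set (ℝ × ℝ) → Ω → ℝ) (hL : Trawl.IsHomogeneousLevyBasis P T L)
    (L' : Ω' → ℝ) (hL' : Trawl.IsLevySeed P' T L')
    (hvar : Var[L'; P'] = 1)
    (p₀ : ℝ) (hp₀ : 16 / 3 ≤ p₀) (hmom : Integrable (fun ω => |L' ω| ^ p₀) P')
    (a : ℝ → ℝ) (ha : Trawl.IsTrawlFunction a) (htrawl : Trawl.TrawlCondition a)
    (Δ : ℕ → ℝ) (μ : ℝ) (hΔ : Trawl.SamplingScheme Δ μ)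
    (N : ℕ → ℕ) (hN : Trawl.TuningCondition Δ N)
    (t : ℝ) (ht : 0 < t) :
    TendstoInMeasure P
      (fun (n : ℕ) (ω : Ω) =>
        Trawl.avarEst (fun k : ℕ => Trawl.trawlProcess L a (k * Δ n) ω) n (Δ n) (N n) t)
      atTop (fun _ => Trawl.avar T a t) := by
  -- The argument works with fifth moments, and 5 ≤ 16/3.
  obtain ⟨K, hK, hX⟩ := hL'.isCenteredBasis hL hvar (by linarith) hmom
  refine (hX.tendsto_avarEst hK ha htrawl.zero_pos hΔ.tendsto_zero hΔ.tendsto_span hN ht).congr'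
    ?_ (ae_of_all _ fun _ => rfl)
  filter_upwards [Trawl.eventually_mesh hΔ.tendsto_zero zero_lt_one, eventually_gt_atTop 0]
    with n h1 h2
  refine ae_of_all _ fun ω => ?_
  simp only [Trawl.centered_trawlSetAt hL ha h1.1.le]
  exact Trawl.avarEst_sub_const _ _ h2 _ _ _
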